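/- **Conventions.** Let $[\![m]\!]=1+q^2+\cdots+q^{2(m-1)}$, $[\![m]\!]!=[\![1]\!]\cdots[\![m]\!]$ and, for $0\le k\le m$, ${m\brack k}=\dfrac{[\![m]\!]!}{[\![k]\!]!\,[\![m-k]\!]!}\in\mathbb Z[q]$. For a $\mathbb Z$-graded commutative $\mathbb C$-algebra $A$ and a graded $A$-module $M$, let $M\langle d\rangle$ be $M$ with its grading shifted up by $d$, i.e. $M\langle d\rangle_i=M_{i-d}$; morphisms of graded modules are the $A$-linear maps of degree $0$. The Grothendieck group of the category of finite-dimensional graded $A$-modules is a $\mathbb Z[q,q^{-1}]$-module via $q^d[M]=[M\langle d\rangle]$. For graded modules $M,N$ write $\operatorname{Ext}^i_A(M,N)_d=\operatorname{Ext}^i(M,N\langle d\rangle)$, where the right-hand side is Ext in the category of graded $A$-modules; the graded Euler characteristic of $\operatorname{Ext}^*_A(M,N)$ is $\sum_{d}\bigl(\sum_{i}(-1)^i\dim_{\mathbb C}\operatorname{Ext}^i_A(M,N)_d\bigr)q^d\in\mathbb Z[[q]][q^{-1}]$. Let $n\ge 1$ and let $H_n=\mathbb C[x_1,\dots,x_n]/I$,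 where $I$ is generated by the symmetric polynomials without constant term and every $x_i$ has degree $2$ (the cohomology ring of the full flag variety). Let $\mathbb C$ denote the trivial module, concentrated in degree $0$, on which every $x_i$ acts by $0$. **Theorem.** (i) $H_n$ is finite-dimensional, and $[H_n]=[\![n]\!]!\,[\mathbb C]$ in the Grothendieck group of finite-dimensional graded $H_n$-modules. (ii) If $n\ge2$, every projective resolution of the module $\mathbb C$ is infinite (both for graded and for ungraded $H_n$-modules). For all $n\ge 1$, a minimal graded projective resolution $P_\bullet\to\mathbb C$ exists (minimal meaning that each differential $P_{i+1}\to P_i$ has image in $\mathfrak m P_i$, where $\mathfrak m\subset H_n$ is the ideal generated by the $x_j$), and for every such resolution $P_i\cong\bigoplus_d H_n\langle d\rangle^{b_{i,d}}$, where, for each $i$, the numbers $b_{i,d}$ ($d\in\mathbb Z$) are almost all zero, and they have the generating series $$\sum_{i,d}b_{i,d}\,q^dt^i=\frac{(1+q^2t)^{n-1}}{\prod_{j=2}^n(1-q^{2j}t^2)} .$$ (iii) All $\operatorname{Ext}^i_{H_n}(\mathbb C,\mathbb C)_d$ are finite-dimensional, for fixed $d$ only finitely many of them are non-zero, and the graded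 Euler characteristic of $\operatorname{Ext}^*_{H_n}(\mathbb C,\mathbb C)$ is $\dfrac1{[\![n]\!]!}$. (iv) Let $0\le k\le n$ and let $H_{k,n-k}$ be the cohomology ring of the Grassmannian of $k$-planes in $\mathbb C^n$, that is, the graded ring $\mathbb C[c_1,\dots,c_k,c'_1,\dots,c'_{n-k}]$, with $c_i$ and $c'_i$ of degree $2i$, modulo the homogeneous components of positive degree of $(1+c_1+\cdots+c_k)(1+c'_1+\cdots+c'_{n-k})$. Let $\mathbb C$ be its trivial module, concentrated in degree $0$. Then $H_{k,n-k}$ is finite-dimensional, $[H_{k,n-k}]={n\brack k}[\mathbb C]$ in the Grothendieck group of finite-dimensional graded $H_{k,n-k}$-modules, the finiteness statements of (iii) hold for $\operatorname{Ext}^*_{H_{k,n-k}}(\mathbb C,\mathbb C)$, and its graded Euler characteristic is $1/{n\brack k}$. -/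

import Mathlib

open CategoryTheory Limits

noncomputable section

section Internal

variable {k M : Type*} [CommRing k] [AddCommGroup M] [Module k M]

/-- A family of submodules is an internal grading as soon as there are linear maps `p i` that are
the identity on the `i`-th one and vanish on the others, and the submodules span. -/
theorem isInternal_of_proj (deg : ℤ → Submodule k M) (p : ℤ → M →ₗ[k] M)
    (h1 : ∀ i x, x ∈ deg i → p i x = x) (h2 : ∀ i j x, x ∈ deg j → j ≠ i → p i x = 0)
    (h3 : ∀ x, x ∈ ⨆ i, deg i) : DirectSum.IsInternal deg := by
  rw [DirectSum.isInternal_submodule_iff_iSupIndep_and_iSup_eq_top]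
  refine ⟨fun i => ?_, (Submodule.eq_top_iff').2 h3⟩
  rw [Submodule.disjoint_def]
  intro x hx hx'
  have hle : (⨆ (j) (_ : j ≠ i), deg j) ≤ LinearMap.ker (p i) :=
    iSup₂_le fun j hj x hx => h2 i j x hx hj
  rw [← h1 i x hx]
  exact hle hx'

/-- The homogeneous component of degree `i`, for an internal grading. -/
def internalProj (deg : ℤ → Submodule k M) (h : DirectSum.IsInternal deg) (i : ℤ) : M →ₗ[k] M :=
  letI := h.chooseDecomposition
  (deg i).subtype ∘ₗ DirectSum.component k ℤ (fun i => deg i) i ∘ₗ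
    (DirectSum.decomposeLinearEquiv deg).toLinearMap

variable {deg : ℤ → Submodule k M} (h : DirectSum.IsInternal deg)

theorem internalProj_mem (i : ℤ) (x : M) : internalProj deg h i x ∈ deg i := by
  simp [internalProj]

theorem internalProj_same {i : ℤ} {x : M} (hx : x ∈ deg i) : internalProj deg h i x = x := by
  let := h.chooseDecomposition
  exact DirectSum.decompose_of_mem_same deg hx

theorem internalProj_ne {i j : ℤ} {x : M} (hx : x ∈ deg j) (hij : j ≠ i) :
    internalProj deg h i x = 0 := by
  let := h.chooseDecomposition
  exact DirectSum.decompose_of_mem_ne deg hx hij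

theorem internal_induction (h : DirectSum.IsInternal deg) {P : M → Prop} (h0 : P 0) (hadd : ∀ x y, P x → P y → P (x + y))
    (hom : ∀ i, ∀ x ∈ deg i, P x) (x : M) : P x := by
  have hx : x ∈ ⨆ i, deg i := by
    rw [((DirectSum.isInternal_submodule_iff_iSupIndep_and_iSup_eq_top deg).1 h).2]; trivial
  exact Submodule.iSup_induction deg (motive := P) hx hom h0 hadd

end Internal

/-- A `ℤ`-graded module over the `ℤ`-graded commutative `k`-algebra `A = ⨁ 𝒜 i`. -/
structure GrMod {k A : Type} [CommRing k] [CommRing A] [Algebra k A] (𝒜 : ℤ → Submodule k A) where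
  carrier : Type
  [addCommGroup : AddCommGroup carrier]
  [module : Module A carrier]
  [moduleBase : Module k carrier]
  [isScalarTower : IsScalarTower k A carrier]
  /-- The homogeneous pieces. -/
  deg : ℤ → Submodule k carrier
  smul_mem : ∀ {i j : ℤ} {a : A} {x : carrier}, a ∈ 𝒜 i → x ∈ deg j → a • x ∈ deg (i + j)
  isInternal : DirectSum.IsInternal deg

namespace GrMod

attribute [instance] addCommGroup module moduleBase isScalarTower

variable {k A : Type} [CommRing k] [CommRing A] [Algebra k A] {𝒜 : ℤ → Submodule k A}

/-- The `k`-module of `A`-linear maps of degree `0`. -/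
def homSubmodule (M N : GrMod 𝒜) : Submodule k (M.carrier →ₗ[A] N.carrier) where
  carrier := {f | ∀ i, ∀ x ∈ M.deg i, f x ∈ N.deg i}
  add_mem' hf hg i x hx := (N.deg i).add_mem (hf i x hx) (hg i x hx)
  zero_mem' i _ _ := (N.deg i).zero_mem
  smul_mem' c _ hf i x hx := (N.deg i).smul_mem c (hf i x hx)

/-- The category of graded modules: the morphisms are the `A`-linear maps of degree `0`. -/
instance : Category (GrMod 𝒜) where
  Hom M N := homSubmodule M N
  id M := ⟨LinearMap.id, fun _ _ hx => hx⟩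
  comp f g := ⟨g.1 ∘ₗ f.1, fun i x hx => g.2 i _ (f.2 i x hx)⟩

variable {M N P : GrMod 𝒜}

/-- The underlying `A`-linear map of a morphism. -/
def lin (f : M ⟶ N) : M.carrier →ₗ[A] N.carrier := f.1

/-- A degree `0` linear map as a morphism. -/
def ofLin (f : M.carrier →ₗ[A] N.carrier) (hf : ∀ i, ∀ x ∈ M.deg i, f x ∈ N.deg i) : M ⟶ N :=
  ⟨f, hf⟩

theorem lin_mem (f : M ⟶ N) {i : ℤ} {x : M.carrier} (hx : x ∈ M.deg i) : lin f x ∈ N.deg i :=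
  f.2 i x hx

@[simp] theorem lin_ofLin (f : M.carrier →ₗ[A] N.carrier)
    (hf : ∀ i, ∀ x ∈ M.deg i, f x ∈ N.deg i) : lin (ofLin f hf) = f := rfl

@[simp] theorem lin_id : lin (𝟙 M) = LinearMap.id := rfl

@[simp] theorem lin_comp (f : M ⟶ N) (g : N ⟶ P) : lin (f ≫ g) = lin g ∘ₗ lin f := rfl

theorem lin_comp_apply (f : M ⟶ N) (g : N ⟶ P) (x : M.carrier) :
    lin (f ≫ g) x = lin g (lin f x) := rfl

theorem lin_injective : Function.Injective (lin : (M ⟶ N) → _) := fun _ _ h => Subtype.ext h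

theorem hom_ext {f g : M ⟶ N} (h : ∀ x, lin f x = lin g x) : f = g :=
  lin_injective (LinearMap.ext h)

instance (M N : GrMod 𝒜) : AddCommGroup (M ⟶ N) := inferInstanceAs (AddCommGroup (homSubmodule M N))

instance (M N : GrMod 𝒜) : Module k (M ⟶ N) := inferInstanceAs (Module k (homSubmodule M N))

@[simp] theorem lin_zero : lin (0 : M ⟶ N) = 0 := rfl

@[simp] theorem lin_add (f g : M ⟶ N) : lin (f + g) = lin f + lin g := rfl

@[simp] theorem lin_smul (c : k) (f : M ⟶ N) : lin (c • f) = c • lin f := rfl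

instance : Preadditive (GrMod 𝒜) where
  add_comp _ _ _ f f' g := hom_ext fun x => by simp
  comp_add _ _ _ f g g' := hom_ext fun x => by simp

instance : Linear k (GrMod 𝒜) where
  smul_comp _ _ _ c f g := hom_ext fun x => by
    simp only [lin_comp_apply, lin_smul, LinearMap.smul_apply]
    exact (lin g).map_smul_of_tower c _
  comp_smul _ _ _ f c g := hom_ext fun x => by simp

/-- The homogeneous component of degree `i`. -/
def proj (M : GrMod 𝒜) (i : ℤ) : M.carrier →ₗ[k] M.carrier := internalProj M.deg M.isInternal i

theorem proj_mem (M : GrMod 𝒜) (i : ℤ) (x : M.carrier) : M.proj i x ∈ M.deg i :=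
  internalProj_mem _ i x

theorem proj_same {i : ℤ} {x : M.carrier} (hx : x ∈ M.deg i) : M.proj i x = x :=
  internalProj_same _ hx

theorem proj_ne {i j : ℤ} {x : M.carrier} (hx : x ∈ M.deg j) (h : j ≠ i) : M.proj i x = 0 :=
  internalProj_ne _ hx h

theorem lin_proj (f : M ⟶ N) (i : ℤ) (x : M.carrier) : lin f (M.proj i x) = N.proj i (lin f x) := by
  refine internal_induction M.isInternal (P := fun x => lin f (M.proj i x) = N.proj i (lin f x))
    (by simp) (fun x y hx hy => by simp [hx, hy]) (fun j x hx => ?_) x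
  by_cases hij : j = i
  · subst hij
    rw [proj_same hx, proj_same (lin_mem f hx)]
  · rw [proj_ne hx hij, proj_ne (lin_mem f hx) hij, map_zero]

theorem mem_deg_of_injective (f : M ⟶ N) (hf : Function.Injective (lin f)) {i : ℤ} {x : M.carrier}
    (hx : lin f x ∈ N.deg i) : x ∈ M.deg i := by
  have : M.proj i x = x := hf (by rw [lin_proj, proj_same hx])
  rw [← this]
  exact M.proj_mem i x

/-- The kernel of a morphism. -/
abbrev ker (f : M ⟶ N) : GrMod 𝒜 where
  carrier := LinearMap.ker (lin f)
  deg i := (M.deg i).comap ((LinearMap.ker (lin f)).subtype.restrictScalars k)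
  smul_mem ha hx := M.smul_mem ha hx
  isInternal := by
    have hk : ∀ i, ∀ x ∈ (LinearMap.ker (lin f)).restrictScalars k,
        M.proj i x ∈ (LinearMap.ker (lin f)).restrictScalars k := by
      intro i x hx
      have hx' : lin f x = 0 := hx
      change lin f _ = 0
      rw [lin_proj, hx', map_zero]
    refine isInternal_of_proj _ (fun i => (M.proj i).restrict (hk i)) ?_ ?_ ?_
    · intro i x hx
      exact Subtype.ext (proj_same hx)
    · intro i j x hx hij
      exact Subtype.ext (proj_ne hx hij)
    · rintro ⟨x, hx⟩
      classical
      let := M.isInternal.chooseDecomposition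
      have : (⟨x, hx⟩ : LinearMap.ker (lin f)) =
          ∑ i ∈ (DirectSum.decompose M.deg x).support, ⟨M.proj i x, hk i x hx⟩ := by
        refine Subtype.ext ?_
        rw [AddSubmonoidClass.coe_finsetSum]
        exact (DirectSum.sum_support_decompose M.deg x).symm
      rw [this]
      exact Submodule.sum_mem _ fun i _ => Submodule.mem_iSup_of_mem i (M.proj_mem i x)

def kerι (f : M ⟶ N) : ker f ⟶ M := ofLin (LinearMap.ker (lin f)).subtype fun _ _ hx => hx

/-- The cokernel of a morphism. -/
abbrev coker (f : M ⟶ N) : GrMod 𝒜 where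
  carrier := N.carrier ⧸ LinearMap.range (lin f)
  deg i := (N.deg i).map ((LinearMap.range (lin f)).mkQ.restrictScalars k)
  smul_mem := by
    rintro i j a _ ha ⟨x, hx, rfl⟩
    exact ⟨a • x, N.smul_mem ha hx, map_smul (LinearMap.range (lin f)).mkQ a x⟩
  isInternal := by
    have hk : ∀ i, (LinearMap.range (lin f)).restrictScalars k ≤
        ((LinearMap.range (lin f)).restrictScalars k).comap (N.proj i) := by
      rintro i _ ⟨x, rfl⟩
      exact ⟨M.proj i x, lin_proj f i x⟩
    refine isInternal_of_proj _ (fun i =>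
      (((LinearMap.range (lin f)).restrictScalars k).mapQ _ (N.proj i) (hk i) :)) ?_ ?_ ?_
    · rintro i _ ⟨x, hx, rfl⟩
      exact congrArg (LinearMap.range (lin f)).mkQ (proj_same hx)
    · rintro i j _ ⟨x, hx, rfl⟩ hij
      exact (congrArg (LinearMap.range (lin f)).mkQ (proj_ne hx hij)).trans (map_zero _)
    · intro y
      obtain ⟨x, rfl⟩ := (LinearMap.range (lin f)).mkQ_surjective y
      refine internal_induction N.isInternal (P := fun x => (LinearMap.range (lin f)).mkQ x ∈ _)
        (by simp) (fun x y hx hy => by rw [map_add]; exact add_mem hx hy) (fun i x hx => ?_) x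
      exact Submodule.mem_iSup_of_mem i ⟨x, hx, rfl⟩

def cokerπ (f : M ⟶ N) : N ⟶ coker f :=
  ofLin (LinearMap.range (lin f)).mkQ fun _ x hx => ⟨x, hx, rfl⟩

/-- The direct sum of a family of graded modules, with `deg i` the sum of the degree `i` pieces. -/
abbrev dsum {ι : Type} (M : ι → GrMod 𝒜) : GrMod 𝒜 where
  carrier := Π₀ s, (M s).carrier
  deg i :=
    { carrier := {f | ∀ s, f s ∈ (M s).deg i}
      add_mem' := fun hf hg s => add_mem (hf s) (hg s)
      zero_mem' := fun s => zero_mem _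
      smul_mem' := fun c _ hf s => Submodule.smul_mem _ c (hf s) }
  smul_mem ha hx s := (M s).smul_mem ha (hx s)
  isInternal := by
    classical
    refine isInternal_of_proj _ (fun i => DFinsupp.mapRange.linearMap fun s => (M s).proj i) ?_ ?_ ?_
    · intro i x hx
      exact DFinsupp.ext fun s => proj_same (hx s)
    · intro i j x hx hij
      exact DFinsupp.ext fun s => proj_ne (hx s) hij
    · intro x
      induction x using DFinsupp.induction with
      | h0 => exact zero_mem _
      | ha s y f _ _ hf =>
        refine add_mem ?_ hf
        refine internal_induction (M s).isInternal
          (P := fun y => (DFinsupp.single s y : Π₀ s, (M s).carrier) ∈ _) (by simp)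
          (fun x y hx hy => by rw [DFinsupp.single_add]; exact add_mem hx hy) (fun i y hy => ?_) y
        refine Submodule.mem_iSup_of_mem i fun t => ?_
        by_cases hst : s = t
        · subst hst; simpa using hy
        · rw [DFinsupp.single_eq_of_ne (Ne.symm hst)]; exact zero_mem _

open Classical in
/-- The inclusion of a summand. -/
def dsumι {ι : Type} (M : ι → GrMod 𝒜) (s : ι) : M s ⟶ dsum M :=
  ofLin (N := dsum M)
    (DFinsupp.lsingle (R := A) (M := fun s => (M s).carrier) s) fun i x hx t => by
    change (DFinsupp.single s x : Π₀ s, (M s).carrier) t ∈ (M t).deg i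
    by_cases hst : s = t
    · subst hst; simpa using hx
    · rw [DFinsupp.single_eq_of_ne (Ne.symm hst)]; exact zero_mem _

open Classical in
/-- The morphism out of a direct sum with given components. -/
def dsumDesc {ι : Type} (M : ι → GrMod 𝒜) (f : ∀ s, M s ⟶ N) : dsum M ⟶ N :=
  ofLin (M := dsum M)
    (DFinsupp.lsum ℕ (fun s => lin (f s)) : (Π₀ s, (M s).carrier) →ₗ[A] N.carrier) fun i x hx => by
    rw [DFinsupp.lsum_apply_apply, DFinsupp.sumAddHom_apply]
    exact Submodule.sum_mem _ fun s _ => lin_mem (f s) (hx s)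

theorem dsumι_desc {ι : Type} (M : ι → GrMod 𝒜) (f : ∀ s, M s ⟶ N) (s : ι) :
    dsumι M s ≫ dsumDesc M f = f s := by
  classical
  refine hom_ext fun x => ?_
  exact DFinsupp.lsum_single ℕ (fun s => lin (f s)) s x

theorem dsum_hom_ext {ι : Type} {M : ι → GrMod 𝒜} {f g : dsum M ⟶ N}
    (h : ∀ s, dsumι M s ≫ f = dsumι M s ≫ g) : f = g := by
  classical
  refine lin_injective (DFinsupp.lhom_ext' fun s => ?_)
  exact congrArg lin (h s)

instance {ι : Type} (M : ι → GrMod 𝒜) : HasCoproduct M :=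
  HasColimit.mk
    { cocone := Cofan.mk (dsum M) (dsumι M)
      isColimit := Cofan.IsColimit.mk _ (fun t => dsumDesc M t.inj) (fun _ s => dsumι_desc M _ s)
        (fun _ _ hm => dsum_hom_ext fun s => (hm s).trans (dsumι_desc M _ s).symm) }

instance : HasFiniteProducts (GrMod 𝒜) :=
  have : HasFiniteCoproducts (GrMod 𝒜) :=
    ⟨fun n =>
      { has_colimit := fun K => by
          have : HasColimit (Discrete.functor (K.obj ∘ Discrete.mk)) :=
            inferInstanceAs (HasCoproduct (K.obj ∘ Discrete.mk))
          exact hasColimit_of_iso Discrete.natIsoFunctor }⟩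
  have : HasFiniteBiproducts (GrMod 𝒜) := HasFiniteBiproducts.of_hasFiniteCoproducts
  inferInstance

theorem kerι_comp (f : M ⟶ N) : kerι f ≫ f = 0 := hom_ext fun x => x.2

theorem comp_cokerπ (f : M ⟶ N) : f ≫ cokerπ f = 0 :=
  hom_ext fun x => (Submodule.Quotient.mk_eq_zero _).2 ⟨x, rfl⟩

instance (f : M ⟶ N) : Mono (kerι f) :=
  ⟨fun _ _ h => hom_ext fun x => Subtype.ext (congrArg (fun h => lin h x) h)⟩

instance (f : M ⟶ N) : Epi (cokerπ f) :=
  ⟨fun g h hgh => hom_ext fun y => by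
    obtain ⟨x, rfl⟩ := (LinearMap.range (lin f)).mkQ_surjective y
    exact congrArg (fun h => lin h x) hgh⟩

instance : HasKernels (GrMod 𝒜) where
  has_limit f := HasLimit.mk
    { cone := KernelFork.ofι (kerι f) (kerι_comp f)
      isLimit := KernelFork.IsLimit.ofι' _ _ fun g hg =>
        ⟨ofLin ((lin g).codRestrict _ fun x => by
            simpa using congrArg (fun h => lin h x) hg) fun _ _ hx => lin_mem g hx, rfl⟩ }

instance : HasCokernels (GrMod 𝒜) where
  has_colimit f := HasColimit.mk
    { cocone := CokernelCofork.ofπ (cokerπ f) (comp_cokerπ f)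
      isColimit := CokernelCofork.IsColimit.ofπ' _ _ fun g hg =>
        ⟨ofLin ((LinearMap.range (lin f)).liftQ (lin g) (by
            rintro _ ⟨x, rfl⟩
            exact congrArg (fun h => lin h x) hg)) (by
          rintro i _ ⟨x, hx, rfl⟩
          exact lin_mem g hx), rfl⟩ }

theorem injective_of_mono (f : M ⟶ N) [Mono f] : Function.Injective (lin f) := by
  rw [← LinearMap.ker_eq_bot, Submodule.eq_bot_iff]
  intro x hx
  have h : kerι f = 0 := by rw [← cancel_mono f, kerι_comp, zero_comp]
  exact congrArg (fun g : ker f ⟶ M => lin g ⟨x, hx⟩) h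

theorem surjective_of_epi (f : M ⟶ N) [Epi f] : Function.Surjective (lin f) := by
  rw [← LinearMap.range_eq_top, Submodule.eq_top_iff']
  intro y
  have h : cokerπ f = 0 := by rw [← cancel_epi f, comp_cokerπ, comp_zero]
  exact (Submodule.Quotient.mk_eq_zero _).1 (congrArg (fun g => lin g y) h)

/-- An injective morphism is the kernel of its cokernel. -/
abbrev normalMono (f : M ⟶ N) [Mono f] : NormalMono f where
  Z := coker f
  g := cokerπ f
  w := comp_cokerπ f
  isLimit := KernelFork.IsLimit.ofι' _ _ fun {K} g hg => by
    have hf := injective_of_mono f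
    have hr : ∀ x, lin g x ∈ LinearMap.range (lin f) := fun x =>
      (Submodule.Quotient.mk_eq_zero _).1 (congrArg (fun h => lin h x) hg)
    let e := LinearEquiv.ofInjective (lin f) hf
    let l : K.carrier →ₗ[A] M.carrier := e.symm.toLinearMap ∘ₗ (lin g).codRestrict _ hr
    have hl : ∀ x, lin f (l x) = lin g x := fun x =>
      congrArg Subtype.val (e.apply_symm_apply ⟨lin g x, hr x⟩)
    exact ⟨ofLin l fun i x hx => mem_deg_of_injective f hf (by rw [hl]; exact lin_mem g hx),
      hom_ext hl⟩

/-- A surjective morphism is the cokernel of its kernel. -/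
abbrev normalEpi (f : M ⟶ N) [Epi f] : NormalEpi f where
  W := ker f
  g := kerι f
  w := kerι_comp f
  isColimit := CokernelCofork.IsColimit.ofπ' _ _ fun {K} g hg => by
    have hf := surjective_of_epi f
    have hk : LinearMap.ker (lin f) ≤ LinearMap.ker (lin g) := fun x hx =>
      congrArg (fun h : ker f ⟶ K => lin h ⟨x, hx⟩) hg
    let l : N.carrier →ₗ[A] K.carrier :=
      (LinearMap.ker (lin f)).liftQ (lin g) hk ∘ₗ
        ((lin f).quotKerEquivOfSurjective hf).symm.toLinearMap
    have hl : ∀ x, l (lin f x) = lin g x := fun x => by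
      have : ((lin f).quotKerEquivOfSurjective hf).symm (lin f x) =
          (LinearMap.ker (lin f)).mkQ x := by
        rw [LinearEquiv.symm_apply_eq]; rfl
      change (LinearMap.ker (lin f)).liftQ (lin g) hk
        (((lin f).quotKerEquivOfSurjective hf).symm (lin f x)) = _
      rw [this]; rfl
    refine ⟨ofLin l fun i y hy => ?_, hom_ext hl⟩
    obtain ⟨x, rfl⟩ := hf y
    rw [← proj_same hy, ← lin_proj, hl]
    exact lin_mem g (M.proj_mem i x)

theorem surjective_of_lift (f : M ⟶ N) (h : ∀ i, ∀ y ∈ N.deg i, ∃ x, lin f x = y) :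
    Function.Surjective (lin f) := fun y =>
  internal_induction N.isInternal (P := fun y => ∃ x, lin f x = y) ⟨0, map_zero _⟩
    (by rintro _ _ ⟨x, rfl⟩ ⟨y, rfl⟩; exact ⟨x + y, map_add _ _ _⟩) h y

theorem epi_of_surjective (f : M ⟶ N) (h : Function.Surjective (lin f)) : Epi f :=
  ⟨fun _ _ hg => hom_ext fun y => by
    obtain ⟨x, rfl⟩ := h y
    exact congrArg (fun h => lin h x) hg⟩

theorem mono_of_injective (f : M ⟶ N) (h : Function.Injective (lin f)) : Mono f :=
  ⟨fun _ _ hg => hom_ext fun x => h (congrArg (fun h => lin h x) hg)⟩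

instance : Abelian (GrMod 𝒜) where
  normalMonoOfMono f _ := ⟨normalMono f⟩
  normalEpiOfEpi f _ := ⟨normalEpi f⟩

/-- The graded module `M⟨d⟩`, whose grading is that of `M` shifted up by `d`. -/
abbrev shift (d : ℤ) (M : GrMod 𝒜) : GrMod 𝒜 where
  carrier := M.carrier
  deg i := M.deg (i - d)
  smul_mem {i j a x} ha hx := by
    have := M.smul_mem ha hx
    rwa [← add_sub_assoc] at this
  isInternal := isInternal_of_proj _ (fun i => M.proj (i - d)) (fun _ _ hx => proj_same hx)
    (fun _ _ _ hx hij => proj_ne hx fun h => hij (sub_left_injective h))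
    (fun x => internal_induction M.isInternal (zero_mem _) (fun _ _ => add_mem)
      (fun i x hx => Submodule.mem_iSup_of_mem (i + d) (by simpa using hx)) x)

/-- `A` as a graded module over itself. -/
abbrev reg (𝒜 : ℤ → Submodule k A) [GradedAlgebra 𝒜] : GrMod 𝒜 where
  carrier := A
  deg := 𝒜
  smul_mem ha hx := SetLike.mul_mem_graded ha hx
  isInternal := DirectSum.Decomposition.isInternal 𝒜

/-- The graded free module `⨁ s, A⟨r s⟩`, with one generator of degree `r s` for each `s`. -/
abbrev free (𝒜 : ℤ → Submodule k A) [GradedAlgebra 𝒜] {ι : Type} (r : ι → ℤ) : GrMod 𝒜 :=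
  dsum fun s => shift (r s) (reg 𝒜)

section Free

variable [GradedAlgebra 𝒜]

/-- The morphism `A⟨d⟩ ⟶ M` sending `1` to an element of degree `d`. -/
def ofElem (M : GrMod 𝒜) (d : ℤ) (m : M.carrier) (hm : m ∈ M.deg d) : shift d (reg 𝒜) ⟶ M :=
  ofLin (M := shift d (reg 𝒜)) (LinearMap.toSpanSingleton A M.carrier m) fun i a ha => by
    have := M.smul_mem (show a ∈ 𝒜 (i - d) from ha) hm
    rwa [sub_add_cancel] at this

theorem ofElem_one (M : GrMod 𝒜) (d : ℤ) (m : M.carrier) (hm : m ∈ M.deg d) :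
    lin (ofElem M d m hm) (1 : A) = m := one_smul A m

theorem shift_reg_hom_ext {d : ℤ} {f g : shift d (reg 𝒜) ⟶ M}
    (h : lin f (1 : A) = lin g (1 : A)) : f = g :=
  lin_injective (LinearMap.ext_ring h)

instance projective_shift_reg (d : ℤ) : Projective (shift d (reg 𝒜)) where
  factors {E X} f e _ := by
    obtain ⟨x, hx⟩ := surjective_of_epi e (lin f (1 : A))
    have h1 : (1 : A) ∈ (shift d (reg 𝒜)).deg d := by
      change (1 : A) ∈ 𝒜 (d - d)
      rw [sub_self]
      exact SetLike.GradedOne.one_mem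
    refine ⟨ofElem E d (E.proj d x) (E.proj_mem d x), shift_reg_hom_ext ?_⟩
    rw [lin_comp_apply, ofElem_one, lin_proj, hx]
    exact proj_same (lin_mem f h1)

instance projective_free {ι : Type} (r : ι → ℤ) : Projective (free 𝒜 r) where
  factors f e _ :=
    ⟨dsumDesc _ fun s => Projective.factorThru (dsumι (fun s => shift (r s) (reg 𝒜)) s ≫ f) e,
      dsum_hom_ext fun s => by
        rw [← Category.assoc, dsumι_desc, Projective.factorThru_comp]⟩

instance : EnoughProjectives (GrMod 𝒜) where
  presentation M := by
    let F : (Σ d, M.deg d) → GrMod 𝒜 := fun s => shift s.1 (reg 𝒜)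
    let g : dsum F ⟶ M := dsumDesc F fun s => ofElem M s.1 s.2 s.2.2
    refine ⟨{ p := dsum F
              projective := projective_free (𝒜 := 𝒜) fun s : Σ d, M.deg d => s.1
              f := g
              epi := epi_of_surjective g (surjective_of_lift g fun i y hy => ?_) }⟩
    refine ⟨lin (dsumι F ⟨i, y, hy⟩) (1 : A), ?_⟩
    rw [← lin_comp_apply, dsumι_desc]
    exact ofElem_one M i y hy

end Free

end GrMod

/-- The one-dimensional `A`-module on which `A` acts through the augmentation `ε : A → k`. -/
def Triv {k A : Type} [CommRing k] [CommRing A] [Algebra k A] (_ε : A →ₐ[k] k) : Type := k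

namespace Triv

variable {k A : Type} [CommRing k] [CommRing A] [Algebra k A] (ε : A →ₐ[k] k)

instance : AddCommGroup (Triv ε) := inferInstanceAs (AddCommGroup k)

instance : Module k (Triv ε) := inferInstanceAs (Module k k)

instance : Module A (Triv ε) := Module.compHom k ε.toRingHom

theorem smul_def (a : A) (z : k) : (a • (show Triv ε from z)) = (show Triv ε from ε a * z) := rfl

instance : IsScalarTower k A (Triv ε) where
  smul_assoc c a z := by
    change ε (c • a) * (show k from z) = c * (ε a * (show k from z))
    rw [map_smul, smul_eq_mul, mul_assoc]

end Triv

/-- The trivial graded module: `k` in degree `0`, with `A` acting through the augmentation `ε`. -/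
abbrev GrMod.triv {k A : Type} [CommRing k] [CommRing A] [Algebra k A] (𝒜 : ℤ → Submodule k A)
    (ε : A →ₐ[k] k) (hε : ∀ i ≠ 0, ∀ a ∈ 𝒜 i, ε a = 0) : GrMod 𝒜 where
  carrier := Triv ε
  deg i := if i = 0 then ⊤ else ⊥
  smul_mem {i j a x} ha hx := by
    by_cases hj : j = 0
    · by_cases hi : i = 0
      · simp [hi, hj]
      · have : a • x = 0 := by
          change ε a * (show k from x) = 0
          rw [hε i hi a ha, zero_mul]
        rw [this]
        exact zero_mem _
    · have hx0 : x = 0 := by simpa [hj] using hx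
      rw [hx0, smul_zero]
      exact zero_mem _
  isInternal := by
    refine isInternal_of_proj _ (fun i => if i = 0 then LinearMap.id else 0) ?_ ?_ ?_
    · intro i x hx
      by_cases hi : i = 0
      · simp [hi]
      · simpa [hi, eq_comm] using hx
    · intro i j x hx hij
      by_cases hi : i = 0
      · subst hi
        simpa [hij] using hx
      · simp [hi]
    · exact fun x => Submodule.mem_iSup_of_mem 0 (by simp)

/-- A finite-dimensional graded module. -/
abbrev FinGrMod {k A : Type} [CommRing k] [CommRing A] [Algebra k A] (𝒜 : ℤ → Submodule k A) :=
  {M : GrMod 𝒜 // Module.Finite k M.carrier}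

section Grothendieck

open GrMod LaurentPolynomial

variable {k A : Type} [CommRing k] [CommRing A] [Algebra k A] {𝒜 : ℤ → Submodule k A}

/-- Isomorphism of finite-dimensional graded modules. -/
instance isoSetoid (𝒜 : ℤ → Submodule k A) : Setoid (FinGrMod 𝒜) :=
  (isIsomorphicSetoid (GrMod 𝒜)).comap Subtype.val

/-- The isomorphism class of a finite-dimensional graded module. -/
def isoClass (M : FinGrMod 𝒜) : Quotient (isoSetoid 𝒜) := Quotient.mk _ M

/-- The relations `[M] = [L] + [N]`, one for each short exact sequence `0 → L → M → N → 0`. -/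
def exactRelations (𝒜 : ℤ → Submodule k A) : Set (FreeAbelianGroup (Quotient (isoSetoid 𝒜))) :=
  {x | ∃ (L M N : FinGrMod 𝒜) (f : L.1 ⟶ M.1) (g : M.1 ⟶ N.1),
    Function.Injective (lin f) ∧ Function.Exact (lin f) (lin g) ∧ Function.Surjective (lin g) ∧
      x = .of (isoClass M) - (.of (isoClass L) + .of (isoClass N))}

/-- The Grothendieck group of the category of finite-dimensional graded modules. -/
def K0 (𝒜 : ℤ → Submodule k A) : Type 1 :=
  FreeAbelianGroup (Quotient (isoSetoid 𝒜)) ⧸ AddSubgroup.closure (exactRelations 𝒜)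

namespace K0

instance : AddCommGroup (K0 𝒜) :=
  inferInstanceAs (AddCommGroup
    (FreeAbelianGroup (Quotient (isoSetoid 𝒜)) ⧸ AddSubgroup.closure (exactRelations 𝒜)))

/-- The class `[M]` of a finite-dimensional graded module. -/
def cls (M : GrMod 𝒜) (hM : Module.Finite k M.carrier) : K0 𝒜 :=
  QuotientAddGroup.mk (FreeAbelianGroup.of (isoClass ⟨M, hM⟩))

/-- A homomorphism out of the Grothendieck group is an additive function on graded modules. -/
def lift {G : Type*} [AddCommGroup G] (φ : FinGrMod 𝒜 → G)
    (hiso : ∀ M N : FinGrMod 𝒜, (M.1 ≅ N.1) → φ M = φ N)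
    (hex : ∀ (L M N : FinGrMod 𝒜) (f : L.1 ⟶ M.1) (g : M.1 ⟶ N.1), Function.Injective (lin f) →
      Function.Exact (lin f) (lin g) → Function.Surjective (lin g) → φ M = φ L + φ N) :
    K0 𝒜 →+ G :=
  QuotientAddGroup.lift _
    (FreeAbelianGroup.lift (Quotient.lift φ fun M N ⟨e⟩ => hiso M N e))
    ((AddSubgroup.closure_le _).2 (by
      rintro _ ⟨L, M, N, f, g, h1, h2, h3, rfl⟩
      change FreeAbelianGroup.lift _ _ = 0
      rw [map_sub, map_add, FreeAbelianGroup.lift_apply_of, FreeAbelianGroup.lift_apply_of,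
        FreeAbelianGroup.lift_apply_of]
      exact sub_eq_zero.2 (hex L M N f g h1 h2 h3)))

theorem lift_cls {G : Type*} [AddCommGroup G] (φ : FinGrMod 𝒜 → G) (hiso) (hex) (M : GrMod 𝒜)
    (hM : Module.Finite k M.carrier) : lift φ hiso hex (cls M hM) = φ ⟨M, hM⟩ :=
  FreeAbelianGroup.lift_apply_of _ _

theorem hom_ext {G : Type*} [AddCommGroup G] {f g : K0 𝒜 →+ G}
    (h : ∀ M hM, f (cls M hM) = g (cls M hM)) : f = g := by
  refine QuotientAddGroup.addMonoidHom_ext _ (FreeAbelianGroup.lift_ext _ _ fun x => ?_)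
  obtain ⟨⟨M, hM⟩, rfl⟩ := Quotient.exists_rep x
  exact h M hM

theorem cls_iso {M N : GrMod 𝒜} (e : M ≅ N) (hM : Module.Finite k M.carrier)
    (hN : Module.Finite k N.carrier) : cls M hM = cls N hN :=
  congrArg (fun x => (QuotientAddGroup.mk (FreeAbelianGroup.of x) : K0 𝒜))
    (Quotient.sound (s := isoSetoid 𝒜) (show (⟨M, hM⟩ : FinGrMod 𝒜) ≈ ⟨N, hN⟩ from ⟨e⟩))

theorem cls_exact {L M N : GrMod 𝒜} (hL : Module.Finite k L.carrier)
    (hM : Module.Finite k M.carrier) (hN : Module.Finite k N.carrier) (f : L ⟶ M) (g : M ⟶ N)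
    (h1 : Function.Injective (lin f)) (h2 : Function.Exact (lin f) (lin g))
    (h3 : Function.Surjective (lin g)) : cls M hM = cls L hL + cls N hN := by
  rw [← sub_eq_zero]
  exact (QuotientAddGroup.eq_zero_iff _).2
    (AddSubgroup.subset_closure ⟨⟨L, hL⟩, ⟨M, hM⟩, ⟨N, hN⟩, f, g, h1, h2, h3, rfl⟩)

end K0

namespace GrMod

/-- The shift of a morphism. -/
def shiftMap (d : ℤ) {M N : GrMod 𝒜} (f : M ⟶ N) : shift d M ⟶ shift d N :=
  ofLin (M := shift d M) (N := shift d N) (lin (M := M) (N := N) f) fun _ _ hx => lin_mem f hx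

/-- The shift of an isomorphism. -/
def shiftIso (d : ℤ) {M N : GrMod 𝒜} (e : M ≅ N) : shift d M ≅ shift d N where
  hom := shiftMap d e.hom
  inv := shiftMap d e.inv
  hom_inv_id := GrMod.lin_injective (congrArg (fun h : M ⟶ M => lin h) e.hom_inv_id)
  inv_hom_id := GrMod.lin_injective (congrArg (fun h : N ⟶ N => lin h) e.inv_hom_id)

/-- Two gradings that agree on the same module give isomorphic graded modules. -/
def shiftCongr (d e f : ℤ) (h : d + e = f) (M : GrMod 𝒜) : shift f M ≅ shift d (shift e M) where
  hom := ofLin (M := shift f M) (N := shift d (shift e M)) LinearMap.id fun i x hx => by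
    change x ∈ M.deg (i - d - e)
    rw [sub_sub, h]; exact hx
  inv := ofLin (M := shift d (shift e M)) (N := shift f M) LinearMap.id fun i x hx => by
    change x ∈ M.deg (i - f)
    rw [← h, ← sub_sub]; exact hx
  hom_inv_id := rfl
  inv_hom_id := rfl

/-- Shifting by `0` does nothing. -/
def shiftZero (M : GrMod 𝒜) : shift 0 M ≅ M where
  hom := ofLin (M := shift 0 M) LinearMap.id fun i x hx => by
    change x ∈ M.deg (i - 0) at hx
    rwa [sub_zero] at hx
  inv := ofLin (N := shift 0 M) LinearMap.id fun i x hx => by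
    change x ∈ M.deg (i - 0)
    rwa [sub_zero]
  hom_inv_id := rfl
  inv_hom_id := rfl

end GrMod

namespace K0

/-- The endomorphism `[M] ↦ [M⟨d⟩]` of the Grothendieck group. -/
def shiftEnd (d : ℤ) : K0 𝒜 →+ K0 𝒜 :=
  lift (fun M => cls (shift d M.1) M.2)
    (fun _ _ e => cls_iso (shiftIso d e) _ _)
    (fun L M N f g h1 h2 h3 => cls_exact (L := shift d L.1) (M := shift d M.1)
      (N := shift d N.1) L.2 M.2 N.2 (shiftMap d f) (shiftMap d g) h1 h2 h3)

theorem shiftEnd_cls (d : ℤ) (M : GrMod 𝒜) (hM : Module.Finite k M.carrier) :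
    shiftEnd d (cls M hM) = cls (shift d M) hM := lift_cls _ _ _ M hM

/-- The action of the group of powers of `q` on the Grothendieck group by shifts. -/
def shiftHom (𝒜 : ℤ → Submodule k A) : Multiplicative ℤ →* AddMonoid.End (K0 𝒜) where
  toFun d := shiftEnd d.toAdd
  map_one' := hom_ext fun M hM => (shiftEnd_cls 0 M hM).trans (cls_iso (shiftZero M) _ _)
  map_mul' d e := hom_ext fun M hM => by
    change _ = shiftEnd d.toAdd (shiftEnd e.toAdd (cls M hM))
    rw [shiftEnd_cls, shiftEnd_cls, shiftEnd_cls]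
    exact cls_iso (shiftCongr _ _ _ rfl M) _ _

/-- The `ℤ[q, q⁻¹]`-module structure on the Grothendieck group: `q` shifts the grading up by `1`. -/
instance : Module ℤ[T;T⁻¹] (K0 𝒜) :=
  Module.compHom (K0 𝒜)
    (AddMonoidAlgebra.lift ℤ (AddMonoid.End (K0 𝒜)) ℤ (shiftHom 𝒜)).toRingHom

theorem T_smul_cls (d : ℤ) (M : GrMod 𝒜) (hM : Module.Finite k M.carrier) :
    (T d : ℤ[T;T⁻¹]) • cls M hM = cls (shift d M) hM := by
  change (AddMonoidAlgebra.lift ℤ (AddMonoid.End (K0 𝒜)) ℤ (shiftHom 𝒜) (T d)) (cls M hM) = _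
  rw [T, AddMonoidAlgebra.lift_single, one_smul]
  exact shiftEnd_cls d M hM

end K0

end Grothendieck

section Resolutions

/-- A projective resolution is infinite if it does not vanish from some point on. -/
def IsInfiniteResolution {C : Type*} [Category* C] [Abelian C] {X : C}
    (P : ProjectiveResolution X) : Prop :=
  ∀ N : ℕ, ∃ i ≥ N, ¬ IsZero (P.complex.X i)

open GrMod LaurentPolynomial

variable {k A : Type} [CommRing k] [CommRing A] [Algebra k A] {𝒜 : ℤ → Submodule k A}

/-- A graded projective resolution is minimal (with respect to the augmentation `ε`) if all its
differentials have image in `ker ε` times the target, that is, vanish after `⊗ k`. -/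
def IsMinimalResolution (ε : A →ₐ[k] k) {X : GrMod 𝒜} (P : ProjectiveResolution X) : Prop :=
  ∀ (i : ℕ) (x : (P.complex.X (i + 1)).carrier),
    lin (P.complex.d (i + 1) i) x ∈
      RingHom.ker ε • (⊤ : Submodule A (P.complex.X i).carrier)

/-- The graded free module with `b d` generators of degree `d` for every `d`. -/
abbrev freeOfRank (𝒜 : ℤ → Submodule k A) [GradedAlgebra 𝒜] (b : ℤ →₀ ℕ) : GrMod 𝒜 :=
  free 𝒜 fun s : Σ d : ℤ, Fin (b d) => s.1

/-- The Poincaré series `∑ b i d q ^ d t ^ i`, as a power series in `t` over `ℤ[q, q⁻¹]`. -/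
def poincareSeries (b : ℕ → ℤ →₀ ℕ) : PowerSeries ℤ[T;T⁻¹] :=
  PowerSeries.mk fun i => (b i).sum fun d m => (m : ℤ[T;T⁻¹]) * T d

variable [GradedAlgebra 𝒜]

/-- The degree `d` part of `Ext ^ i (M, N)`, that is, extensions of degree `0` from `M` to
`N⟨d⟩`. -/
abbrev gradedExt (M N : GrMod 𝒜) (i : ℕ) (d : ℤ) : ModuleCat k :=
  ((Ext k (GrMod 𝒜) i).obj (Opposite.op M)).obj (shift d N)

/-- `E` is the graded Euler characteristic `∑ (-1) ^ i (dim Ext ^ i (M, N)_d) q ^ d`; in particular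
each of its coefficients is a finite sum of finite dimensions. -/
structure IsGradedEulerChar (M N : GrMod 𝒜) (E : LaurentSeries ℤ) : Prop where
  finite_dim : ∀ i d, Module.Finite k (gradedExt M N i d)
  finite_support : ∀ d, {i | Nontrivial (gradedExt M N i d)}.Finite
  coeff_eq : ∀ d, E.coeff d = ∑ᶠ i : ℕ, (-1) ^ i * (Module.finrank k (gradedExt M N i d) : ℤ)

end Resolutions

section QuantumNumbers

open Polynomial

/-- The quantum number `1 + q ^ 2 + ⋯ + q ^ (2 (n - 1))`. -/
def qInt (n : ℕ) : ℤ[X] := ∑ i ∈ Finset.range n, X ^ (2 * i)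

/-- The quantum factorial. -/
def qFact (n : ℕ) : ℤ[X] := ∏ i ∈ Finset.range n, qInt (i + 1)

/-- The quantum binomial coefficient, defined by the Pascal recursion; see `qBinom_mul`. -/
def qBinom : ℕ → ℕ → ℤ[X]
  | _, 0 => 1
  | 0, _ + 1 => 0
  | n + 1, k + 1 => qBinom n k + X ^ (2 * (k + 1)) * qBinom n (k + 1)

theorem qInt_add (a b : ℕ) : qInt (a + b) = qInt a + X ^ (2 * a) * qInt b := by
  simp only [qInt, Finset.sum_range_add, Finset.mul_sum, mul_add, pow_add]

theorem qFact_succ (n : ℕ) : qFact (n + 1) = qFact n * qInt (n + 1) :=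
  Finset.prod_range_succ _ _

theorem qBinom_zero (n : ℕ) : qBinom n 0 = 1 := by cases n <;> rfl

theorem qBinom_of_lt {n k : ℕ} (h : n < k) : qBinom n k = 0 := by
  induction n generalizing k with
  | zero => obtain _ | k := k
            · omega
            · rfl
  | succ n ih =>
    obtain _ | k := k
    · omega
    · rw [qBinom, ih (by omega), ih (by omega), mul_zero, add_zero]

/-- The quantum binomial coefficient is the quotient of the quantum factorials. -/
theorem qBinom_add_mul (a b : ℕ) : qBinom (a + b) a * (qFact a * qFact b) = qFact (a + b) := by
  induction h : a + b generalizing a b with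
  | zero =>
    obtain ⟨rfl, rfl⟩ : a = 0 ∧ b = 0 := by omega
    simp [qBinom, qFact]
  | succ n ih =>
    obtain _ | a := a
    · obtain rfl : b = n + 1 := by omega
      simp [qBinom_zero, qFact]
    · have h1 := ih a b (by omega)
      rw [qBinom, qFact_succ n]
      obtain _ | b := b
      · obtain rfl : a = n := by omega
        rw [qBinom_of_lt (Nat.lt_succ_self a), qFact_succ]
        linear_combination qInt (a + 1) * h1
      · have h2 := ih (a + 1) b (by omega)
        have e : qInt (n + 1) = qInt (a + 1) + X ^ (2 * (a + 1)) * qInt (b + 1) := by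
          rw [← qInt_add]; congr 1; omega
        rw [qFact_succ] at h1 h2
        rw [e, qFact_succ a, qFact_succ b]
        linear_combination qInt (a + 1) * h1 + X ^ (2 * (a + 1)) * qInt (b + 1) * h2

theorem qBinom_mul {n k : ℕ} (h : k ≤ n) : qBinom n k * (qFact k * qFact (n - k)) = qFact n := by
  have := qBinom_add_mul k (n - k)
  rwa [Nat.add_sub_cancel' h] at this

/-- An integral polynomial in `q` as a Laurent series in `q`. -/
def toLaurentSeries (p : ℤ[X]) : LaurentSeries ℤ := HahnSeries.ofPowerSeries ℤ ℤ (p : PowerSeries ℤ)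

end QuantumNumbers

section GradedQuotient

open MvPolynomial

variable {σ : Type} (w : σ → ℤ) (I : Ideal (MvPolynomial σ ℂ))

/-- The grading of a quotient of a polynomial ring in which the `i`-th variable has degree `w i`. -/
def quotGrading (d : ℤ) : Submodule ℂ (MvPolynomial σ ℂ ⧸ I) :=
  (weightedHomogeneousSubmodule ℂ w d).map (Ideal.Quotient.mkₐ ℂ I).toLinearMap

/-- The quotient by a homogeneous ideal is graded. -/
abbrev quotGradedAlgebra (hI : ∀ p ∈ I, ∀ d, weightedHomogeneousComponent w d p ∈ I) :
    GradedAlgebra (quotGrading w I) :=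
  have : SetLike.GradedMonoid (quotGrading w I) :=
    { one_mem := ⟨1, isWeightedHomogeneous_one ℂ w, map_one (Ideal.Quotient.mk I)⟩
      mul_mem := by
        rintro i j _ _ ⟨p, hp, rfl⟩ ⟨q, hq, rfl⟩
        exact ⟨p * q, IsWeightedHomogeneous.mul hp hq, map_mul (Ideal.Quotient.mk I) p q⟩ }
  DirectSum.IsInternal.gradedAlgebra (isInternal_of_proj (quotGrading w I)
    (fun d => (I.restrictScalars ℂ).mapQ (I.restrictScalars ℂ) (weightedHomogeneousComponent w d)
      fun p hp => hI p hp d)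
    (by
      rintro d _ ⟨p, hp, rfl⟩
      exact congrArg (Ideal.Quotient.mk I)
        (IsWeightedHomogeneous.weightedHomogeneousComponent_same hp))
    (by
      rintro d e _ ⟨p, hp, rfl⟩ hde
      exact (congrArg (Ideal.Quotient.mk I)
        (IsWeightedHomogeneous.weightedHomogeneousComponent_ne d hp hde.symm)).trans (map_zero _))
    (by
      intro x
      obtain ⟨p, rfl⟩ := Ideal.Quotient.mk_surjective x
      induction p using MvPolynomial.induction_on' with
      | monomial u a =>
        exact Submodule.mem_iSup_of_mem (Finsupp.weight w u)
          ⟨monomial u a, isWeightedHomogeneous_monomial w u a rfl, rfl⟩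
      | add p q hp hq => rw [map_add]; exact add_mem hp hq))

theorem component_mem_span {S : Set (MvPolynomial σ ℂ)}
    (hS : ∀ p ∈ S, ∀ d, weightedHomogeneousComponent w d p ∈ Ideal.span S) :
    ∀ p ∈ Ideal.span S, ∀ d, weightedHomogeneousComponent w d p ∈ Ideal.span S := by
  classical
  let := weightedGradedAlgebra ℂ w
  have hspan : Ideal.span S = Ideal.span
      {p | p ∈ Ideal.span S ∧ SetLike.IsHomogeneousElem (weightedHomogeneousSubmodule ℂ w) p} := by
    refine le_antisymm (Ideal.span_le.2 fun p hp => ?_) (Ideal.span_le.2 fun p hp => hp.1)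
    rw [SetLike.mem_coe, ← DirectSum.sum_support_decompose (weightedHomogeneousSubmodule ℂ w) p]
    refine Ideal.sum_mem _ fun d _ => Ideal.subset_span ⟨?_, SetLike.isHomogeneousElem_coe _⟩
    have := weightedDecomposition.decompose'_apply ℂ w p d
    exact this ▸ hS p hp d
  have hh := Ideal.homogeneous_span (weightedHomogeneousSubmodule ℂ w)
    {p | p ∈ Ideal.span S ∧ SetLike.IsHomogeneousElem (weightedHomogeneousSubmodule ℂ w) p}
    fun _ h => h.2
  rw [← hspan] at hh
  intro p hp d
  have := weightedDecomposition.decompose'_apply ℂ w p d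
  exact this ▸ hh d hp

variable {I}

/-- The augmentation sending all variables to `0`. -/
def quotAug (hI : ∀ p ∈ I, constantCoeff p = 0) : (MvPolynomial σ ℂ ⧸ I) →ₐ[ℂ] ℂ :=
  Ideal.Quotient.liftₐ I (aeval fun _ => 0) fun p hp => by
    rw [aeval_zero', hI p hp, map_zero]

theorem quotAug_eq_zero (hI : ∀ p ∈ I, constantCoeff p = 0) :
    ∀ d ≠ 0, ∀ a ∈ quotGrading w I d, quotAug hI a = 0 := by
  rintro d hd _ ⟨p, hp, rfl⟩
  change aeval (fun _ => 0) p = 0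
  rw [aeval_zero', constantCoeff_eq, IsWeightedHomogeneous.coeff_eq_zero hp 0 (by simpa using hd.symm),
    map_zero]

theorem constantCoeff_of_mem_span {S : Set (MvPolynomial σ ℂ)} (hS : ∀ p ∈ S, constantCoeff p = 0) :
    ∀ p ∈ Ideal.span S, constantCoeff p = 0 := fun _ hp =>
  (Ideal.span_le (I := RingHom.ker (constantCoeff (R := ℂ) (σ := σ)))).2 hS hp

end GradedQuotient

section Coinvariants

open MvPolynomial

/-- The ideal generated by the symmetric polynomials without constant term. -/
def coinvIdeal (n : ℕ) : Ideal (MvPolynomial (Fin n) ℂ) :=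
  Ideal.span {p | p.IsSymmetric ∧ constantCoeff p = 0}

/-- The ring of coinvariants `H_n`, i.e. the cohomology ring of the full flag variety. -/
abbrev Coinv (n : ℕ) : Type := MvPolynomial (Fin n) ℂ ⧸ coinvIdeal n

/-- The grading of `H_n` in which all variables have degree `2`. -/
abbrev coinvGrading (n : ℕ) : ℤ → Submodule ℂ (Coinv n) := quotGrading (fun _ => 2) (coinvIdeal n)

theorem isSymmetric_component {n : ℕ} {p : MvPolynomial (Fin n) ℂ} (hp : p.IsSymmetric) (d : ℤ) :
    (weightedHomogeneousComponent (fun _ => (2 : ℤ)) d p).IsSymmetric := by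
  classical
  intro e
  ext u
  obtain ⟨v, rfl⟩ : ∃ v : Fin n →₀ ℕ, v.mapDomain e = u :=
    ⟨u.mapDomain e.symm, by rw [← Finsupp.mapDomain_comp]; simp⟩
  have hc : coeff (v.mapDomain e) p = coeff v p := by
    conv_lhs => rw [← hp e]
    exact coeff_rename_mapDomain e e.injective p v
  have hw : Finsupp.weight (fun _ : Fin n => (2 : ℤ)) (v.mapDomain e) =
      Finsupp.weight (fun _ => (2 : ℤ)) v := by
    simp only [Finsupp.weight_apply]
    exact Finsupp.sum_mapDomain_index (by simp) (by intros; rw [add_smul])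
  rw [coeff_rename_mapDomain e e.injective, coeff_weightedHomogeneousComponent,
    coeff_weightedHomogeneousComponent, hc, hw]

instance (n : ℕ) : GradedAlgebra (coinvGrading n) :=
  quotGradedAlgebra _ _ (component_mem_span _ fun p hp d => Ideal.subset_span
    ⟨isSymmetric_component hp.1 d, by
      classical
      have : coeff 0 p = 0 := hp.2
      rw [constantCoeff_eq, coeff_weightedHomogeneousComponent, this, ite_self]⟩)

/-- The augmentation of `H_n`. -/
def coinvAug (n : ℕ) : Coinv n →ₐ[ℂ] ℂ := quotAug (constantCoeff_of_mem_span fun _ hp => hp.2)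

/-- The trivial graded `H_n`-module `ℂ`. -/
abbrev coinvTriv (n : ℕ) : GrMod (coinvGrading n) :=
  GrMod.triv (coinvGrading n) (coinvAug n) (quotAug_eq_zero _ _)

end Coinvariants

section Grassmannian

open MvPolynomial

/-- The `i`-th Chern class of the tautological bundle of rank `k` (with `c_0 = 1`). -/
def chernSub (k l i : ℕ) : MvPolynomial (Fin k ⊕ Fin l) ℂ :=
  if i = 0 then 1 else if h : i - 1 < k then X (Sum.inl ⟨i - 1, h⟩) else 0

/-- The `i`-th Chern class of the tautological quotient bundle of rank `l` (with `c_0 = 1`). -/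
def chernQuot (k l i : ℕ) : MvPolynomial (Fin k ⊕ Fin l) ℂ :=
  if i = 0 then 1 else if h : i - 1 < l then X (Sum.inr ⟨i - 1, h⟩) else 0

/-- The ideal of relations expressing that the product of the total Chern classes is `1`. -/
def grassIdeal (k l : ℕ) : Ideal (MvPolynomial (Fin k ⊕ Fin l) ℂ) :=
  Ideal.span {p | ∃ m : ℕ, 1 ≤ m ∧
    p = ∑ x ∈ Finset.HasAntidiagonal.antidiagonal m, chernSub k l x.1 * chernQuot k l x.2}

/-- The cohomology ring of the Grassmannian of `k`-planes in `ℂ ^ (k + l)`: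
`ℂ[c_1, …, c_k, c'_1, …, c'_l] / ((1 + c_1 + ⋯ + c_k) (1 + c'_1 + ⋯ + c'_l) = 1)`. -/
abbrev GrassCoh (k l : ℕ) : Type := MvPolynomial (Fin k ⊕ Fin l) ℂ ⧸ grassIdeal k l

/-- The `i`-th Chern classes have degree `2 i`. -/
def grassWeight (k l : ℕ) : Fin k ⊕ Fin l → ℤ :=
  Sum.elim (fun i => 2 * ((i : ℤ) + 1)) fun j => 2 * ((j : ℤ) + 1)

/-- The grading of the cohomology ring of the Grassmannian. -/
abbrev grassGrading (k l : ℕ) : ℤ → Submodule ℂ (GrassCoh k l) :=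
  quotGrading (grassWeight k l) (grassIdeal k l)

theorem chernSub_homogeneous (k l i : ℕ) :
    IsWeightedHomogeneous (grassWeight k l) (chernSub k l i) (2 * (i : ℤ)) := by
  unfold chernSub
  split_ifs with h0 h
  · subst h0; simpa using isWeightedHomogeneous_one ℂ (grassWeight k l)
  · have : (2 * (i : ℤ)) = grassWeight k l (Sum.inl ⟨i - 1, h⟩) := by
      simp only [grassWeight, Sum.elim_inl]; omega
    rw [this]; exact isWeightedHomogeneous_X ℂ _ _
  · exact isWeightedHomogeneous_zero ℂ _ _

theorem chernQuot_homogeneous (k l i : ℕ) :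
    IsWeightedHomogeneous (grassWeight k l) (chernQuot k l i) (2 * (i : ℤ)) := by
  unfold chernQuot
  split_ifs with h0 h
  · subst h0; simpa using isWeightedHomogeneous_one ℂ (grassWeight k l)
  · have : (2 * (i : ℤ)) = grassWeight k l (Sum.inr ⟨i - 1, h⟩) := by
      simp only [grassWeight, Sum.elim_inr]; omega
    rw [this]; exact isWeightedHomogeneous_X ℂ _ _
  · exact isWeightedHomogeneous_zero ℂ _ _

theorem grassRelation_homogeneous (k l m : ℕ) : IsWeightedHomogeneous (grassWeight k l)
    (∑ x ∈ Finset.HasAntidiagonal.antidiagonal m, chernSub k l x.1 * chernQuot k l x.2) (2 * (m : ℤ)) := by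
  refine IsWeightedHomogeneous.sum _ _ _ fun x hx => ?_
  have := (chernSub_homogeneous k l x.1).mul (chernQuot_homogeneous k l x.2)
  rw [← Finset.HasAntidiagonal.mem_antidiagonal.1 hx]
  push_cast
  rwa [mul_add]

instance (k l : ℕ) : GradedAlgebra (grassGrading k l) :=
  quotGradedAlgebra _ _ (component_mem_span _ (by
    classical
    rintro p ⟨m, hm, rfl⟩ d
    by_cases hd : 2 * (m : ℤ) = d
    · subst hd
      rw [(grassRelation_homogeneous k l m).weightedHomogeneousComponent_same]
      exact Ideal.subset_span ⟨m, hm, rfl⟩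
    · rw [(grassRelation_homogeneous k l m).weightedHomogeneousComponent_ne d (Ne.symm hd)]
      exact zero_mem _))

theorem grassRelation_constantCoeff (k l m : ℕ) (hm : 1 ≤ m) :
    constantCoeff (∑ x ∈ Finset.HasAntidiagonal.antidiagonal m, chernSub k l x.1 * chernQuot k l x.2) = 0 := by
  rw [constantCoeff_eq]
  exact (grassRelation_homogeneous k l m).coeff_eq_zero 0 (by rw [map_zero]; omega)

/-- The augmentation of the cohomology ring of the Grassmannian. -/
def grassAug (k l : ℕ) : GrassCoh k l →ₐ[ℂ] ℂ :=
  quotAug (constantCoeff_of_mem_span (by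
    rintro _ ⟨m, hm, rfl⟩
    exact grassRelation_constantCoeff k l m hm))

/-- The trivial graded module `ℂ` over the cohomology ring of the Grassmannian. -/
abbrev grassTriv (k l : ℕ) : GrMod (grassGrading k l) :=
  GrMod.triv (grassGrading k l) (grassAug k l) (quotAug_eq_zero _ _)

end Grassmannian

end

/-! Write `n = r + 1`. The relation that the sum of all variables vanishes eliminates the last
variable. In the other `r` variables `H_n` is a complete intersection: its relations are the
complete symmetric polynomials `h_n(x_0)`, `h_{n-1}(x_0, x_1)`, …, `h_2(x_0, …, x_{r-1})`, the
Newton interpolation coefficients of `X ^ n` (`coinvPres_ker`). The `k`-th one is monic in `x_k` and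
the earlier ones do not involve `x_k`, so they form a regular sequence.

Tate's construction then resolves `ℂ`. The Koszul complex on the `r` variables supplies exterior
generators of bidegree `q²t`. Each relation `f = ∑ b_i x_i` of polynomial degree `j` creates one new
homology class, that of `∑ b_i e_i`, which is killed by adjoining a divided power variable of
bidegree `q^{2j}t²`. All relations have degree at least two, so every matrix entry has positive
degree and the resolution is minimal; counting basis elements gives the rational function in (ii).
The complexes live over the polynomial ring and are complexes only modulo the ideal `J` of relations
already imposed (`TateData`), which avoids changing the base ring. The augmentation ideal of `H_n`
is nilpotent, so a homotopy equivalence between minimal resolutions is an isomorphism in each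
degree, and no term of any other resolution can vanish where the minimal one does not.

The remaining parts rest on Hilbert series. `H_n` is the universal algebra in which `X ^ n` becomes
a product of `n` linear factors; adjoining one root after the other gives a monomial basis with
generating function the quantum factorial (`hasHilbert_coinv`). The ring of the Grassmannian
classifies factorizations of `X ^ n` into monic factors of degrees `k` and `n - k`. Splitting both
factors completely recovers `H_n`, which is therefore free over it, and division of Hilbert series
gives the quantum binomial (`hasHilbert_grass`). Over a connected graded algebra, removing lines of
top degree shows that the class of a module is its Hilbert series times the class of the trivial
module (`IsConnectedGraded.cls_eq`).

For the Euler characteristics no minimal resolution is needed. Covering each syzygy by the free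
module on one of its homogeneous bases gives a resolution whose `i`-th term has generators counted
by `(P - 1) ^ i`, with `P` the Hilbert series of the algebra. As `P` has constant term one, each
internal degree sees finitely many terms, and the alternating sum is the geometric series of `1 / P`
(`exists_gradedEulerChar`). -/

noncomputable section

/-! ### Vectors with coordinates in an ideal -/

section CoeffIn

variable {Q T T' ι ι' : Type*} [CommRing Q] [AddCommGroup T] [Module Q T] [AddCommGroup T']
  [Module Q T']

/-- The vectors all of whose coordinates with respect to `b` lie in the ideal `J`. -/
def coeffIn (b : Module.Basis ι Q T) (J : Ideal Q) : Submodule Q T where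
  carrier := {z | ∀ s, b.repr z s ∈ J}
  add_mem' hx hy s := by simpa using J.add_mem (hx s) (hy s)
  zero_mem' s := by simp
  smul_mem' c x hx s := by simpa using J.mul_mem_left c (hx s)

/-- The right-hand side does not mention the basis; this is why linear maps between free modules
preserve the condition. -/
theorem coeffIn_eq_smul_top (b : Module.Basis ι Q T) (J : Ideal Q) :
    coeffIn b J = J • (⊤ : Submodule Q T) := by
  refine le_antisymm (fun z hz => ?_) (Submodule.smul_le.2 fun a ha z _ s => ?_)
  · rw [← b.linearCombination_repr z, Finsupp.linearCombination_apply]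
    exact Submodule.sum_mem _ fun s _ => Submodule.smul_mem_smul (hz s) trivial
  · simpa using J.mul_mem_right _ ha

theorem map_mem_coeffIn (b : Module.Basis ι Q T) (b' : Module.Basis ι' Q T') {J : Ideal Q}
    (φ : T →ₗ[Q] T') {z : T} (hz : z ∈ coeffIn b J) : φ z ∈ coeffIn b' J := by
  rw [coeffIn_eq_smul_top] at hz ⊢
  have := Submodule.mem_map_of_mem (f := φ) hz
  rw [Submodule.map_smul''] at this
  exact Submodule.smul_mono le_rfl le_top this

theorem coeffIn_mono (b : Module.Basis ι Q T) {J J' : Ideal Q} (h : J ≤ J') :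
    coeffIn b J ≤ coeffIn b J' := fun _ hz s => h (hz s)

theorem smul_mem_coeffIn (b : Module.Basis ι Q T) {J : Ideal Q} {a : Q} (ha : a ∈ J) (z : T) :
    a • z ∈ coeffIn b J := fun s => by simpa using J.mul_mem_right _ ha

theorem mem_coeffIn_sup_span (b : Module.Basis ι Q T) {J : Ideal Q} {f : Q} {z : T}
    (hz : z ∈ coeffIn b (J ⊔ Ideal.span {f})) : ∃ w, z - f • w ∈ coeffIn b J := by
  rw [coeffIn_eq_smul_top, Submodule.sup_smul, Submodule.mem_sup] at hz
  obtain ⟨y, hy, y', hy', rfl⟩ := hz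
  rw [Submodule.ideal_span_singleton_smul, Submodule.mem_smul_pointwise_iff_exists] at hy'
  obtain ⟨w, -, rfl⟩ := hy'
  exact ⟨w, by rw [coeffIn_eq_smul_top]; simpa using hy⟩

theorem mem_coeffIn_of_smul (b : Module.Basis ι Q T) {J : Ideal Q} {f : Q}
    (hf : ∀ c, f * c ∈ J → c ∈ J) {z : T} (hz : f • z ∈ coeffIn b J) : z ∈ coeffIn b J :=
  fun s => hf _ (by simpa using hz s)

end CoeffIn

/-! ### Koszul–Tate complexes and exterior variables -/

open MvPolynomial

/-- The ideal generated by the first `k` elements of a sequence. -/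
def initIdeal {Q : Type*} [CommRing Q] (x : ℕ → Q) (k : ℕ) : Ideal Q :=
  Ideal.span (x '' Set.Iio k)

theorem mem_initIdeal {Q : Type*} [CommRing Q] (x : ℕ → Q) {i k : ℕ} (h : i < k) :
    x i ∈ initIdeal x k := Ideal.subset_span ⟨i, h, rfl⟩

theorem initIdeal_succ {Q : Type*} [CommRing Q] (x : ℕ → Q) (k : ℕ) :
    initIdeal x (k + 1) = initIdeal x k ⊔ Ideal.span {x k} := by
  have : Set.Iio (k + 1) = Set.Iio k ∪ {k} := by ext i; simp
  rw [initIdeal, this, Set.image_union, Ideal.span_union, Set.image_singleton, initIdeal]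

theorem initIdeal_mono {Q : Type*} [CommRing Q] (x : ℕ → Q) {i k : ℕ} (h : i ≤ k) :
    initIdeal x i ≤ initIdeal x k :=
  Ideal.span_mono (Set.image_mono (Set.Iio_subset_Iio h))

/-- A Koszul–Tate complex on the first `k` elements of a sequence `x` of linear forms, which is a
resolution of the quotient by these elements after reduction modulo `J`: a free module with a
differential and contracting homotopies `θ i` for the multiplication by `x i`. -/
structure TateData {τ K : Type} [Field K] (x : ℕ → MvPolynomial τ K) (k : ℕ)
    (J : Ideal (MvPolynomial τ K)) where
  T : Type
  [addCommGroup : AddCommGroup T]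
  [module : Module (MvPolynomial τ K) T]
  /-- The index set of the basis. -/
  ι : Type
  basis : Module.Basis ι (MvPolynomial τ K) T
  /-- The index of the unit. -/
  o : ι
  /-- The homological degree. -/
  hd : ι → ℕ
  /-- The internal degree. -/
  wt : ι → ℕ
  d : T →ₗ[MvPolynomial τ K] T
  θ : ℕ → T →ₗ[MvPolynomial τ K] T
  hd_o : hd o = 0
  wt_o : wt o = 0
  finite_hd : ∀ i, {s | hd s = i}.Finite
  d_sq : ∀ z, d (d z) ∈ coeffIn basis J
  anti : ∀ i j z, θ i (θ j z) + θ j (θ i z) = 0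
  htpy : ∀ i < k, ∀ z, d (θ i z) + θ i (d z) = x i • z
  d_entry : ∀ s t, basis.repr (d (basis s)) t ≠ 0 →
    hd s = hd t + 1 ∧ ∃ m, 1 ≤ m ∧ wt s = wt t + m ∧ (basis.repr (d (basis s)) t).IsHomogeneous m
  θ_entry : ∀ i s t, basis.repr (θ i (basis s)) t ≠ 0 →
    hd t = hd s + 1 ∧ wt t = wt s + 1 ∧ (basis.repr (θ i (basis s)) t).IsHomogeneous 0
  d_mem : ∀ z s, basis.repr (d z) s ∈ initIdeal x k
  le : J ≤ initIdeal x k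
  exact : ∀ z, d z ∈ coeffIn basis J →
    ∃ w, ∃ c : MvPolynomial τ K, z - d w - c • basis o ∈ coeffIn basis J

namespace TateData

attribute [instance] TateData.addCommGroup TateData.module

variable {τ K : Type} [Field K] {x : ℕ → MvPolynomial τ K} {k : ℕ} {J : Ideal (MvPolynomial τ K)}

section

variable (C : TateData x k J)

theorem d_one : C.d (C.basis C.o) = 0 := by
  refine C.basis.repr.injective (Finsupp.ext fun t => ?_)
  by_contra h
  have := (C.d_entry C.o t (by simpa using h)).1
  rw [C.hd_o] at this
  omega

/-- Both `J` and all coordinates of boundaries lie in the ideal of the `x i`. Together with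
`exists_of_mem` this identifies the homology in degree zero with the quotient by `initIdeal x k`. -/
theorem mem_of_exact {w : C.T} {c : MvPolynomial τ K}
    (h : c • C.basis C.o - C.d w ∈ coeffIn C.basis J) : c ∈ initIdeal x k := by
  have h1 := C.le (h C.o)
  have := add_mem h1 (C.d_mem w C.o)
  simpa using this

theorem exists_of_mem {c : MvPolynomial τ K} (h : c ∈ initIdeal x k) :
    ∃ w, c • C.basis C.o = C.d w := by
  refine Submodule.span_induction (p := fun c _ => ∃ w, c • C.basis C.o = C.d w) ?_ ⟨0, by simp⟩
    ?_ ?_ h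
  · rintro _ ⟨i, hi, rfl⟩
    refine ⟨C.θ i (C.basis C.o), ?_⟩
    rw [← C.htpy i hi, C.d_one, map_zero, add_zero]
  · rintro a b - - ⟨v, hv⟩ ⟨w, hw⟩
    exact ⟨v + w, by rw [add_smul, hv, hw, map_add]⟩
  · rintro a b - ⟨v, hv⟩
    exact ⟨a • v, by rw [smul_assoc, hv, map_smul]⟩

end

/-- The base ring as a complex concentrated in degree `0`. -/
def base (x : ℕ → MvPolynomial τ K) : TateData x 0 ⊥ where
  T := MvPolynomial τ K
  ι := Unit
  basis := Module.Basis.singleton Unit _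
  o := ()
  hd _ := 0
  wt _ := 0
  d := 0
  θ _ := 0
  hd_o := rfl
  wt_o := rfl
  finite_hd _ := Set.toFinite _
  d_sq _ := by simp
  anti := by simp
  htpy := by simp
  d_entry := by simp
  θ_entry := by simp
  d_mem := by simp
  le := bot_le
  exact z _ := ⟨0, z, by simp⟩

/-- Adjoining an exterior variable. -/
def koszulStep (C : TateData x k J) (hx : ∀ c, x k * c ∈ initIdeal x k → c ∈ initIdeal x k)
    (hxh : (x k).IsHomogeneous 1) : TateData x (k + 1) J where
  T := C.T × C.T
  ι := C.ι ⊕ C.ι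
  basis := C.basis.prod C.basis
  o := Sum.inl C.o
  hd := Sum.elim C.hd fun s => C.hd s + 1
  wt := Sum.elim C.wt fun s => C.wt s + 1
  -- A pair `(u, v)` stands for `u + e v` with a new odd variable `e` such that `d e = x k`. The
  -- operator `θ k` is multiplication by `e`, and the signs come from moving odd operators past `e`.
  d := ((C.d ∘ₗ LinearMap.fst _ _ _) + x k • LinearMap.snd _ _ _).prod
    (-(C.d ∘ₗ LinearMap.snd _ _ _))
  θ i := if i = k then (LinearMap.inr _ _ _) ∘ₗ LinearMap.fst _ _ _ else
    (C.θ i ∘ₗ LinearMap.fst _ _ _).prod (-(C.θ i ∘ₗ LinearMap.snd _ _ _))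
  hd_o := C.hd_o
  wt_o := C.wt_o
  finite_hd i := by
    have h1 := (C.finite_hd i).image (Sum.inl : C.ι → C.ι ⊕ C.ι)
    have h2 := (C.finite_hd (i - 1)).image (Sum.inr : C.ι → C.ι ⊕ C.ι)
    refine (h1.union h2).subset ?_
    rintro (s | s) hs
    · exact Or.inl ⟨s, hs, rfl⟩
    · refine Or.inr ⟨s, ?_, rfl⟩
      simp at hs ⊢
      omega
  d_sq := by
    rintro ⟨u, v⟩ (s | s)
    · simpa using C.d_sq u s
    · simpa using C.d_sq v s
  anti i j := by
    rintro ⟨u, v⟩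
    by_cases hi : i = k <;> by_cases hj : j = k <;> simp [hi, hj, C.anti]
  htpy i hi := by
    rintro ⟨u, v⟩
    by_cases h : i = k
    · simp [h]
    · have h' := C.htpy i (by omega)
      refine Prod.ext ?_ ?_
      · simp [if_neg h, ← h' u]
        abel
      · simp [if_neg h, ← h' v]
  d_entry := by
    rintro (s | s) (t | t) h
    · simpa using C.d_entry s t (by simpa using h)
    · simp at h
    · simp only [Module.Basis.prod_apply, Sum.elim_inr] at h
      by_cases hst : s = t
      · subst hst
        simpa using hxh
      · simp [hst] at h
    · simp at h ⊢
      obtain ⟨h1, m, h2, h3, h4⟩ := C.d_entry s t h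
      exact ⟨by omega, m, h2, by omega, by simpa using h4.neg⟩
  θ_entry i := by
    by_cases hi : i = k
    · rintro (s | s) (t | t) h
      · simp [hi] at h
      · by_cases hst : s = t
        · subst hst
          simpa [hi] using isHomogeneous_one τ K
        · simp [hi, hst] at h
      · simp [hi] at h
      · simp [hi] at h
    · rintro (s | s) (t | t) h
      · simpa [hi] using C.θ_entry i s t (by simpa [hi] using h)
      · simp [hi] at h
      · simp [hi] at h
      · simp [hi] at h ⊢
        obtain ⟨h1, h2, h3⟩ := C.θ_entry i s t h
        exact ⟨by omega, by omega, by simpa using h3.neg⟩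
  d_mem := by
    have hle := initIdeal_mono x k.le_succ
    rintro ⟨u, v⟩ (s | s)
    · simpa using add_mem (hle (C.d_mem u s))
        (Ideal.mul_mem_right _ _ (mem_initIdeal x k.lt_succ_self))
    · simpa using hle (C.d_mem v s)
  le := C.le.trans (initIdeal_mono x k.le_succ)
  exact := by
    rintro ⟨u, v⟩ h
    have h1 : C.d u + x k • v ∈ coeffIn C.basis J := fun s => by simpa using h (Sum.inl s)
    have h2 : C.d v ∈ coeffIn C.basis J := fun s => by simpa using h (Sum.inr s)
    obtain ⟨w, c, hw⟩ := C.exact v h2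
    -- Modulo `J`, `x k • v` is the boundary of `-u` and `v` is `d w + c`, so `x k * c` is zero in
    -- homology of degree zero. Regularity of `x k` then removes the factor, `c` becomes a boundary,
    -- and `v` lifts to `w + w'`.
    have hc : c ∈ initIdeal x k := by
      refine hx c (C.mem_of_exact (w := -(u + x k • w)) ?_)
      have := sub_mem h1 (Submodule.smul_mem _ (x k) hw)
      convert this using 1
      simp only [map_neg, map_add, map_smul]
      module
    obtain ⟨w', hw'⟩ := C.exists_of_mem hc
    have h3 : C.d (u + x k • (w + w')) ∈ coeffIn C.basis J := by
      have := sub_mem h1 (Submodule.smul_mem _ (x k) hw)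
      convert this using 1
      simp only [map_add, map_smul, hw']
      module
    obtain ⟨y, c', hy⟩ := C.exact _ h3
    refine ⟨(y, -(w + w')), c', ?_⟩
    rintro (s | s)
    · convert hy s using 1
      simp
      ring
    · convert hw s using 1
      simp [hw']
      ring

end TateData

end

/-! ### Adjoining a divided power variable -/

noncomputable section

open MvPolynomial

/-- The differential `d + σ S` on the divided power extension of a complex, where `S` lowers the
divided power by one. -/
def dividedPowerDiff {Q T : Type*} [CommRing Q] [AddCommGroup T] [Module Q T] (d σ : T →ₗ[Q] T) :
    (ℕ →₀ T) →ₗ[Q] (ℕ →₀ T) :=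
  Finsupp.mapRange.linearMap d +
    Finsupp.mapRange.linearMap σ ∘ₗ Finsupp.lcomapDomain Nat.succ Nat.succ_injective

section

variable {Q T : Type*} [CommRing Q] [AddCommGroup T] [Module Q T] (d σ : T →ₗ[Q] T)

theorem dividedPowerDiff_apply (z : ℕ →₀ T) (j : ℕ) :
    dividedPowerDiff d σ z j = d (z j) + σ (z (j + 1)) := rfl

end

namespace TateData

variable {τ K : Type} [Field K] {x : ℕ → MvPolynomial τ K} {k : ℕ} {J : Ideal (MvPolynomial τ K)}

section

variable (C : TateData x k J) (b : ℕ → MvPolynomial τ K)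

/-- The contracting homotopy for the multiplication by `∑ b i * x i`. -/
def homotopy : C.T →ₗ[MvPolynomial τ K] C.T := ∑ i ∈ Finset.range k, b i • C.θ i

theorem homotopy_apply (z : C.T) : C.homotopy b z = ∑ i ∈ Finset.range k, b i • C.θ i z := by
  simp [homotopy]

/-- Applied to the unit, this says that `∑ b i * e i` has boundary `f = ∑ b i * x i`. It becomes a
cycle once `f` is set to zero, and it is the class that the divided powers have to kill. -/
theorem homotopy_htpy (z : C.T) : C.d (C.homotopy b z) + C.homotopy b (C.d z) =
    (∑ i ∈ Finset.range k, b i * x i) • z := by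
  rw [homotopy_apply, homotopy_apply, map_sum, ← Finset.sum_add_distrib, Finset.sum_smul]
  refine Finset.sum_congr rfl fun i hi => ?_
  rw [map_smul, ← smul_add, C.htpy i (Finset.mem_range.1 hi), smul_smul]

/-- Anticommutation of the `θ i` only shows that twice the square vanishes, hence the division by
two. -/
theorem homotopy_sq [NeZero (2 : K)] (z : C.T) : C.homotopy b (C.homotopy b z) = 0 := by
  have h : C.homotopy b (C.homotopy b z) + C.homotopy b (C.homotopy b z) = 0 := by
    simp only [homotopy_apply, map_sum, map_smul, Finset.smul_sum]
    -- Exchanging the indices in one of the two copies pairs `θ i θ j` with `θ j θ i`.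
    nth_rewrite 2 [Finset.sum_comm]
    rw [← Finset.sum_add_distrib]
    refine Finset.sum_eq_zero fun i _ => ?_
    rw [← Finset.sum_add_distrib]
    refine Finset.sum_eq_zero fun j _ => ?_
    rw [smul_comm (b i), ← smul_add, ← smul_add, C.anti, smul_zero, smul_zero]
  refine C.basis.repr.injective (Finsupp.ext fun t => ?_)
  have h2 : (2 : K) • C.basis.repr (C.homotopy b (C.homotopy b z)) t = 0 := by
    rw [two_smul]
    simpa using DFunLike.congr_fun (congrArg C.basis.repr h) t
  simpa using (smul_eq_zero_iff_right (NeZero.ne (2 : K))).1 h2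

theorem homotopy_entry {m : ℕ} (hb : ∀ i < k, (b i).IsHomogeneous m) (s t : C.ι)
    (h : C.basis.repr (C.homotopy b (C.basis s)) t ≠ 0) :
    C.hd t = C.hd s + 1 ∧ C.wt t = C.wt s + 1 ∧
      (C.basis.repr (C.homotopy b (C.basis s)) t).IsHomogeneous m := by
  have e : C.basis.repr (C.homotopy b (C.basis s)) t =
      ∑ i ∈ Finset.range k, b i * C.basis.repr (C.θ i (C.basis s)) t := by
    simp [homotopy_apply]
  rw [e] at h ⊢
  obtain ⟨i, -, hi⟩ := Finset.exists_ne_zero_of_sum_ne_zero h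
  obtain ⟨h1, h2, -⟩ := C.θ_entry i s t (right_ne_zero_of_mul hi)
  refine ⟨h1, h2, IsHomogeneous.sum _ _ _ fun i hi => ?_⟩
  by_cases h0 : C.basis.repr (C.θ i (C.basis s)) t = 0
  · rw [h0, mul_zero]; exact isHomogeneous_zero _ _ _
  · simpa using (hb i (Finset.mem_range.1 hi)).mul (C.θ_entry i s t h0).2.2

/-- The basis of the divided power extension. -/
def dpBasis : Module.Basis (Σ _ : ℕ, C.ι) (MvPolynomial τ K) (ℕ →₀ C.T) :=
  Finsupp.basis fun _ => C.basis

theorem dpBasis_repr (z : ℕ →₀ C.T) (j : ℕ) (s : C.ι) :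
    C.dpBasis.repr z ⟨j, s⟩ = C.basis.repr (z j) s := rfl

theorem dpBasis_apply (j : ℕ) (s : C.ι) : C.dpBasis ⟨j, s⟩ = Finsupp.single j (C.basis s) := by
  simp [dpBasis]

theorem mem_coeffIn_dpBasis {I : Ideal (MvPolynomial τ K)} {z : ℕ →₀ C.T} :
    z ∈ coeffIn C.dpBasis I ↔ ∀ j, z j ∈ coeffIn C.basis I :=
  ⟨fun h j s => h ⟨j, s⟩, fun h s => h s.1 s.2⟩

/-- With `σ` the homotopy and `S` the lowering of divided powers, the square is `d² + (dσ + σd) S +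
σ² S²`. The first term vanishes modulo `J`, the second is multiplication by `f`, the third is zero.
-/
theorem dp_sq [NeZero (2 : K)] {f : MvPolynomial τ K} (hf : f = ∑ i ∈ Finset.range k, b i * x i)
    (z : ℕ →₀ C.T) :
    dividedPowerDiff C.d (C.homotopy b) (dividedPowerDiff C.d (C.homotopy b) z) ∈
      coeffIn C.dpBasis (J ⊔ Ideal.span {f}) := by
  refine C.mem_coeffIn_dpBasis.2 fun j => ?_
  simp only [dividedPowerDiff_apply, map_add, C.homotopy_sq, add_zero]
  rw [add_assoc, C.homotopy_htpy, ← hf]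
  exact add_mem (coeffIn_mono _ le_sup_left (C.d_sq _))
    (smul_mem_coeffIn _ (le_sup_right (a := J) (Ideal.mem_span_singleton_self f)) _)

/-- Cycles of the reduction modulo one more regular element. -/
theorem exists_of_cycle {f : MvPolynomial τ K} (hf : f = ∑ i ∈ Finset.range k, b i * x i)
    (hreg : ∀ c, f * c ∈ J → c ∈ J) {z : C.T}
    (hz : C.d z ∈ coeffIn C.basis (J ⊔ Ideal.span {f})) :
    ∃ c c' : MvPolynomial τ K, ∃ u : C.T, z - c • C.homotopy b (C.basis C.o) - C.d u - c' • C.basis C.o ∈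
      coeffIn C.basis (J ⊔ Ideal.span {f}) := by
  have hd := C.d_one
  -- Write `d z = f w` modulo `J`. As `d² = 0` there and `f` is regular, `w` is a cycle, so `w = d v
  -- + c`; since `f = d (σ 1)`, subtracting `c σ 1 + f v` turns `z` into a cycle modulo `J`. Hence
  -- the only homology modulo `f` comes from `1` and `σ 1`.
  obtain ⟨w, hw⟩ := mem_coeffIn_sup_span _ hz
  have h1 : C.d w ∈ coeffIn C.basis J := by
    refine mem_coeffIn_of_smul _ hreg ?_
    have := sub_mem (C.d_sq z) (map_mem_coeffIn C.basis C.basis C.d hw)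
    simpa using this
  obtain ⟨v, c, hv⟩ := C.exact w h1
  have hσ := C.homotopy_htpy b (C.basis C.o)
  rw [hd, map_zero, add_zero, ← hf] at hσ
  have h2 : C.d (z - c • C.homotopy b (C.basis C.o) - f • v) ∈ coeffIn C.basis J := by
    have := add_mem hw (Submodule.smul_mem _ f hv)
    convert this using 1
    simp only [map_sub, map_smul, hσ]
    module
  obtain ⟨u, c', hu⟩ := C.exact _ h2
  refine ⟨c, c', u, ?_⟩
  have := add_mem (coeffIn_mono _ le_sup_left hu)
    (smul_mem_coeffIn C.basis (le_sup_right (a := J) (Ideal.mem_span_singleton_self f)) v)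
  convert this using 1
  abel

/-- This controls the annihilator of the new class: if `c σ 1` is a boundary modulo `J` and `f`,
write the difference as `f w`, apply `d` to get `f c = f (d w)` modulo `J`, and cancel `f`. -/
theorem mem_of_cycle {f : MvPolynomial τ K} (hf : f = ∑ i ∈ Finset.range k, b i * x i)
    (hreg : ∀ c, f * c ∈ J → c ∈ J) {z : C.T} {c : MvPolynomial τ K}
    (hz : C.d z + c • C.homotopy b (C.basis C.o) ∈ coeffIn C.basis (J ⊔ Ideal.span {f})) :
    c ∈ initIdeal x k := by
  obtain ⟨w, hw⟩ := mem_coeffIn_sup_span _ hz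
  have hσ := C.homotopy_htpy b (C.basis C.o)
  rw [C.d_one, map_zero, add_zero, ← hf] at hσ
  refine C.mem_of_exact (w := w) (mem_coeffIn_of_smul _ hreg ?_)
  have := sub_mem (map_mem_coeffIn C.basis C.basis C.d hw) (C.d_sq z)
  convert this using 1
  simp only [map_sub, map_add, map_smul, hσ]
  module

/-- Induction on a bound for the divided powers that occur modulo the ideal: subtracting a boundary
removes the top coefficient, until only a multiple of the unit is left. -/
theorem dp_exact [NeZero (2 : K)] {f : MvPolynomial τ K}
    (hf : f = ∑ i ∈ Finset.range k, b i * x i)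
    (hreg : ∀ c, f * c ∈ J → c ∈ J) (N : ℕ) (z : ℕ →₀ C.T)
    (hN : ∀ j ≥ N, z j ∈ coeffIn C.basis (J ⊔ Ideal.span {f}))
    (hz : dividedPowerDiff C.d (C.homotopy b) z ∈ coeffIn C.dpBasis (J ⊔ Ideal.span {f})) :
    ∃ w, ∃ c : MvPolynomial τ K, z - dividedPowerDiff C.d (C.homotopy b) w - c • C.dpBasis ⟨0, C.o⟩ ∈
      coeffIn C.dpBasis (J ⊔ Ideal.span {f}) := by
  classical
  have hd := C.d_one
  induction N generalizing z with
  | zero => exact ⟨0, 0, by simpa using C.mem_coeffIn_dpBasis.2 fun j => hN j (Nat.zero_le j)⟩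
  | succ N ih =>
    have hz' := C.mem_coeffIn_dpBasis.1 hz
    have h1 : C.d (z N) ∈ coeffIn C.basis (J ⊔ Ideal.span {f}) := by
      have := sub_mem (hz' N)
        (map_mem_coeffIn C.basis C.basis (C.homotopy b) (hN (N + 1) le_rfl))
      simpa [dividedPowerDiff_apply] using this
    -- The top coefficient is `c σ 1 + d u + c'`. The first summand is the differential of `c` times
    -- the next divided power; the second is removed by `u` in the same divided power, at the cost
    -- of a change one power lower.
    obtain ⟨c, c', u, hu⟩ := C.exists_of_cycle b hf hreg h1
    -- In divided power zero the constant `c'` stays, and is the one in the conclusion. In higher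
    -- powers it has to be removed as well.
    obtain _ | N := N
    · refine ⟨Finsupp.single 1 (c • C.basis C.o) + Finsupp.single 0 u, c',
        C.mem_coeffIn_dpBasis.2 fun j => ?_⟩
      obtain _ | j := j
      · convert hu using 1
        simp [dividedPowerDiff_apply, dpBasis_apply]
        abel
      · have := hN (j + 1) (by omega)
        convert this using 1
        by_cases hj : j = 0
        · subst hj
          simp [dividedPowerDiff_apply, dpBasis_apply, hd]
        · simp [dividedPowerDiff_apply, dpBasis_apply, hj]
    · have hc : c' ∈ initIdeal x k := by
        refine C.mem_of_cycle b hf hreg (z := z N - C.homotopy b u) ?_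
        have hσ := C.homotopy_htpy b u
        have h2 := map_mem_coeffIn C.basis C.basis (C.homotopy b) hu
        have h3 := sub_mem (hz' N) h2
        have h4 := sub_mem h3 (smul_mem_coeffIn C.basis
          (le_sup_right (a := J) (Ideal.mem_span_singleton_self f)) u)
        convert h4 using 1
        rw [hf, ← hσ, dividedPowerDiff_apply]
        simp only [map_sub, map_smul, C.homotopy_sq]
        module
      obtain ⟨w', hw'⟩ := C.exists_of_mem hc
      set y : ℕ →₀ C.T := Finsupp.single (N + 2) (c • C.basis C.o) + Finsupp.single (N + 1) (u + w')
        with hy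
      have key : ∀ j ≥ N + 1, (z - dividedPowerDiff C.d (C.homotopy b) y) j ∈
          coeffIn C.basis (J ⊔ Ideal.span {f}) := by
        intro j hj
        by_cases h1 : j = N + 1
        · subst h1
          convert hu using 1
          simp [hy, dividedPowerDiff_apply, hw']
          abel
        · have := hN j (by omega)
          convert this using 1
          by_cases h2 : j = N + 2
          · subst h2
            simp [hy, dividedPowerDiff_apply, hd]
          · have e1 : ¬ N + 2 = j := by omega
            have e2 : ¬ N + 1 = j := by omega
            have e3 : ¬ N + 2 = j + 1 := by omega
            have e4 : ¬ N = j := by omega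
            simp [hy, dividedPowerDiff_apply, e1, e2, e3, e4]
      obtain ⟨w, e, hw⟩ := ih (z - dividedPowerDiff C.d (C.homotopy b) y) key (by
        rw [map_sub]
        exact sub_mem hz (C.dp_sq b hf y))
      refine ⟨y + w, e, ?_⟩
      convert hw using 1
      rw [map_add]
      abel

end

/-- Adjoining a divided power variable that kills `f = ∑ b i * x i`. -/
def tateStep [NeZero (2 : K)] (C : TateData x k J) (b : ℕ → MvPolynomial τ K) {m : ℕ} (hm : 1 ≤ m)
    (hb : ∀ i < k, (b i).IsHomogeneous m) (hbx : ∀ i < k, b i ∈ initIdeal x k) (f : MvPolynomial τ K)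
    (hf : f = ∑ i ∈ Finset.range k, b i * x i)
    (hreg : ∀ c, f * c ∈ J → c ∈ J) : TateData x k (J ⊔ Ideal.span {f}) where
  T := ℕ →₀ C.T
  ι := Σ _ : ℕ, C.ι
  basis := C.dpBasis
  o := ⟨0, C.o⟩
  -- The new variable has homological degree one more than `σ 1`, and internal degree that of `f`,
  -- which is one more than the degree `m` of the coefficients `b i`.
  hd s := C.hd s.2 + 2 * s.1
  wt s := C.wt s.2 + (m + 1) * s.1
  d := dividedPowerDiff C.d (C.homotopy b)
  θ i := Finsupp.mapRange.linearMap (C.θ i)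
  hd_o := by simp [C.hd_o]
  wt_o := by simp [C.wt_o]
  finite_hd i := by
    have h : ((Set.Iic i) ×ˢ ⋃ l ∈ Set.Iic i, {s | C.hd s = l}).Finite :=
      (Set.finite_Iic i).prod ((Set.finite_Iic i).biUnion fun l _ => C.finite_hd l)
    refine (h.image fun p => (⟨p.1, p.2⟩ : Σ _ : ℕ, C.ι)).subset ?_
    rintro ⟨j, s⟩ hs
    simp at hs ⊢
    omega
  d_sq := C.dp_sq b hf
  anti i j z := Finsupp.ext fun l => by simpa using C.anti i j (z l)
  htpy i hi z := Finsupp.ext fun l => by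
    -- The operators `θ i` anticommute with `σ`, so the new summand of the differential does not
    -- disturb the homotopy relation.
    have hσ : ∀ u, C.homotopy b (C.θ i u) + C.θ i (C.homotopy b u) = 0 := fun u => by
      rw [homotopy_apply, homotopy_apply, map_sum, ← Finset.sum_add_distrib]
      refine Finset.sum_eq_zero fun j _ => ?_
      rw [map_smul, ← smul_add, C.anti, smul_zero]
    have h := C.htpy i hi (z l)
    have h' := hσ (z (l + 1))
    simp only [Finsupp.add_apply, dividedPowerDiff_apply, Finsupp.mapRange.linearMap_apply,
      Finsupp.mapRange_apply, map_add, Finsupp.smul_apply]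
    rw [add_add_add_comm, h, h', add_zero]
  d_entry := by
    classical
    rintro ⟨j, s⟩ ⟨l, t⟩ h
    simp only [dpBasis_apply, dpBasis_repr, dividedPowerDiff_apply, Finsupp.single_apply] at h ⊢
    by_cases h1 : j = l
    · subst h1
      simp at h ⊢
      obtain ⟨h1, p, h2, h3, h4⟩ := C.d_entry s t h
      exact ⟨by omega, p, h2, by omega, h4⟩
    · by_cases h2 : j = l + 1
      · subst h2
        simp at h ⊢
        obtain ⟨h1, h2, h3⟩ := C.homotopy_entry b hb s t h
        exact ⟨by omega, m, hm, by rw [h2]; ring, h3⟩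
      · simp [h1, h2] at h
  θ_entry i := by
    classical
    rintro ⟨j, s⟩ ⟨l, t⟩ h
    simp only [dpBasis_apply, dpBasis_repr, Finsupp.mapRange.linearMap_apply, Finsupp.mapRange_apply,
      Finsupp.single_apply] at h ⊢
    by_cases h1 : j = l
    · subst h1
      simp at h ⊢
      obtain ⟨h1, h2, h3⟩ := C.θ_entry i s t h
      exact ⟨by omega, by omega, h3⟩
    · simp [h1] at h
  d_mem := by
    rintro z ⟨j, s⟩
    rw [dpBasis_repr, dividedPowerDiff_apply, map_add, homotopy_apply]
    refine add_mem (C.d_mem _ _) ?_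
    simp only [map_sum, map_smul, Finsupp.finsetSum_apply, Finsupp.smul_apply, smul_eq_mul]
    exact Ideal.sum_mem _ fun i hi => Ideal.mul_mem_right _ _ (hbx i (Finset.mem_range.1 hi))
  le := by
    refine sup_le C.le ((Ideal.span_singleton_le_iff_mem _).2 ?_)
    rw [hf]
    exact Ideal.sum_mem _ fun i hi =>
      Ideal.mul_mem_left _ _ (mem_initIdeal x (Finset.mem_range.1 hi))
  exact z hz := by
    refine C.dp_exact b hf hreg (z.support.sup id + 1) z (fun j hj => ?_) hz
    have : z j = 0 := by
      by_contra h
      have := Finset.le_sup (f := id) (Finsupp.mem_support_iff.2 h)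
      simp at this
      omega
    rw [this]
    exact zero_mem _

end TateData

end

noncomputable section

open MvPolynomial

/-! ### Newton interpolation of a power of the variable -/

section Newton

open Polynomial in
/-- The successive quotients of `X ^ n` by `X - y 0`, `X - y 1`, … -/
def newtonPoly {R : Type*} [CommRing R] (y : ℕ → R) (n : ℕ) : ℕ → Polynomial R
  | 0 => Polynomial.X ^ n
  | k + 1 => newtonPoly y n k /ₘ (Polynomial.X - Polynomial.C (y k))

/-- The complete symmetric polynomial of degree `n - k` in `y 0, …, y k`, as the remainder of a
successive quotient of `X ^ n`. -/
def newtonCoeff {R : Type*} [CommRing R] (y : ℕ → R) (n k : ℕ) : R := (newtonPoly y n k).eval (y k)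

variable {R S : Type*} [CommRing R] [CommRing S] (y : ℕ → R) (n : ℕ)

theorem newtonPoly_eq (k : ℕ) : newtonPoly y n k = Polynomial.C (newtonCoeff y n k) +
    (Polynomial.X - Polynomial.C (y k)) * newtonPoly y n (k + 1) := by
  rw [newtonCoeff, ← Polynomial.modByMonic_X_sub_C_eq_C_eval, newtonPoly,
    Polynomial.modByMonic_add_div]

theorem newtonPoly_map (φ : R →+* S) (k : ℕ) :
    (newtonPoly y n k).map φ = newtonPoly (fun i => φ (y i)) n k := by
  induction k with
  | zero => simp [newtonPoly]
  | succ k ih =>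
    rw [newtonPoly, newtonPoly, Polynomial.map_divByMonic _ (Polynomial.monic_X_sub_C _), ih]
    simp

theorem newtonCoeff_map (φ : R →+* S) (k : ℕ) :
    φ (newtonCoeff y n k) = newtonCoeff (fun i => φ (y i)) n k := by
  rw [newtonCoeff, newtonCoeff, ← newtonPoly_map, Polynomial.eval_map_apply]

theorem newtonPoly_congr {y z : ℕ → R} {k : ℕ} (h : ∀ i < k, y i = z i) :
    newtonPoly y n k = newtonPoly z n k := by
  induction k with
  | zero => rfl
  | succ k ih => rw [newtonPoly, newtonPoly, ih fun i hi => h i (by omega), h k (by omega)]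

theorem newtonCoeff_congr {y z : ℕ → R} {k : ℕ} (h : ∀ i ≤ k, y i = z i) :
    newtonCoeff y n k = newtonCoeff z n k := by
  rw [newtonCoeff, newtonCoeff, newtonPoly_congr n fun i hi => h i hi.le, h k le_rfl]

theorem newtonPoly_natDegree [Nontrivial R] (k : ℕ) : (newtonPoly y n k).natDegree = n - k := by
  induction k with
  | zero => simp [newtonPoly]
  | succ k ih =>
    rw [newtonPoly, Polynomial.natDegree_divByMonic _ (Polynomial.monic_X_sub_C _), ih,
      Polynomial.natDegree_X_sub_C, Nat.sub_sub]

theorem newtonPoly_monic {k : ℕ} (hk : k ≤ n) : (newtonPoly y n k).Monic := by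
  nontriviality R
  induction k with
  | zero => exact Polynomial.monic_X_pow n
  | succ k ih =>
    rw [Polynomial.Monic, newtonPoly,
      Polynomial.leadingCoeff_divByMonic_of_monic (Polynomial.monic_X_sub_C _)]
    · exact ih (by omega)
    · rw [Polynomial.degree_X_sub_C]
      by_contra! h
      rw [Nat.WithBot.lt_one_iff_le_zero] at h
      have := newtonPoly_natDegree y n k
      have h0 := Polynomial.natDegree_eq_zero_iff_degree_le_zero.2 h
      omega

/-- Newton's interpolation formula for `X ^ n`. -/
theorem X_pow_eq_newton (k : ℕ) : (Polynomial.X ^ n : Polynomial R) =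
    ∑ j ∈ Finset.range k, Polynomial.C (newtonCoeff y n j) *
      ∏ i ∈ Finset.range j, (Polynomial.X - Polynomial.C (y i)) +
    (∏ i ∈ Finset.range k, (Polynomial.X - Polynomial.C (y i))) * newtonPoly y n k := by
  induction k with
  | zero => simp [newtonPoly]
  | succ k ih =>
    rw [ih, newtonPoly_eq, Finset.sum_range_succ, Finset.prod_range_succ]
    ring

/-- If `X ^ n` already splits with roots `y i`, each division removes one factor. The next factor
then vanishes at `y k`, so all Newton coefficients below `n` are zero. -/
theorem newtonPoly_eq_prod [Nontrivial R] {y : ℕ → R} {n : ℕ}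
    (h : (Polynomial.X ^ n : Polynomial R) =
      ∏ i ∈ Finset.range n, (Polynomial.X - Polynomial.C (y i))) {k : ℕ} (hk : k ≤ n) :
    newtonPoly y n k = ∏ i ∈ Finset.Ico k n, (Polynomial.X - Polynomial.C (y i)) := by
  induction k with
  | zero => rw [newtonPoly, h, Finset.range_eq_Ico]
  | succ k ih =>
    rw [newtonPoly, ih (by omega), Finset.prod_eq_prod_Ico_succ_bot (by omega)]
    exact Polynomial.mul_divByMonic_cancel_left _ (Polynomial.monic_X_sub_C _)

theorem newtonCoeff_eq_zero [Nontrivial R] {y : ℕ → R} {n : ℕ}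
    (h : (Polynomial.X ^ n : Polynomial R) =
      ∏ i ∈ Finset.range n, (Polynomial.X - Polynomial.C (y i))) {k : ℕ} (hk : k < n) :
    newtonCoeff y n k = 0 := by
  rw [newtonCoeff, newtonPoly_eq_prod h hk.le, Polynomial.eval_prod]
  exact Finset.prod_eq_zero (Finset.left_mem_Ico.2 hk) (by simp)

end Newton

/-! ### Regular sequences and Euler's formula -/

section Regular

/-- An element that is a monic polynomial in one variable is regular modulo an ideal generated by
elements not involving this variable. -/
theorem mem_of_monic_mul_mem {Q B : Type*} [CommRing Q] [CommRing B] (e : Q ≃+* Polynomial B)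
    {S : Set Q} (hS : ∀ s ∈ S, ∃ b, e s = Polynomial.C b) {f : Q} (hf : (e f).Monic) (c : Q)
    (h : f * c ∈ Ideal.span S) : c ∈ Ideal.span S := by
  set J : Ideal B := Ideal.span {b | e.symm (Polynomial.C b) ∈ S} with hJ
  -- Since the generators are constants in the chosen variable, membership can be tested on
  -- coefficients modulo `J`. A monic polynomial stays monic there, hence is not a zero divisor.
  have key : ∀ c, c ∈ Ideal.span S ↔ Polynomial.map (Ideal.Quotient.mk J) (e c) = 0 := by
    refine fun c => ⟨fun hc => ?_, fun hc => ?_⟩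
    · have : Ideal.span S ≤ RingHom.ker ((Polynomial.mapRingHom (Ideal.Quotient.mk J)).comp
          (e : Q →+* Polynomial B)) := by
        refine Ideal.span_le.2 fun s hs => ?_
        obtain ⟨b, hb⟩ := hS s hs
        have hbJ : b ∈ J := Ideal.subset_span (by
          change e.symm (Polynomial.C b) ∈ S
          rw [← hb, RingEquiv.symm_apply_apply]; exact hs)
        simp [RingHom.mem_ker, hb, Ideal.Quotient.eq_zero_iff_mem.2 hbJ]
      exact this hc
    · have h1 : e c ∈ Ideal.map Polynomial.C J := Ideal.mem_map_C_iff.2 fun n => by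
        rw [← Ideal.Quotient.eq_zero_iff_mem, ← Polynomial.coeff_map, hc, Polynomial.coeff_zero]
      have h2 : Ideal.map Polynomial.C J ≤ (Ideal.span S).comap (e.symm : Polynomial B →+* Q) := by
        rw [Ideal.map_le_iff_le_comap, hJ, Ideal.span_le]
        exact fun b hb => Ideal.subset_span hb
      simpa using h2 h1
  rw [key] at h ⊢
  rw [map_mul, Polynomial.map_mul] at h
  exact (hf.map _).isRegular.left (h.trans (mul_zero _).symm)

variable {K : Type} [Field K] (r : ℕ)

/-- The variables as an infinite sequence. -/
def varSeq (K : Type) [Field K] (r i : ℕ) : MvPolynomial (Fin r) K :=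
  if h : i < r then X ⟨i, h⟩ else 0

theorem varSeq_of_lt {i : ℕ} (h : i < r) : varSeq K r i = X ⟨i, h⟩ := dif_pos h

theorem varSeq_homogeneous (i : ℕ) : (varSeq K r i).IsHomogeneous 1 := by
  unfold varSeq
  split_ifs
  · exact isHomogeneous_X _ _
  · exact isHomogeneous_zero _ _ _

/-- Singling out one variable. -/
def isolate (K : Type) [Field K] {r : ℕ} (i : Fin r) :
    MvPolynomial (Fin r) K ≃+* Polynomial (MvPolynomial {j // j ≠ i} K) :=
  ((renameEquiv K (Equiv.optionSubtypeNe i).symm).trans (optionEquivLeft K _)).toRingEquiv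

theorem isolate_self (i : Fin r) : isolate K i (X i) = Polynomial.X := by
  simp [isolate]

theorem isolate_ne {i j : Fin r} (h : j ≠ i) :
    isolate K i (X j) = Polynomial.C (X ⟨j, h⟩) := by
  simp [isolate, Equiv.optionSubtypeNe_symm_of_ne h]

theorem isolate_varSeq {k : ℕ} (hk : k < r) : ∃ y : ℕ → MvPolynomial {j // j ≠ (⟨k, hk⟩ : Fin r)} K,
    ∀ i ≠ k, isolate K ⟨k, hk⟩ (varSeq K r i) = Polynomial.C (y i) := by
  refine ⟨fun i => if h : i < r ∧ i ≠ k then X ⟨⟨i, h.1⟩, by simpa using h.2⟩ else 0, fun i hi => ?_⟩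
  by_cases h : i < r
  · rw [varSeq_of_lt r h, isolate_ne r (by simpa using hi)]
    simp [h, hi]
  · simp [varSeq, h]

theorem mem_of_varSeq_mul_mem {k : ℕ} (hk : k < r) (c : MvPolynomial (Fin r) K)
    (h : varSeq K r k * c ∈ initIdeal (varSeq K r) k) : c ∈ initIdeal (varSeq K r) k := by
  obtain ⟨y, hy⟩ := isolate_varSeq (K := K) r hk
  refine mem_of_monic_mul_mem (isolate K ⟨k, hk⟩) ?_ ?_ c h
  · rintro _ ⟨i, hi, rfl⟩
    exact ⟨_, hy i (ne_of_lt hi)⟩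
  · rw [varSeq_of_lt r hk, isolate_self]
    exact Polynomial.monic_X

/-- The `k`-th coefficient is a monic polynomial, with coefficients in the variables before the
`k`-th, evaluated at the `k`-th variable. The earlier coefficients do not involve this variable, so
the sequence is triangular. -/
theorem mem_of_newtonCoeff_mul_mem {k n : ℕ} (hk : k < r) (hn : k ≤ n) (c : MvPolynomial (Fin r) K)
    (h : newtonCoeff (varSeq K r) n k * c ∈ initIdeal (newtonCoeff (varSeq K r) n) k) :
    c ∈ initIdeal (newtonCoeff (varSeq K r) n) k := by
  obtain ⟨y, hy⟩ := isolate_varSeq (K := K) r hk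
  refine mem_of_monic_mul_mem (isolate K ⟨k, hk⟩) ?_ ?_ c h
  · rintro _ ⟨i, hi, rfl⟩
    refine ⟨newtonCoeff y n i, ?_⟩
    have := newtonCoeff_map (varSeq K r) n (isolate K (⟨k, hk⟩ : Fin r)).toRingHom i
    refine this.trans ?_
    rw [newtonCoeff_map]
    exact newtonCoeff_congr n fun j hj => hy j (by simp at hi; omega)
  · have := newtonCoeff_map (varSeq K r) n (isolate K (⟨k, hk⟩ : Fin r)).toRingHom k
    refine (congrArg Polynomial.Monic this).mpr ?_
    have e2 : newtonPoly (fun i => (isolate K (⟨k, hk⟩ : Fin r)).toRingHom (varSeq K r i)) n k =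
        newtonPoly (fun i => Polynomial.C (y i)) n k :=
      newtonPoly_congr n fun i hi => hy i (ne_of_lt hi)
    rw [newtonCoeff, e2, ← newtonPoly_map]
    -- After isolating the `k`-th variable it is the polynomial variable itself, so evaluation at it
    -- returns the monic quotient.
    have e : (isolate K (⟨k, hk⟩ : Fin r)).toRingHom (varSeq K r k) = Polynomial.X := by
      rw [varSeq_of_lt r hk]; exact isolate_self r _
    rw [e, Polynomial.eval_map, Polynomial.eval₂_C_X]
    exact newtonPoly_monic y n hn

theorem newtonPoly_coeff_homogeneous {τ : Type} {y : ℕ → MvPolynomial τ K}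
    (hy : ∀ i, (y i).IsHomogeneous 1) (n k j m : ℕ) (hm : j + k + m = n) :
    ((newtonPoly y n k).coeff j).IsHomogeneous m := by
  induction k generalizing j m with
  | zero =>
    rw [newtonPoly, Polynomial.coeff_X_pow]
    split_ifs with h
    · obtain rfl : m = 0 := by omega
      exact isHomogeneous_one _ _
    · exact isHomogeneous_zero _ _ _
  | succ k ih =>
    rw [newtonPoly, Polynomial.coeff_divByMonic_X_sub_C]
    refine IsHomogeneous.sum _ _ _ fun i hi => ?_
    rw [Finset.mem_Icc, newtonPoly_natDegree] at hi
    have h1 := ih i (n - k - i) (by omega)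
    have h2 := ((hy k).pow (i - (j + 1))).mul h1
    convert h2 using 1
    omega

theorem newtonCoeff_homogeneous {τ : Type} {y : ℕ → MvPolynomial τ K}
    (hy : ∀ i, (y i).IsHomogeneous 1) {n k m : ℕ} (hm : k + m = n) :
    (newtonCoeff y n k).IsHomogeneous m := by
  rw [newtonCoeff, Polynomial.eval_eq_sum_range]
  refine IsHomogeneous.sum _ _ _ fun i hi => ?_
  rw [Finset.mem_range, newtonPoly_natDegree] at hi
  have h1 := newtonPoly_coeff_homogeneous hy n k i (m - i) (by omega)
  have h2 := h1.mul ((hy k).pow i)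
  convert h2 using 1
  omega

/-- The coefficients in Euler's formula for a homogeneous polynomial. -/
def eulerCoeff (m : ℕ) (f : MvPolynomial (Fin r) K) (i : ℕ) : MvPolynomial (Fin r) K :=
  if h : i < r then C ((m + 1 : K)⁻¹) * pderiv ⟨i, h⟩ f else 0

theorem eulerCoeff_homogeneous {m : ℕ} {f : MvPolynomial (Fin r) K} (hf : f.IsHomogeneous (m + 1))
    (i : ℕ) : (eulerCoeff r m f i).IsHomogeneous m := by
  unfold eulerCoeff
  split_ifs with h
  · simpa using (isHomogeneous_C _ ((m + 1 : K)⁻¹)).mul (hf.pderiv (i := ⟨i, h⟩))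
  · exact isHomogeneous_zero _ _ _

/-- Characteristic zero allows division by the degree in Euler's formula. The result is homogeneous
coefficients of degree one less, as required for adjoining a divided power variable. -/
theorem eq_sum_eulerCoeff [CharZero K] {m : ℕ} {f : MvPolynomial (Fin r) K}
    (hf : f.IsHomogeneous (m + 1)) :
    f = ∑ i ∈ Finset.range r, eulerCoeff r m f i * varSeq K r i := by
  have h0 : (m + 1 : K) ≠ 0 := by exact_mod_cast Nat.succ_ne_zero m
  have h1 : f = C ((m + 1 : K)⁻¹) * ∑ i, X i * pderiv i f := by
    rw [hf.sum_X_mul_pderiv, nsmul_eq_mul, ← mul_assoc]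
    have : C ((m + 1 : K)⁻¹) * ((m + 1 : ℕ) : MvPolynomial (Fin r) K) = 1 := by
      rw [← map_natCast (C : K →+* _), ← map_mul]
      push_cast
      rw [inv_mul_cancel₀ h0, map_one]
    rw [this, one_mul]
  conv_lhs => rw [h1]
  rw [Finset.sum_range, Finset.mul_sum]
  refine Finset.sum_congr rfl fun i _ => ?_
  rw [varSeq_of_lt r i.2, eulerCoeff, dif_pos i.2]
  ring

theorem mem_initIdeal_of_homogeneous [CharZero K] {m : ℕ} {f : MvPolynomial (Fin r) K}
    (hf : f.IsHomogeneous (m + 1)) : f ∈ initIdeal (varSeq K r) r := by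
  rw [eq_sum_eulerCoeff r hf]
  exact Ideal.sum_mem _ fun i hi => Ideal.mul_mem_left _ _ (mem_initIdeal _ (Finset.mem_range.1 hi))

end Regular

/-! ### Generating series of bigraded bases -/

section Series

open LaurentPolynomial

/-- The generating series of a bigraded set. -/
def bigradedSeries {ι : Type*} (hd wt : ι → ℕ) (h : ∀ i, {s | hd s = i}.Finite) :
    PowerSeries ℤ[T;T⁻¹] :=
  PowerSeries.mk fun i => ∑ s ∈ (h i).toFinset, LaurentPolynomial.T (2 * (wt s : ℤ))

variable {ι : Type*} (hd wt : ι → ℕ) (h : ∀ i, {s | hd s = i}.Finite)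

theorem coeff_bigradedSeries (i : ℕ) : PowerSeries.coeff i (bigradedSeries hd wt h) =
    ∑ s ∈ (h i).toFinset, LaurentPolynomial.T (2 * (wt s : ℤ)) := PowerSeries.coeff_mk _ _

theorem bigradedSeries_sum (h') : bigradedSeries (Sum.elim hd fun s => hd s + 1)
    (Sum.elim wt fun s => wt s + 1) h' =
      (1 + PowerSeries.C (LaurentPolynomial.T 2) * PowerSeries.X) * bigradedSeries hd wt h := by
  classical
  ext1 i
  have e : ∀ i, (h' (i + 1)).toFinset = (h (i + 1)).toFinset.disjSum (h i).toFinset := by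
    intro i
    ext s
    rcases s with s | s <;> simp
  have e0 : (h' 0).toFinset = (h 0).toFinset.disjSum ∅ := by
    ext s
    rcases s with s | s <;> simp
  rw [add_mul, one_mul, mul_assoc, map_add, PowerSeries.coeff_C_mul]
  rcases i with _ | i
  · rw [PowerSeries.coeff_zero_X_mul, mul_zero, add_zero, coeff_bigradedSeries,
      coeff_bigradedSeries, e0, Finset.sum_disjSum, Finset.sum_empty, add_zero]
    rfl
  · rw [PowerSeries.coeff_succ_X_mul, coeff_bigradedSeries, coeff_bigradedSeries,
      coeff_bigradedSeries, e, Finset.sum_disjSum, Finset.mul_sum]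
    congr 1
    refine Finset.sum_congr rfl fun s _ => ?_
    rw [← LaurentPolynomial.T_add, Sum.elim_inr]
    congr 1
    push_cast
    ring

/-- A pair either has exponent zero or arises from a unique pair by raising the exponent by one,
which shifts the bidegree by that of the new variable. This is the geometric series, cleared of its
denominator. -/
theorem bigradedSeries_sigma (m : ℕ) (h') :
    bigradedSeries (fun s : Σ _ : ℕ, ι => hd s.2 + 2 * s.1) (fun s => wt s.2 + m * s.1) h' *
      (1 - PowerSeries.C (LaurentPolynomial.T (2 * (m : ℤ))) * PowerSeries.X ^ 2) =
        bigradedSeries hd wt h := by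
  classical
  have hinj0 : Function.Injective fun s : ι => (⟨0, s⟩ : Σ _ : ℕ, ι) := fun s t h => by
    simpa using h
  have hinj1 : Function.Injective fun s : (Σ _ : ℕ, ι) => (⟨s.1 + 1, s.2⟩ : Σ _ : ℕ, ι) := by
    rintro ⟨i, s⟩ ⟨j, t⟩ h
    simpa using h
  have e : ∀ i, (h' (i + 2)).toFinset =
      (h (i + 2)).toFinset.map ⟨_, hinj0⟩ ∪ (h' i).toFinset.map ⟨_, hinj1⟩ := by
    intro i
    ext ⟨j, s⟩
    rcases j with _ | j
    · simp
    · simp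
      omega
  -- The new variable has homological degree two, so degrees zero and one contain only exponent
  -- zero.
  have e0 : ∀ i < 2, (h' i).toFinset = (h i).toFinset.map ⟨_, hinj0⟩ := by
    intro i hi
    ext ⟨j, s⟩
    rcases j with _ | j
    · simp
    · simp
      omega
  rw [mul_sub, mul_one, sub_eq_iff_eq_add, ← mul_assoc, mul_comm (bigradedSeries _ _ h')]
  ext1 i
  rw [mul_assoc, map_add, PowerSeries.coeff_C_mul]
  have c0 : ∀ i, ∑ s ∈ (h i).toFinset.map ⟨_, hinj0⟩,
      LaurentPolynomial.T (R := ℤ) (2 * ((wt s.2 + m * s.1 : ℕ) : ℤ)) =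
        PowerSeries.coeff i (bigradedSeries hd wt h) := by
    intro i
    rw [Finset.sum_map, coeff_bigradedSeries]
    exact Finset.sum_congr rfl fun s _ => by simp
  by_cases hi : i < 2
  · rw [PowerSeries.coeff_mul_X_pow', if_neg (by omega), mul_zero, add_zero, ← c0,
      coeff_bigradedSeries, e0 i hi]
  · obtain ⟨i, rfl⟩ : ∃ j, i = j + 2 := ⟨i - 2, by omega⟩
    rw [PowerSeries.coeff_mul_X_pow, ← c0, coeff_bigradedSeries, e, coeff_bigradedSeries,
      Finset.sum_union]
    · congr 1
      rw [Finset.sum_map, Finset.mul_sum]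
      refine Finset.sum_congr rfl fun s _ => ?_
      rw [← LaurentPolynomial.T_add]
      refine congrArg _ ?_
      simp only [Function.Embedding.coeFn_mk]
      push_cast
      ring
    · rw [Finset.disjoint_left]
      rintro _ h1 h2
      obtain ⟨s, -, rfl⟩ := Finset.mem_map.1 h1
      obtain ⟨t, -, ht⟩ := Finset.mem_map.1 h2
      simp at ht

theorem bigradedSeries_unit (h') : bigradedSeries (fun _ : Unit => 0) (fun _ => 0) h' = 1 := by
  ext1 i
  rw [coeff_bigradedSeries, PowerSeries.coeff_one]
  split_ifs with h
  · subst h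
    simp
  · refine Finset.sum_eq_zero fun s hs => absurd ?_ h
    exact ((h' i).mem_toFinset.1 hs).symm

end Series

/-! ### Existence of the Koszul–Tate resolution -/

namespace TateData

open LaurentPolynomial in
/-- The generating series of the basis elements. -/
def series {τ K : Type} [Field K] {x : ℕ → MvPolynomial τ K} {k : ℕ} {J : Ideal (MvPolynomial τ K)}
    (C : TateData x k J) : PowerSeries ℤ[T;T⁻¹] := bigradedSeries C.hd C.wt C.finite_hd

variable {τ K : Type} [Field K] {x : ℕ → MvPolynomial τ K} {k : ℕ} {J : Ideal (MvPolynomial τ K)}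

theorem series_base (x : ℕ → MvPolynomial τ K) : (base x).series = 1 := bigradedSeries_unit _

theorem series_koszulStep (C : TateData x k J) (hx) (hxh) : (C.koszulStep hx hxh).series =
    (1 + PowerSeries.C (LaurentPolynomial.T 2) * PowerSeries.X) * C.series :=
  bigradedSeries_sum _ _ _ _

theorem series_tateStep [NeZero (2 : K)] (C : TateData x k J) (b : ℕ → MvPolynomial τ K) {m : ℕ}
    (hm : 1 ≤ m) (hb) (hbx) (f : MvPolynomial τ K) (hf) (hreg) :
    (C.tateStep b hm hb hbx f hf hreg).series *
      (1 - PowerSeries.C (LaurentPolynomial.T (2 * ((m + 1 : ℕ) : ℤ))) * PowerSeries.X ^ 2) =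
        C.series :=
  bigradedSeries_sigma _ _ _ _ _

/-- The Koszul complex on the variables. -/
theorem exists_koszul (K : Type) [Field K] (r : ℕ) : ∀ k ≤ r, ∃ C : TateData (varSeq K r) k ⊥,
    C.series = (1 + PowerSeries.C (LaurentPolynomial.T 2) * PowerSeries.X) ^ k ∧
      (0 < k → ∃ s, C.hd s = 1) := by
  intro k
  induction k with
  | zero => exact fun _ => ⟨base _, by rw [series_base, pow_zero], by simp⟩
  | succ k ih =>
    intro hk
    obtain ⟨C, hC, -⟩ := ih (by omega)
    refine ⟨C.koszulStep (mem_of_varSeq_mul_mem r (by omega)) (varSeq_homogeneous r k), ?_,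
      fun _ => ⟨(Sum.inr C.o : C.ι ⊕ C.ι), ?_⟩⟩
    · rw [series_koszulStep, hC, pow_succ']
    · simp [koszulStep, C.hd_o]

/-- The Koszul–Tate resolution. -/
theorem exists_tate (K : Type) [Field K] [CharZero K] (r : ℕ) : ∀ k ≤ r,
    ∃ C : TateData (varSeq K r) r (initIdeal (newtonCoeff (varSeq K r) (r + 1)) k),
      C.series * ∏ j ∈ Finset.range k,
        (1 - PowerSeries.C (LaurentPolynomial.T (2 * ((r + 1 - j : ℕ) : ℤ))) * PowerSeries.X ^ 2) =
        (1 + PowerSeries.C (LaurentPolynomial.T 2) * PowerSeries.X) ^ r ∧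
      (0 < r → ∃ s, C.hd s = 1) ∧ (0 < k → ∀ i, ∃ s, C.hd s = i) := by
  intro k
  induction k with
  | zero =>
    intro _
    obtain ⟨C, hC, h1⟩ := exists_koszul K r r le_rfl
    have : initIdeal (newtonCoeff (varSeq K r) (r + 1)) 0 = ⊥ := by simp [initIdeal]
    rw [this]
    exact ⟨C, by simpa using hC, h1, by simp⟩
  | succ k ih =>
    intro hk
    obtain ⟨C, hC, h1, -⟩ := ih (by omega)
    rw [initIdeal_succ]
    -- As `k < r`, the next relation has degree at least two. Its Euler coefficients thus have
    -- positive degree, which keeps the differential minimal.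
    obtain ⟨m, hm⟩ : ∃ m, r + 1 - k = m + 2 := ⟨r + 1 - k - 2, by omega⟩
    have hf : (newtonCoeff (varSeq K r) (r + 1) k).IsHomogeneous (m + 1 + 1) :=
      newtonCoeff_homogeneous (varSeq_homogeneous r) (by omega)
    have hb := eulerCoeff_homogeneous r hf
    refine ⟨C.tateStep (eulerCoeff r (m + 1) (newtonCoeff (varSeq K r) (r + 1) k)) (m := m + 1)
      (by omega) (fun i _ => hb i) (fun i _ => mem_initIdeal_of_homogeneous r (hb i)) _
      (eq_sum_eulerCoeff r hf) (mem_of_newtonCoeff_mul_mem r (by omega) (by omega)), ?_, ?_, ?_⟩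
    · rw [Finset.prod_range_succ, mul_comm (Finset.prod _ _), ← mul_assoc, hm, series_tateStep, hC]
    · intro hr
      obtain ⟨s, hs⟩ := h1 hr
      exact ⟨(⟨0, s⟩ : Σ _ : ℕ, C.ι), by simp [tateStep, hs]⟩
    · intro _ i
      obtain ⟨s, hs⟩ := h1 (by omega)
      -- Divided powers of a single variable fill the even degrees, and their products with an
      -- element of degree one fill the odd degrees.
      obtain ⟨j, hj | hj⟩ := Nat.even_or_odd' i
      · exact ⟨(⟨j, C.o⟩ : Σ _ : ℕ, C.ι), by simp [tateStep, C.hd_o, hj]⟩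
      · exact ⟨(⟨j, s⟩ : Σ _ : ℕ, C.ι), by simp [tateStep, hs, hj, add_comm]⟩

end TateData

end

noncomputable section

open MvPolynomial

/-! ### The ring of coinvariants as a complete intersection -/

section CoinvRing

variable {S : Type*} [CommRing S] [Algebra ℂ S] {n : ℕ}

/-- Vieta's formulas: up to sign, these are the lower coefficients of `X ^ n`. -/
theorem aeval_esymm_eq_zero {y : Fin n → S}
    (h : ∏ i, (Polynomial.X - Polynomial.C (y i)) = Polynomial.X ^ n) {j : ℕ} (hj : 1 ≤ j)
    (hjn : j ≤ n) : aeval y (esymm (Fin n) ℂ j) = 0 := by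
  have hc : Multiset.card (Finset.univ.val.map y) = n := by simp
  have h1 := Multiset.prod_X_sub_C_coeff (Finset.univ.val.map y) (k := n - j) (by rw [hc]; omega)
  have h2 : ((Finset.univ.val.map y).map fun t => Polynomial.X - Polynomial.C t).prod =
      Polynomial.X ^ n := by
    rw [Multiset.map_map]
    exact h
  rw [h2, hc, Polynomial.coeff_X_pow, if_neg (by omega), Nat.sub_sub_self hjn] at h1
  rw [aeval_esymm_eq_multiset_esymm]
  have h3 : ((-1 : S) ^ j * (-1) ^ j) = 1 := by rw [← mul_pow]; simp
  calc (Finset.univ.val.map y).esymm j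
      = (-1) ^ j * ((-1) ^ j * (Finset.univ.val.map y).esymm j) := by rw [← mul_assoc, h3, one_mul]
    _ = 0 := by rw [← h1, mul_zero]

theorem aeval_aeval_esymm {y : Fin n → S}
    (h : ∏ i, (Polynomial.X - Polynomial.C (y i)) = Polynomial.X ^ n)
    (q : MvPolynomial (Fin n) ℂ) :
    aeval y (aeval (fun i : Fin n => esymm (Fin n) ℂ (i + 1)) q) =
      algebraMap ℂ S (constantCoeff q) := by
  have hz : (fun i : Fin n => aeval y (esymm (Fin n) ℂ (i + 1))) = fun _ => 0 :=
    funext fun i => aeval_esymm_eq_zero h (by omega) (by omega)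
  rw [← AlgHom.comp_apply, comp_aeval, hz, aeval_zero']

/-- A symmetric polynomial is a polynomial `q` in the elementary ones, all of which vanish at `y`,
so only the constant term of `q` is left. -/
theorem aeval_symmetric_eq_zero {y : Fin n → S}
    (h : ∏ i, (Polynomial.X - Polynomial.C (y i)) = Polynomial.X ^ n)
    {p : MvPolynomial (Fin n) ℂ} (hp : p.IsSymmetric) (h0 : constantCoeff p = 0) :
    aeval y p = 0 := by
  obtain ⟨q, hq⟩ := esymmAlgHom_surjective (σ := Fin n) ℂ (n := n) (by simp) ⟨p, hp⟩
  have hq' : aeval (fun i : Fin n => esymm (Fin n) ℂ (i + 1)) q = p := by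
    have := congrArg Subtype.val hq
    rwa [esymmAlgHom_apply] at this
  -- The zero tuple satisfies the same hypothesis; comparing with it shows that `q` has the constant
  -- term of `p`, namely zero.
  have h1 := aeval_aeval_esymm (S := ℂ) (n := n) (y := fun _ => 0) (by simp) q
  rw [hq', aeval_zero', h0, map_zero, Algebra.algebraMap_self, RingHom.id_apply] at h1
  rw [← hq', aeval_aeval_esymm h, ← h1, map_zero]

/-- The ring of coinvariants represents the factorizations of `X ^ n` into linear factors. -/
def coinvLift (y : Fin n → S) (h : ∏ i, (Polynomial.X - Polynomial.C (y i)) = Polynomial.X ^ n) :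
    Coinv n →ₐ[ℂ] S :=
  Ideal.Quotient.liftₐ _ (aeval y) fun p hp => by
    have : coinvIdeal n ≤ RingHom.ker (aeval y : MvPolynomial (Fin n) ℂ →ₐ[ℂ] S) :=
      Ideal.span_le.2 fun p hp => aeval_symmetric_eq_zero h hp.1 hp.2
    exact this hp

/-- The `i`-th generator of the ring of coinvariants. -/
def coinvX (n : ℕ) (i : Fin n) : Coinv n := Ideal.Quotient.mk _ (X i)

@[simp] theorem coinvLift_X (y : Fin n → S)
    (h : ∏ i, (Polynomial.X - Polynomial.C (y i)) = Polynomial.X ^ n) (i : Fin n) :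
    coinvLift y h (coinvX n i) = y i :=
  aeval_X y i

theorem coinv_mk (p : MvPolynomial (Fin n) ℂ) :
    (Ideal.Quotient.mk (coinvIdeal n) p) = aeval (coinvX n) p := by
  have : Ideal.Quotient.mkₐ ℂ (coinvIdeal n) = aeval (coinvX n) := algHom_ext fun i => by
    rw [aeval_X]; rfl
  exact AlgHom.congr_fun this p

theorem coinv_prod (n : ℕ) :
    ∏ i, (Polynomial.X - Polynomial.C (coinvX n i)) = Polynomial.X ^ n := by
  have hc : Multiset.card (Finset.univ.val.map (coinvX n)) = n := by simp
  have h1 := Multiset.prod_X_sub_X_eq_sum_esymm (Finset.univ.val.map (coinvX n))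
  rw [Multiset.map_map, hc, Finset.sum_range_succ'] at h1
  refine h1.trans ?_
  rw [Finset.sum_eq_zero, zero_add]
  · rw [Multiset.esymm, Multiset.powersetCard_zero_left]
    simp
  · intro j hj
    have : (Finset.univ.val.map (coinvX n)).esymm (j + 1) = 0 := by
      rw [← aeval_esymm_eq_multiset_esymm (σ := Fin n) (R := ℂ), ← coinv_mk, Ideal.Quotient.eq_zero_iff_mem]
      refine Ideal.subset_span ⟨esymm_isSymmetric _ _ _, ?_⟩
      have h0 := aeval_esymm_eq_zero (S := ℂ) (n := n) (y := fun _ => 0) (j := j + 1) (by simp)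
        (by omega) (by rw [Finset.mem_range] at hj; omega)
      rwa [aeval_zero'] at h0
    rw [this]
    simp

instance (n : ℕ) : Nontrivial (Coinv n) := (coinvAug n).toRingHom.domain_nontrivial

theorem coinvAug_mk (p : MvPolynomial (Fin n) ℂ) :
    coinvAug n (Ideal.Quotient.mk _ p) = constantCoeff p := aeval_zero' p

theorem coinvX_pow (n : ℕ) (i : Fin n) : coinvX n i ^ n = 0 := by
  have := congrArg (Polynomial.eval (coinvX n i)) (coinv_prod n)
  rw [Polynomial.eval_prod, Polynomial.eval_pow, Polynomial.eval_X] at this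
  rw [← this]
  exact Finset.prod_eq_zero (Finset.mem_univ i) (by simp)

theorem mem_span_X_of_constantCoeff {σ K : Type*} [Field K] {p : MvPolynomial σ K}
    (h : constantCoeff p = 0) : p ∈ Ideal.span (Set.range (X : σ → MvPolynomial σ K)) := by
  rw [← Set.image_univ, mem_ideal_span_X_image]
  intro m hm
  by_contra! h'
  have : m = 0 := Finsupp.ext fun i => h' i trivial
  rw [this, mem_support_iff] at hm
  exact hm h

/-- The augmentation ideal is generated by the variables, which are nilpotent as roots of `X ^ n`.
Nilpotency plays the role of Nakayama's lemma in comparing resolutions. -/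
theorem coinvAug_ker_isNilpotent (n : ℕ) : IsNilpotent (RingHom.ker (coinvAug n)) := by
  rw [Ideal.FG.isNilpotent_iff_le_nilradical (IsNoetherian.noetherian _)]
  intro a ha
  obtain ⟨p, rfl⟩ := Ideal.Quotient.mk_surjective a
  have h1 := mem_span_X_of_constantCoeff ((coinvAug_mk p).symm.trans ha)
  have h2 : Ideal.span (Set.range X) ≤ (nilradical (Coinv n)).comap (Ideal.Quotient.mk _) :=
    Ideal.span_le.2 (by
      rintro _ ⟨i, rfl⟩
      exact ⟨n, coinvX_pow n i⟩)
  exact h2 h1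

/-- The presentation of the ring of coinvariants that eliminates the last variable. -/
def coinvPres (r : ℕ) : MvPolynomial (Fin r) ℂ →ₐ[ℂ] Coinv (r + 1) :=
  aeval fun i => coinvX (r + 1) i.castSucc

theorem coinvPres_surjective (r : ℕ) : Function.Surjective (coinvPres r) := by
  have hl : ∀ i : Fin (r + 1), coinvX (r + 1) i ∈ (coinvPres r).range := by
    intro i
    induction i using Fin.lastCases with
    | cast i => exact ⟨X i, by simp [coinvPres]⟩
    | last =>
      -- The first elementary symmetric polynomial vanishes, so the last variable is minus the sum
      -- of the others.
      have h := aeval_esymm_eq_zero (coinv_prod (r + 1)) le_rfl (by omega)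
      rw [esymm_one, map_sum, Fin.sum_univ_castSucc] at h
      simp only [aeval_X] at h
      rw [← neg_eq_of_add_eq_zero_right h]
      exact neg_mem (sum_mem fun i _ => ⟨X i, by simp [coinvPres]⟩)
  intro a
  obtain ⟨p, rfl⟩ := Ideal.Quotient.mk_surjective a
  rw [coinv_mk]
  have : aeval (coinvX (r + 1)) p ∈ (coinvPres r).range := by
    induction p using MvPolynomial.induction_on with
    | C a => rw [aeval_C]; exact Subalgebra.algebraMap_mem _ a
    | add p q hp hq => rw [map_add]; exact add_mem hp hq
    | mul_X p i hp => rw [map_mul, aeval_X]; exact mul_mem hp (hl i)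
  exact this

/-- Modulo the Newton coefficients, `X ^ (r + 1)` factors into the `r` factors `X - x_i` and a monic
linear quotient. The universal property of the coinvariants then gives a map back that recovers the
quotient map. Conversely, in the coinvariants `X ^ (r + 1)` splits, so the Newton coefficients
vanish. -/
theorem coinvPres_ker (r : ℕ) :
    RingHom.ker (coinvPres r) = initIdeal (newtonCoeff (varSeq ℂ r) (r + 1)) r := by
  refine le_antisymm (fun p hp => ?_) (Ideal.span_le.2 ?_)
  · set J := initIdeal (newtonCoeff (varSeq ℂ r) (r + 1)) r with hJ
    by_cases hn : Nontrivial (MvPolynomial (Fin r) ℂ ⧸ J)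
    swap
    · rw [not_nontrivial_iff_subsingleton] at hn
      rw [← Ideal.Quotient.eq_zero_iff_mem]
      exact Subsingleton.elim _ _
    set y : ℕ → MvPolynomial (Fin r) ℂ ⧸ J := fun i => Ideal.Quotient.mk J (varSeq ℂ r i) with hy
    have h1 := X_pow_eq_newton y (r + 1) r
    have h2 : ∀ j ∈ Finset.range r, newtonCoeff y (r + 1) j = 0 := by
      intro j hj
      rw [hy, ← newtonCoeff_map, Ideal.Quotient.eq_zero_iff_mem]
      exact mem_initIdeal _ (Finset.mem_range.1 hj)
    rw [Finset.sum_eq_zero fun j hj => by rw [h2 j hj, map_zero, zero_mul], zero_add] at h1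
    have h3 : newtonPoly y (r + 1) r = Polynomial.X - Polynomial.C (-(newtonPoly y (r + 1) r).coeff 0) := by
      have hd := newtonPoly_natDegree y (r + 1) r
      have hm := newtonPoly_monic y (r + 1) (k := r) (by omega)
      rw [show r + 1 - r = 1 by omega] at hd
      have := Polynomial.eq_X_add_C_of_natDegree_le_one hd.le
      rw [Polynomial.Monic, Polynomial.leadingCoeff, hd] at hm
      rw [hm, map_one, one_mul] at this
      rw [map_neg, sub_neg_eq_add]
      exact this
    -- The missing root is read off from the last, linear quotient.
    set z : Fin (r + 1) → MvPolynomial (Fin r) ℂ ⧸ J :=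
      Fin.snoc (fun i : Fin r => y i) (-(newtonPoly y (r + 1) r).coeff 0) with hz
    have h4 : ∏ i, (Polynomial.X - Polynomial.C (z i)) = Polynomial.X ^ (r + 1) := by
      rw [h1, Fin.prod_univ_castSucc, h3, Finset.prod_range]
      simp [hz]
    have h5 : (coinvLift z h4).comp (coinvPres r) = Ideal.Quotient.mkₐ ℂ J := by
      refine algHom_ext fun i => ?_
      simp [coinvPres, hz, hy, varSeq_of_lt r i.2]
    rw [← Ideal.Quotient.eq_zero_iff_mem]
    have h6 := AlgHom.congr_fun h5 p
    rw [AlgHom.comp_apply, show coinvPres r p = 0 from hp, map_zero] at h6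
    exact h6.symm
  · rintro _ ⟨k, hk, rfl⟩
    set y : ℕ → Coinv (r + 1) := fun i => if h : i < r + 1 then coinvX (r + 1) ⟨i, h⟩ else 0 with hy
    have h1 : (Polynomial.X ^ (r + 1) : Polynomial (Coinv (r + 1))) =
        ∏ i ∈ Finset.range (r + 1), (Polynomial.X - Polynomial.C (y i)) := by
      rw [Finset.prod_range, ← coinv_prod]
      refine Finset.prod_congr rfl fun i _ => ?_
      simp only [hy, dif_pos i.2]
    have h2 := newtonCoeff_map (varSeq ℂ r) (r + 1) (coinvPres r).toRingHom k
    refine h2.trans ?_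
    rw [← newtonCoeff_eq_zero h1 (Nat.lt_succ_of_lt hk)]
    refine newtonCoeff_congr _ fun i hi => ?_
    have hir : i < r := lt_of_le_of_lt hi hk
    rw [varSeq_of_lt r hir]
    have hir' : i < r + 1 := by omega
    simp only [hy, dif_pos hir']
    simp [coinvPres]

end CoinvRing

end

noncomputable section

/-! ### Projective resolutions from exact sequences -/

section Builder

variable {C : Type*} [Category* C] [Abelian C] {Z : C} (X : ℕ → C) (d : ∀ n, X (n + 1) ⟶ X n)
  (sq : ∀ n, d (n + 1) ≫ d n = 0) (π : X 0 ⟶ Z) (w : d 0 ≫ π = 0)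

theorem ChainComplex.of_d_succ {V : Type*} [Category* V] [HasZeroMorphisms V] (X : ℕ → V)
    (d : ∀ n, X (n + 1) ⟶ X n) (sq : ∀ n, d (n + 1) ≫ d n = 0) (n : ℕ) :
    (ChainComplex.of X d sq).d (n + 1) n = d n :=
  ChainComplex.of_d X d n

/-- A projective resolution from an exact sequence of projective objects. -/
def ProjectiveResolution.ofExact [∀ n, Projective (X n)] [Epi π]
    (ex0 : (ShortComplex.mk (d 0) π w).Exact)
    (ex : ∀ n, (ShortComplex.mk (d (n + 1)) (d n) (sq n)).Exact) : ProjectiveResolution Z where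
  complex := ChainComplex.of X d sq
  projective n := inferInstanceAs (Projective (X n))
  π := (ChainComplex.toSingle₀Equiv _ _).symm ⟨π, by rw [ChainComplex.of_d_succ]; exact w⟩
  quasiIso := ⟨fun n => by
    cases n
    · rw [ChainComplex.quasiIsoAt₀_iff, ShortComplex.quasiIso_iff_of_zeros']
      · refine (ShortComplex.exact_and_epi_g_iff_of_iso ?_).2 ⟨ex0, inferInstanceAs (Epi π)⟩
        refine ShortComplex.isoMk (Iso.refl _) (Iso.refl _) (Iso.refl _) ?_ ?_
        · refine (Category.id_comp _).trans ((ChainComplex.of_d_succ X d sq 0).symm.trans ?_)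
          exact (Category.comp_id _).symm
        · refine (Category.id_comp _).trans (Eq.trans ?_ (Category.comp_id _).symm)
          exact (ChainComplex.toSingle₀Equiv_symm_apply_f_zero (C := ChainComplex.of X d sq) π _).symm
      all_goals rfl
    · rename_i n
      rw [quasiIsoAt_iff_exactAt']
      · rw [HomologicalComplex.exactAt_iff' _ (n + 1 + 1) (n + 1) n (by simp) (by simp)]
        refine (ShortComplex.exact_iff_of_iso ?_).2 (ex n)
        exact ShortComplex.isoMk (Iso.refl _) (Iso.refl _) (Iso.refl _)
          ((Category.id_comp _).trans ((ChainComplex.of_d_succ X d sq (n + 1)).symm.trans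
            (Category.comp_id _).symm))
          ((Category.id_comp _).trans ((ChainComplex.of_d_succ X d sq n).symm.trans
            (Category.comp_id _).symm))
      · apply ChainComplex.exactAt_succ_single_obj⟩

theorem ProjectiveResolution.ofExact_d [∀ n, Projective (X n)] [Epi π]
    (ex0 : (ShortComplex.mk (d 0) π w).Exact)
    (ex : ∀ n, (ShortComplex.mk (d (n + 1)) (d n) (sq n)).Exact) (n : ℕ) :
    (ProjectiveResolution.ofExact X d sq π w ex0 ex).complex.d (n + 1) n = d n :=
  ChainComplex.of_d_succ X d sq n

end Builder

/-! ### Resolutions given by matrices, graded and ungraded -/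

namespace GrMod

variable {k A : Type} [CommRing k] [CommRing A] [Algebra k A] {𝒜 : ℤ → Submodule k A}

/-- Exactness up to refinements suffices: a map killed by `g` factors through the concrete kernel,
onto which `L` surjects, and so lifts to `L` after passing to a projective cover of its source. -/
theorem exact_of_elements [GradedAlgebra 𝒜] {L M N : GrMod 𝒜} (f : L ⟶ M) (g : M ⟶ N)
    (w : f ≫ g = 0)
    (h : ∀ x, lin g x = 0 → ∃ y, lin f y = x) : (ShortComplex.mk f g w).Exact := by
  rw [ShortComplex.exact_iff_exact_up_to_refinements]
  intro B x₂ hx₂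
  have hf : ∀ y, lin g (lin f y) = 0 := fun y => LinearMap.congr_fun (congrArg lin w) y
  let p : L ⟶ ker g := ofLin ((lin f).codRestrict _ hf) fun _ _ hx => lin_mem f hx
  have : Epi p := epi_of_surjective p fun ⟨x, hx⟩ => by
    obtain ⟨y, hy⟩ := h x hx
    exact ⟨y, Subtype.ext hy⟩
  have hx : ∀ y, lin g (lin x₂ y) = 0 := fun y => LinearMap.congr_fun (congrArg lin hx₂) y
  let q : B ⟶ ker g := ofLin ((lin x₂).codRestrict _ hx) fun _ _ hx => lin_mem x₂ hx
  refine ⟨Projective.over B, Projective.π B, inferInstance,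
    Projective.factorThru (Projective.π B ≫ q) p, ?_⟩
  have h1 : q ≫ kerι g = x₂ := rfl
  have h2 : p ≫ kerι g = f := rfl
  dsimp only
  rw [← h1, ← h2, ← Category.assoc, ← Category.assoc, Projective.factorThru_comp]

variable [GradedAlgebra 𝒜]

/-- The morphism of graded free modules given by a matrix. -/
def matHom {κ κ' : Type} [Fintype κ'] (r : κ → ℤ) (r' : κ' → ℤ) (D : Matrix κ κ' A)
    (hD : ∀ s t, D s t ∈ 𝒜 (r s - r' t)) : free 𝒜 r ⟶ free 𝒜 r' :=
  dsumDesc _ fun s => ofElem (free 𝒜 r') (r s)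
    ((DFinsupp.equivFunOnFintype (ι := κ') (β := fun _ => A)).symm (D s)) fun t => hD s t

theorem lin_dsumDesc_apply {κ : Type} [Fintype κ] (r : κ → ℤ) (M : GrMod 𝒜)
    (f : ∀ s, shift (r s) (reg 𝒜) ⟶ M) (x : (free 𝒜 r).carrier) :
    lin (dsumDesc _ f) x = ∑ s, x s • lin (f s) (1 : A) := by
  classical
  have h : ∀ s, lin (f s) (x s) = x s • lin (f s) (1 : A) := fun s => by
    rw [← map_smul]
    exact congrArg (lin (f s)) (mul_one (x s)).symm
  simp only [← h]
  refine (DFinsupp.lsum_apply_apply ℕ (fun s => lin (f s)) x).trans ?_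
  rw [DFinsupp.sumAddHom_apply]
  exact DFinsupp.sum_eq_sum_fintype _ fun s => map_zero _

theorem matHom_apply {κ κ' : Type} [Fintype κ] [Fintype κ'] (r : κ → ℤ) (r' : κ' → ℤ)
    (D : Matrix κ κ' A) (hD : ∀ s t, D s t ∈ 𝒜 (r s - r' t)) (x : (free 𝒜 r).carrier) (t : κ') :
    lin (matHom r r' D hD) x t = Matrix.vecMul (fun s => x s) D t := by
  rw [matHom, lin_dsumDesc_apply, DFinsupp.finsetSum_apply]
  refine Finset.sum_congr rfl fun s _ => ?_
  exact congrArg (fun z : Π₀ _ : κ', A => x s * z t) (ofElem_one (free 𝒜 r') (r s) _ fun t => hD s t)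

end GrMod

open GrMod

/-- A minimal resolution of the trivial module by free modules of finite rank, given by matrices. -/
structure MatrixResolution {k A : Type} [CommRing k] [CommRing A] [Algebra k A]
    (𝒜 : ℤ → Submodule k A) (ε : A →ₐ[k] k) where
  κ : ℕ → Type
  [fintype : ∀ i, Fintype (κ i)]
  /-- The degrees of the generators. -/
  r : ∀ i, κ i → ℤ
  o : κ 0
  D : ∀ i, Matrix (κ (i + 1)) (κ i) A
  r_o : r 0 o = 0
  mem : ∀ i s t, D i s t ∈ 𝒜 (r (i + 1) s - r i t)
  aug : ∀ i s t, ε (D i s t) = 0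
  mul : ∀ i, D (i + 1) * D i = 0
  exact_succ : ∀ i x, Matrix.vecMul x (D i) = 0 → ∃ y, Matrix.vecMul y (D (i + 1)) = x
  exact_zero : ∀ x : κ 0 → A, ε (x o) = 0 → ∃ y, Matrix.vecMul y (D 0) = x

namespace MatrixResolution

attribute [instance] MatrixResolution.fintype

variable {k A : Type} [CommRing k] [CommRing A] [Algebra k A] {𝒜 : ℤ → Submodule k A}
  {ε : A →ₐ[k] k} (R : MatrixResolution 𝒜 ε)

theorem aug_vecMul (i : ℕ) (y : R.κ (i + 1) → A) (t : R.κ i) :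
    ε (Matrix.vecMul y (R.D i) t) = 0 := by
  change ε (∑ s, y s * R.D i s t) = 0
  simp [R.aug]

section Gr

variable [GradedAlgebra 𝒜] (hε : ∀ i ≠ 0, ∀ a ∈ 𝒜 i, ε a = 0)

open Classical in
/-- The augmentation of the graded resolution. -/
def grAug : free 𝒜 (R.r 0) ⟶ triv 𝒜 ε hε :=
  dsumDesc _ fun s => if h : s = R.o then ofElem (triv 𝒜 ε hε) _ (show Triv ε from (1 : k)) (by
    rw [h, R.r_o]
    change _ ∈ (if (0 : ℤ) = 0 then (⊤ : Submodule k (Triv ε)) else ⊥)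
    rw [if_pos rfl]
    trivial) else 0

theorem grAug_apply (x : (free 𝒜 (R.r 0)).carrier) :
    lin (R.grAug hε) x = (show Triv ε from ε (x R.o)) := by
  classical
  rw [grAug, lin_dsumDesc_apply, Finset.sum_eq_single R.o]
  · rw [dif_pos rfl, ofElem_one]
    exact mul_one (ε (x R.o))
  · intro s _ hs
    rw [dif_neg hs]
    exact smul_zero _
  · exact fun h => absurd (Finset.mem_univ _) h

theorem epi_grAug : Epi (R.grAug hε) := epi_of_surjective _ fun c => by
  classical
  refine ⟨(DFinsupp.single R.o (algebraMap k A c) : Π₀ _ : R.κ 0, A), ?_⟩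
  rw [grAug_apply, DFinsupp.single_eq_same]
  exact ε.commutes c

/-- The graded projective resolution given by a sequence of matrices. -/
def toGr : ProjectiveResolution (triv 𝒜 ε hε) :=
  have := R.epi_grAug hε
  ProjectiveResolution.ofExact (fun i => free 𝒜 (R.r i))
    (fun i => matHom (R.r (i + 1)) (R.r i) (R.D i) (R.mem i))
    (fun i => GrMod.hom_ext fun x => DFinsupp.ext fun t => by
      rw [lin_comp_apply, matHom_apply]
      have : (fun s => lin (matHom _ _ (R.D (i + 1)) (R.mem (i + 1))) x s) =
          Matrix.vecMul (fun s => x s) (R.D (i + 1)) := funext fun s => matHom_apply _ _ _ _ x s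
      rw [this, Matrix.vecMul_vecMul, R.mul, Matrix.vecMul_zero]
      rfl)
    (R.grAug hε)
    (GrMod.hom_ext fun x => by
      rw [lin_comp_apply, grAug_apply, matHom_apply, R.aug_vecMul]
      rfl)
    (exact_of_elements _ _ _ fun x hx => by
      rw [grAug_apply] at hx
      obtain ⟨y, hy⟩ := R.exact_zero (fun s => x s) hx
      exact ⟨(DFinsupp.equivFunOnFintype (ι := R.κ 1) (β := fun _ => A)).symm y,
        DFinsupp.ext fun t => (matHom_apply _ _ _ _ _ t).trans (congrFun hy t)⟩)
    (fun i => exact_of_elements _ _ _ fun x hx => by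
      obtain ⟨y, hy⟩ := R.exact_succ i (fun s => x s) (funext fun t => by
        rw [← matHom_apply (𝒜 := 𝒜) (R.r (i + 1)) (R.r i) (R.D i) (R.mem i), hx]
        rfl)
      exact ⟨(DFinsupp.equivFunOnFintype (ι := R.κ (i + 2)) (β := fun _ => A)).symm y,
        DFinsupp.ext fun t => (matHom_apply _ _ _ _ _ t).trans (congrFun hy t)⟩)

theorem mem_smul_top_dfinsupp {κ : Type} [Fintype κ] (I : Ideal A) (x : Π₀ _ : κ, A)
    (h : ∀ s, x s ∈ I) : x ∈ I • (⊤ : Submodule A (Π₀ _ : κ, A)) := by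
  classical
  have : x = ∑ s, x s • (DFinsupp.single s (1 : A) : Π₀ _ : κ, A) := DFinsupp.ext fun t => by
    rw [DFinsupp.finsetSum_apply, Finset.sum_eq_single t]
    · simp
    · intro s _ hs
      simp [DFinsupp.single_apply, hs]
    · simp
  rw [this]
  exact Submodule.sum_mem _ fun s _ => Submodule.smul_mem_smul (h s) trivial

theorem toGr_minimal : IsMinimalResolution ε (R.toGr hε) := by
  intro i x
  refine mem_smul_top_dfinsupp _ _ fun t => ?_
  have : (R.toGr hε).complex.d (i + 1) i = matHom (R.r (i + 1)) (R.r i) (R.D i) (R.mem i)  := by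
    unfold toGr
    rw [ProjectiveResolution.ofExact_d]
  rw [this]
  exact (congrArg ε (matHom_apply _ _ _ (R.mem i) x t)).trans (R.aug_vecMul i _ t)

end Gr

/-- The augmentation of the ungraded resolution. -/
def modAug : (R.κ 0 → A) →ₗ[A] Triv ε where
  toFun x := (show Triv ε from ε (x R.o))
  map_add' _ _ := map_add ε _ _
  map_smul' _ _ := map_mul ε _ _

theorem epi_modAug : Epi (ModuleCat.ofHom R.modAug) := by
  classical
  rw [ModuleCat.epi_iff_surjective]
  intro c
  refine ⟨(Pi.single R.o (algebraMap k A c) : R.κ 0 → A), ?_⟩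
  change ε ((Pi.single R.o (algebraMap k A c) : R.κ 0 → A) R.o) = c
  rw [Pi.single_eq_same]
  exact ε.commutes c

/-- The ungraded projective resolution given by a sequence of matrices. -/
def toMod : ProjectiveResolution (ModuleCat.of A (Triv ε)) :=
  have := R.epi_modAug
  ProjectiveResolution.ofExact (fun i => ModuleCat.of A (R.κ i → A))
    (fun i => ModuleCat.ofHom (Matrix.vecMulLinear (R.D i)))
    (fun i => by
      ext x t
      change Matrix.vecMul (Matrix.vecMul x (R.D (i + 1))) (R.D i) t = 0
      rw [Matrix.vecMul_vecMul, R.mul, Matrix.vecMul_zero]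
      rfl)
    (ModuleCat.ofHom R.modAug)
    (by
      ext x
      exact R.aug_vecMul 0 x R.o)
    (by
      rw [ShortComplex.moduleCat_exact_iff]
      exact fun x hx => R.exact_zero x hx)
    (fun i => by
      rw [ShortComplex.moduleCat_exact_iff]
      exact fun x hx => R.exact_succ i x hx)

theorem toMod_minimal (i : ℕ) (x : (R.toMod).complex.X (i + 1)) :
    (R.toMod.complex.d (i + 1) i).hom x ∈
      RingHom.ker ε • (⊤ : Submodule A (R.toMod.complex.X i)) := by
  have : R.toMod.complex.d (i + 1) i = ModuleCat.ofHom (Matrix.vecMulLinear (R.D i))  := by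
    unfold toMod
    rw [ProjectiveResolution.ofExact_d]
  rw [this]
  have h : ∀ x : R.κ i → A, (∀ s, x s ∈ RingHom.ker ε) →
      x ∈ RingHom.ker ε • (⊤ : Submodule A (R.κ i → A)) := fun x hx => by
    classical
    have : x = ∑ s, x s • (Pi.single s (1 : A) : R.κ i → A) := by
      conv_lhs => rw [← Finset.univ_sum_single x]
      exact Finset.sum_congr rfl fun s _ => by rw [← Pi.single_smul, smul_eq_mul, mul_one]
    rw [this]
    exact Submodule.sum_mem _ fun s _ => Submodule.smul_mem_smul (hx s) trivial
  exact h _ fun t => R.aug_vecMul i x t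

end MatrixResolution

/-! ### Comparison with minimal resolutions -/

section Uniqueness

/-- The difference with the identity sends `I ^ n M` into `I ^ (n + 1) M`, hence is nilpotent, and
one plus a nilpotent is a unit. No finiteness of `M` is needed. -/
theorem bijective_of_sub_mem {A M : Type*} [CommRing A] [AddCommGroup M] [Module A M]
    {I : Ideal A} (hI : IsNilpotent I) (φ : M →ₗ[A] M)
    (h : ∀ x, φ x - x ∈ I • (⊤ : Submodule A M)) : Function.Bijective φ := by
  obtain ⟨N, hN⟩ := hI
  have h1 : ∀ n x, ((φ - 1) ^ n) x ∈ I ^ n • (⊤ : Submodule A M) := by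
    intro n
    induction n with
    | zero => simp
    | succ n ih =>
      intro x
      rw [pow_succ' (φ - 1), Module.End.mul_apply]
      have h2 : (I ^ n • (⊤ : Submodule A M)).map (φ - 1) ≤ I ^ (n + 1) • ⊤ := by
        rw [Submodule.map_smul'', pow_succ, mul_smul]
        refine Submodule.smul_mono le_rfl ?_
        rintro _ ⟨y, -, rfl⟩
        exact h y
      exact h2 ⟨_, ih x, rfl⟩
  have h2 : IsNilpotent (φ - 1) := ⟨N, LinearMap.ext fun x => by
    have := h1 N x
    rw [hN] at this
    simpa using this⟩
  have h3 := h2.isUnit_add_one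
  rw [sub_add_cancel] at h3
  exact (Module.End.isUnit_iff φ).1 h3

namespace GrMod

variable {k A : Type} [CommRing k] [CommRing A] [Algebra k A] {𝒜 : ℤ → Submodule k A}
  {ε : A →ₐ[k] k} {X : GrMod 𝒜}

/-- Homotopic maps differ by `d h + h d`. The image of `d` lies in the augmentation ideal times the
module, and linear maps preserve such submodules. -/
theorem homotopy_sub_mem {P : ProjectiveResolution X} (hP : IsMinimalResolution ε P)
    {f g : P.complex ⟶ P.complex} (h : Homotopy f g) (i : ℕ) (x : (P.complex.X i).carrier) :
    lin (f.f i) x - lin (g.f i) x ∈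
      RingHom.ker ε • (⊤ : Submodule A (P.complex.X i).carrier) := by
  have h1 : lin (prevD i h.hom) x ∈ RingHom.ker ε • (⊤ : Submodule A (P.complex.X i).carrier) := by
    rw [Homotopy.prevD_chainComplex]
    exact hP i _
  have h2 : lin (dNext i h.hom) x ∈ RingHom.ker ε • (⊤ : Submodule A (P.complex.X i).carrier) := by
    rcases i with _ | i
    · rw [Homotopy.dNext_zero_chainComplex]
      exact zero_mem _
    · rw [Homotopy.dNext_succ_chainComplex]
      have := Submodule.mem_map_of_mem (f := lin (h.hom i (i + 1))) (hP i x)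
      rw [Submodule.map_smul''] at this
      exact Submodule.smul_mono le_rfl le_top this
  rw [h.comm i, lin_add, lin_add]
  simpa using add_mem h2 h1

theorem iso_of_minimal (hI : IsNilpotent (RingHom.ker ε)) {P Q : ProjectiveResolution X}
    (hP : IsMinimalResolution ε P) (hQ : IsMinimalResolution ε Q) (i : ℕ) :
    Nonempty (P.complex.X i ≅ Q.complex.X i) := by
  let e := ProjectiveResolution.homotopyEquiv P Q
  have h1 := bijective_of_sub_mem hI (lin ((e.hom ≫ e.inv).f i))
    fun x => homotopy_sub_mem hP e.homotopyHomInvId i x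
  have h2 := bijective_of_sub_mem hI (lin ((e.inv ≫ e.hom).f i))
    fun x => homotopy_sub_mem hQ e.homotopyInvHomId i x
  rw [HomologicalComplex.comp_f, lin_comp, LinearMap.coe_comp] at h1 h2
  have := mono_of_injective (e.hom.f i) h1.1.of_comp
  have := epi_of_surjective (e.hom.f i) h2.2.of_comp
  have := isIso_of_mono_of_epi (e.hom.f i)
  exact ⟨asIso (e.hom.f i)⟩

/-- Only one resolution has to be minimal: the composite `Q → P → Q` is homotopic to the identity,
hence bijective in each degree, so it cannot factor through zero where `Q` is nontrivial. -/
theorem not_isZero_of_minimal (hI : IsNilpotent (RingHom.ker ε)) (P Q : ProjectiveResolution X)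
    (hQ : IsMinimalResolution ε Q) (i : ℕ) (hi : Nontrivial (Q.complex.X i).carrier) :
    ¬ IsZero (P.complex.X i) := by
  intro hz
  let e := ProjectiveResolution.homotopyEquiv P Q
  have h2 := bijective_of_sub_mem hI (lin ((e.inv ≫ e.hom).f i))
    fun x => homotopy_sub_mem hQ e.homotopyInvHomId i x
  rw [HomologicalComplex.comp_f, hz.eq_of_tgt (e.inv.f i) 0, zero_comp] at h2
  obtain ⟨x, hx⟩ := exists_ne (0 : (Q.complex.X i).carrier)
  exact hx (h2.1 rfl)

end GrMod

theorem ModuleCat.not_isZero_of_minimal {A : Type} [CommRing A] {I : Ideal A} (hI : IsNilpotent I)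
    {X : ModuleCat.{0} A} (P Q : ProjectiveResolution X)
    (hQ : ∀ i x, (Q.complex.d (i + 1) i).hom x ∈ I • (⊤ : Submodule A (Q.complex.X i)))
    (i : ℕ) (hi : Nontrivial (Q.complex.X i)) : ¬ IsZero (P.complex.X i) := by
  intro hz
  let e := ProjectiveResolution.homotopyEquiv P Q
  have h := e.homotopyInvHomId
  have h2 := bijective_of_sub_mem hI ((e.inv ≫ e.hom).f i).hom fun x => by
    have h1 : (prevD i h.hom).hom x ∈ I • (⊤ : Submodule A (Q.complex.X i)) := by
      rw [Homotopy.prevD_chainComplex]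
      exact hQ i _
    have h2 : (dNext i h.hom).hom x ∈ I • (⊤ : Submodule A (Q.complex.X i)) := by
      rcases i with _ | i
      · rw [Homotopy.dNext_zero_chainComplex]
        exact zero_mem _
      · rw [Homotopy.dNext_succ_chainComplex]
        have := Submodule.mem_map_of_mem (f := (h.hom i (i + 1)).hom) (hQ i x)
        rw [Submodule.map_smul''] at this
        exact Submodule.smul_mono le_rfl le_top this
    rw [h.comm i]
    simpa using add_mem h2 h1
  rw [HomologicalComplex.comp_f, hz.eq_of_tgt (e.inv.f i) 0, zero_comp] at h2
  obtain ⟨x, hx⟩ := exists_ne (0 : Q.complex.X i)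
  exact hx (h2.1 rfl)

end Uniqueness

end

noncomputable section

/-! ### Graded free modules up to isomorphism -/

section Reindex

open GrMod

variable {k A : Type} [CommRing k] [CommRing A] [Algebra k A] {𝒜 : ℤ → Submodule k A}
  [GradedAlgebra 𝒜]

open Classical in
/-- The morphism of free modules induced by a degree preserving map of the index sets. -/
def GrMod.freeMap {κ κ' : Type} (r : κ → ℤ) (r' : κ' → ℤ) (e : κ → κ') (h : ∀ s, r' (e s) = r s) :
    free 𝒜 r ⟶ free 𝒜 r' :=
  dsumDesc _ fun s => ofElem (free 𝒜 r') (r s) (DFinsupp.single (e s) (1 : A)) fun t => by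
    by_cases ht : e s = t
    · subst ht
      rw [DFinsupp.single_eq_same]
      change (1 : A) ∈ 𝒜 (r s - r' (e s))
      rw [h, sub_self]
      exact SetLike.GradedOne.one_mem
    · rw [DFinsupp.single_eq_of_ne (Ne.symm ht)]
      exact zero_mem _

open Classical in
theorem GrMod.freeMap_single {κ κ' : Type} (r : κ → ℤ) (r' : κ' → ℤ) (e : κ → κ')
    (h : ∀ s, r' (e s) = r s) (s : κ) :
    lin (freeMap (𝒜 := 𝒜) r r' e h) (DFinsupp.single s (1 : A)) = DFinsupp.single (e s) (1 : A) := by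
  have := congrArg (fun f => lin f (1 : A))
    (dsumι_desc (fun s => shift (r s) (reg 𝒜)) (fun s => ofElem (free 𝒜 r') (r s)
      (DFinsupp.single (e s) (1 : A)) (by
        intro t
        by_cases ht : e s = t
        · subst ht
          rw [DFinsupp.single_eq_same]
          change (1 : A) ∈ 𝒜 (r s - r' (e s))
          rw [h, sub_self]
          exact SetLike.GradedOne.one_mem
        · rw [DFinsupp.single_eq_of_ne (Ne.symm ht)]
          exact zero_mem _)) s)
  exact this.trans (ofElem_one (free 𝒜 r') (r s) _ _)

theorem GrMod.free_hom_ext {κ : Type} {r : κ → ℤ} {M : GrMod 𝒜} {f g : free 𝒜 r ⟶ M}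
    (h : ∀ s, lin f (by classical exact DFinsupp.single s (1 : A)) =
      lin g (by classical exact DFinsupp.single s (1 : A))) : f = g :=
  dsum_hom_ext fun s => shift_reg_hom_ext (h s)

/-- Reindexing a free module. -/
def GrMod.freeIso {κ κ' : Type} (r : κ → ℤ) (r' : κ' → ℤ) (e : κ ≃ κ') (h : ∀ s, r' (e s) = r s) :
    free 𝒜 r ≅ free 𝒜 r' where
  hom := freeMap r r' e h
  inv := freeMap r' r e.symm fun s => by rw [← h, e.apply_symm_apply]
  hom_inv_id := free_hom_ext fun s => by
    rw [lin_comp_apply, freeMap_single, freeMap_single, e.symm_apply_apply]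
    rfl
  inv_hom_id := free_hom_ext fun s => by
    rw [lin_comp_apply, freeMap_single, freeMap_single, e.apply_symm_apply]
    rfl

/-- The number of indices with a given degree. -/
def degreeCount {κ : Type} [Fintype κ] (r : κ → ℤ) : ℤ →₀ ℕ := ∑ s, Finsupp.single (r s) 1

theorem degreeCount_apply {κ : Type} [Fintype κ] (r : κ → ℤ) (d : ℤ) :
    degreeCount r d = Nat.card {s // r s = d} := by
  classical
  rw [degreeCount, Finsupp.finsetSum_apply, Nat.card_eq_fintype_card, Fintype.card_subtype,
    Finset.card_filter]
  simp only [Finsupp.single_apply]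

theorem GrMod.nonempty_iso_freeOfRank {κ : Type} [Fintype κ] (r : κ → ℤ) :
    Nonempty (free 𝒜 r ≅ freeOfRank 𝒜 (degreeCount r)) := by
  have e : ∀ d, {s // r s = d} ≃ Fin (degreeCount r d) := fun d =>
    (Finite.equivFin _).trans (finCongr (degreeCount_apply r d).symm)
  exact ⟨freeIso _ _ ((Equiv.sigmaFiberEquiv r).symm.trans (Equiv.sigmaCongrRight e)) fun s => rfl⟩

theorem degreeCount_sum {κ : Type} [Fintype κ] (r : κ → ℤ) :
    ((degreeCount r).sum fun d m => (m : LaurentPolynomial ℤ) * LaurentPolynomial.T d) =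
      ∑ s, LaurentPolynomial.T (r s) := by
  rw [degreeCount, ← Finsupp.sum_finsetSum_index (by simp) (by intros; push_cast; ring)]
  exact Finset.sum_congr rfl fun s _ => by simp

end Reindex

open MvPolynomial

theorem coinvPres_homogeneous {r m : ℕ} {p : MvPolynomial (Fin r) ℂ} (hp : p.IsHomogeneous m) :
    coinvPres r p ∈ coinvGrading (r + 1) (2 * (m : ℤ)) := by
  rw [← p.support_sum_monomial_coeff, map_sum]
  refine Submodule.sum_mem _ fun u hu => ?_
  have hd : u.degree = m := by
    rw [Finsupp.degree_eq_weight_one]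
    exact hp (mem_support_iff.1 hu)
  rw [coinvPres, aeval_monomial, ← Algebra.smul_def, ← hd]
  refine Submodule.smul_mem _ _ ?_
  have := SetLike.prod_pow_mem_graded (coinvGrading (r + 1)) (fun _ : Fin r => (2 : ℤ))
    (fun i => coinvX (r + 1) i.castSucc) (F := u.support) u
    (fun i _ => ⟨X i.castSucc, isWeightedHomogeneous_X ℂ _ _, rfl⟩)
  have h : ∑ i ∈ u.support, u i • (2 : ℤ) = 2 * (u.degree : ℤ) := by
    rw [Finsupp.degree_apply]
    simp [Finset.mul_sum, mul_comm]
  rw [h] at this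
  exact this

/-! ### From the Koszul–Tate complex to matrices -/

namespace TateData

section Fibers

variable {τ K : Type} [Field K] {x : ℕ → MvPolynomial τ K} {k : ℕ} {J : Ideal (MvPolynomial τ K)}
  (C : TateData x k J)

instance (i : ℕ) : Fintype {s // C.hd s = i} := (C.finite_hd i).fintype

/-- Only basis vectors of homological degree one higher contribute, and there are finitely many. The
differential is therefore described by finite matrices even though the whole complex has infinite
rank. -/
theorem repr_d {i : ℕ} (w : C.T) {t : C.ι} (ht : C.hd t = i) : C.basis.repr (C.d w) t =
    ∑ s : {s // C.hd s = i + 1}, C.basis.repr w s * C.basis.repr (C.d (C.basis s)) t := by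
  have h : C.basis.coord t ∘ₗ C.d = ∑ s : {s // C.hd s = i + 1},
      C.basis.repr (C.d (C.basis s)) t • C.basis.coord s := C.basis.ext fun s => by
    simp only [LinearMap.comp_apply, Module.Basis.coord_apply, LinearMap.sum_apply,
      LinearMap.smul_apply, smul_eq_mul, Module.Basis.repr_self]
    by_cases hs : C.hd s = i + 1
    · rw [Finset.sum_eq_single ⟨s, hs⟩]
      · simp
      · intro t _ hts
        rw [Finsupp.single_eq_of_ne (fun h => hts (Subtype.ext h)), mul_zero]
      · simp
    · rw [Finset.sum_eq_zero]
      · by_contra h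
        exact hs ((C.d_entry s t h).1.trans (by rw [ht]))
      · intro t _
        rw [Finsupp.single_eq_of_ne (fun h : (t : C.ι) = s => hs (by rw [← h]; exact t.2)), mul_zero]
  have := LinearMap.congr_fun h w
  simpa [mul_comm] using this

theorem sum_fiber (i : ℕ) : ∑ s : {s // C.hd s = i}, (LaurentPolynomial.T (2 * (C.wt s : ℤ)) :
    LaurentPolynomial ℤ) = ∑ s ∈ (C.finite_hd i).toFinset, LaurentPolynomial.T (2 * (C.wt s : ℤ)) :=
  (Finset.sum_subtype _ (p := fun s => C.hd s = i) (fun _ => Set.Finite.mem_toFinset _)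
    fun s => (LaurentPolynomial.T (2 * (C.wt s : ℤ)) : LaurentPolynomial ℤ)).symm

/-- A vector supported in homological degree `i`. -/
def ofFiber (i : ℕ) (u : {s // C.hd s = i} → MvPolynomial τ K) : C.T :=
  ∑ s, u s • C.basis s

theorem repr_ofFiber (i : ℕ) (u : {s // C.hd s = i} → MvPolynomial τ K) (s) :
    C.basis.repr (C.ofFiber i u) s.1 = u s := by
  classical
  simp only [ofFiber, map_sum, map_smul, Finsupp.finsetSum_apply, Finsupp.smul_apply,
    Module.Basis.repr_self, smul_eq_mul]
  rw [Finset.sum_eq_single s]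
  · simp
  · intro t _ hts
    rw [Finsupp.single_eq_of_ne (fun h => hts (Subtype.ext h.symm)), mul_zero]
  · simp

theorem repr_ofFiber_of_ne (i : ℕ) (u : {s // C.hd s = i} → MvPolynomial τ K) {t : C.ι}
    (ht : C.hd t ≠ i) : C.basis.repr (C.ofFiber i u) t = 0 := by
  simp only [ofFiber, map_sum, map_smul, Finsupp.finsetSum_apply, Finsupp.smul_apply,
    Module.Basis.repr_self, smul_eq_mul]
  refine Finset.sum_eq_zero fun s _ => ?_
  rw [Finsupp.single_eq_of_ne (fun h => ht (by rw [h]; exact s.2)), mul_zero]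

end Fibers

variable {r : ℕ} (C : TateData (varSeq ℂ r) r (initIdeal (newtonCoeff (varSeq ℂ r) (r + 1)) r))

theorem coinvPres_eq_zero_iff {p : MvPolynomial (Fin r) ℂ} :
    coinvPres r p = 0 ↔ p ∈ initIdeal (newtonCoeff (varSeq ℂ r) (r + 1)) r := by
  rw [← coinvPres_ker]
  rfl

theorem mem_initIdeal_of_aug {p : MvPolynomial (Fin r) ℂ}
    (h : coinvAug (r + 1) (coinvPres r p) = 0) : p ∈ initIdeal (varSeq ℂ r) r := by
  have h1 : (coinvAug (r + 1)).comp (coinvPres r) = aeval fun _ => 0 := algHom_ext fun i => by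
    simp [coinvPres, coinvX, coinvAug_mk]
  have h2 := AlgHom.congr_fun h1 p
  rw [AlgHom.comp_apply, h, aeval_zero'] at h2
  refine (Ideal.span_mono ?_) (mem_span_X_of_constantCoeff (by simpa using h2.symm))
  rintro _ ⟨i, rfl⟩
  exact ⟨i, i.2, varSeq_of_lt r i.2⟩

/-- The matrices of the Koszul–Tate resolution. -/
def toMatrix : MatrixResolution (coinvGrading (r + 1)) (coinvAug (r + 1)) where
  κ i := {s // C.hd s = i}
  r _ s := 2 * (C.wt s : ℤ)
  o := ⟨C.o, C.hd_o⟩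
  D _ := Matrix.of fun s t => coinvPres r (C.basis.repr (C.d (C.basis s)) t)
  r_o := by simp [C.wt_o]
  mem i s t := by
    by_cases h : C.basis.repr (C.d (C.basis s)) t = 0
    · rw [Matrix.of_apply, h, map_zero]
      exact zero_mem _
    · obtain ⟨-, m, -, h2, h3⟩ := C.d_entry _ _ h
      rw [Matrix.of_apply, h2]
      have := coinvPres_homogeneous h3
      convert this using 2
      push_cast
      ring
  aug i s t := by
    by_cases h : C.basis.repr (C.d (C.basis s)) t = 0
    · rw [Matrix.of_apply, h, map_zero, map_zero]
    · obtain ⟨-, m, h1, -, h3⟩ := C.d_entry _ _ h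
      -- Every nonzero entry is homogeneous of positive degree, so the augmentation kills it; this
      -- is minimality.
      have h0 : (2 * (m : ℤ)) ≠ 0 := by omega
      exact quotAug_eq_zero _ _ _ h0 _ (coinvPres_homogeneous h3)
  mul i := by
    ext s t
    have h1 := C.d_sq (C.basis s) t
    rw [C.repr_d _ t.2, ← coinvPres_eq_zero_iff, map_sum] at h1
    simpa [Matrix.mul_apply] using h1
  exact_succ i x hx := by
    -- Lift the coordinates to polynomials and place them in homological degree `i + 1`. The
    -- boundary lies in the ideal by assumption in degree `i`, and vanishes in all other degrees.
    choose u hu using fun s => coinvPres_surjective r (x s)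
    have hz : C.d (C.ofFiber (i + 1) u) ∈ coeffIn C.basis _ := fun t => by
      by_cases ht : C.hd t = i
      · rw [C.repr_d _ ht, ← coinvPres_eq_zero_iff, map_sum]
        have := congrFun hx ⟨t, ht⟩
        simpa [repr_ofFiber, hu, Matrix.vecMul, dotProduct] using this
      · rw [C.repr_d _ rfl, Finset.sum_eq_zero]
        · exact zero_mem _
        · intro s _
          rw [C.repr_ofFiber_of_ne _ _ (by rw [s.2]; omega), zero_mul]
    obtain ⟨w, c, hw⟩ := C.exact _ hz
    refine ⟨fun s => coinvPres r (C.basis.repr w s), funext fun t => ?_⟩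
    have h1 := hw t
    -- The unit sits in homological degree zero, so the multiple of it allowed by exactness is
    -- invisible here.
    have h2 : C.o ≠ t := fun h => by
      have := t.2
      rw [← h, C.hd_o] at this
      omega
    rw [← coinvPres_eq_zero_iff] at h1
    simp only [map_sub, Finsupp.sub_apply, map_smul, Finsupp.smul_apply, repr_ofFiber,
      Module.Basis.repr_self, Finsupp.single_eq_of_ne h2.symm, smul_zero, sub_zero,
      C.repr_d w t.2, map_sum, map_mul, hu, sub_eq_zero] at h1
    simpa [Matrix.vecMul, dotProduct] using h1.symm
  exact_zero x hx := by
    choose u hu using fun s => coinvPres_surjective r (x s)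
    have hz : C.d (C.ofFiber 0 u) ∈ coeffIn C.basis
        (initIdeal (newtonCoeff (varSeq ℂ r) (r + 1)) r) := fun t => by
      rw [C.repr_d _ rfl, Finset.sum_eq_zero]
      · exact zero_mem _
      · intro s _
        rw [C.repr_ofFiber_of_ne _ _ (by rw [s.2]; omega), zero_mul]
    obtain ⟨w, c, hw⟩ := C.exact _ hz
    -- At the unit, the coordinates of the lift, of boundaries and of the error term all lie in the
    -- ideal of the variables. So does `c`, which makes `c` times the unit a boundary.
    have hc : c ∈ initIdeal (varSeq ℂ r) r := by
      have h1 := C.le (hw C.o)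
      have h2 : u ⟨C.o, C.hd_o⟩ ∈ initIdeal (varSeq ℂ r) r :=
        mem_initIdeal_of_aug (by rw [hu]; exact hx)
      have h3 := C.repr_ofFiber 0 u ⟨C.o, C.hd_o⟩
      simp only [map_sub, Finsupp.sub_apply, map_smul, Finsupp.smul_apply, h3,
        Module.Basis.repr_self, Finsupp.single_eq_same, smul_eq_mul, mul_one] at h1
      have := sub_mem (sub_mem h2 (C.d_mem w C.o)) h1
      simpa using this
    obtain ⟨w', hw'⟩ := C.exists_of_mem hc
    refine ⟨fun s => coinvPres r (C.basis.repr (w + w') s), funext fun t => ?_⟩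
    have h1 := hw t
    rw [hw', sub_sub, ← map_add, ← coinvPres_eq_zero_iff] at h1
    simp only [map_sub, Finsupp.sub_apply, repr_ofFiber, C.repr_d (w + w') t.2, map_sum, map_mul,
      hu, sub_eq_zero] at h1
    simpa [Matrix.vecMul, dotProduct] using h1.symm

end TateData

/-- The minimal resolution of the trivial module over the ring of coinvariants. -/
theorem exists_coinv_resolution (r : ℕ) :
    ∃ R : MatrixResolution (coinvGrading (r + 1)) (coinvAug (r + 1)),
      poincareSeries (fun i => degreeCount (R.r i)) * ∏ j ∈ Finset.Icc 2 (r + 1),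
          (1 - PowerSeries.C (LaurentPolynomial.T (2 * (j : ℤ))) * PowerSeries.X ^ 2) =
        (1 + PowerSeries.C (LaurentPolynomial.T 2) * PowerSeries.X) ^ r ∧
      (0 < r → ∀ i, Nonempty (R.κ i)) := by
  obtain ⟨C, h1, -, h2⟩ := TateData.exists_tate ℂ r r le_rfl
  have h3 : poincareSeries (fun i => degreeCount (C.toMatrix.r i)) = C.series := by
    refine PowerSeries.ext fun i => ?_
    rw [TateData.series, coeff_bigradedSeries, poincareSeries, PowerSeries.coeff_mk,
      degreeCount_sum]
    exact C.sum_fiber i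
  have h4 : ∏ j ∈ Finset.Icc 2 (r + 1), (1 - PowerSeries.C (LaurentPolynomial.T (2 * (j : ℤ)) :
      LaurentPolynomial ℤ) * PowerSeries.X ^ 2) = ∏ j ∈ Finset.range r,
      (1 - PowerSeries.C (LaurentPolynomial.T (2 * ((r + 1 - j : ℕ) : ℤ))) * PowerSeries.X ^ 2) := by
    refine Finset.prod_bij' (fun j _ => r + 1 - j) (fun j _ => r + 1 - j) ?_ ?_ ?_ ?_ ?_ <;>
      intro j hj <;> simp only [Finset.mem_Icc, Finset.mem_range] at hj ⊢
    · omega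
    · omega
    · omega
    · omega
    · rw [show r + 1 - (r + 1 - j) = j by omega]
  refine ⟨C.toMatrix, ?_, fun hr i => ?_⟩
  · rw [h3, h4, h1]
  · obtain ⟨s, hs⟩ := h2 hr i
    exact ⟨(⟨s, hs⟩ : {s // C.hd s = i})⟩

end

noncomputable section

/-! ### Hilbert series and classes in the Grothendieck group -/

section Hilbert

open GrMod LaurentPolynomial

theorem LaurentPolynomial.coeff_T_mul {R : Type*} [Semiring R] (n : ℤ) (f : LaurentPolynomial R)
    (d : ℤ) : (T n * f).coeff d = f.coeff (d - n) := by
  rw [T, AddMonoidAlgebra.coeff_single_mul_apply, one_mul, neg_add_eq_sub]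

theorem finrank_of_exact {k V W U : Type*} [Field k] [AddCommGroup V] [Module k V] [AddCommGroup W]
    [Module k W] [AddCommGroup U] [Module k U] [Module.Finite k W] (f : V →ₗ[k] W) (g : W →ₗ[k] U)
    (h1 : Function.Injective f) (h2 : Function.Exact f g) (h3 : Function.Surjective g) :
    Module.finrank k W = Module.finrank k V + Module.finrank k U := by
  have := LinearMap.finrank_range_add_finrank_ker g
  rw [LinearMap.range_eq_top.2 h3, finrank_top, LinearMap.exact_iff.1 h2,
    LinearMap.finrank_range_of_inj h1] at this
  omega

variable {k A : Type} [Field k] [CommRing A] [Algebra k A] {𝒜 : ℤ → Submodule k A}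

namespace GrMod

variable {L M N : GrMod 𝒜}

theorem finrank_deg_of_exact [Module.Finite k M.carrier] (f : L ⟶ M) (g : M ⟶ N)
    (h1 : Function.Injective (lin f)) (h2 : Function.Exact (lin f) (lin g))
    (h3 : Function.Surjective (lin g)) (d : ℤ) :
    Module.finrank k (M.deg d) = Module.finrank k (L.deg d) + Module.finrank k (N.deg d) := by
  refine finrank_of_exact
    (((lin f).restrictScalars k).restrict (p := L.deg d) (q := M.deg d) fun x hx => lin_mem f hx)
    (((lin g).restrictScalars k).restrict (p := M.deg d) (q := N.deg d) fun x hx => lin_mem g hx)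
    (fun x y h => Subtype.ext (h1 (congrArg Subtype.val h))) (fun x => ⟨fun h => ?_, ?_⟩)
    fun y => ?_
  · obtain ⟨y, hy⟩ := (h2 x).1 (congrArg Subtype.val h)
    exact ⟨⟨y, mem_deg_of_injective f h1 (by rw [hy]; exact x.2)⟩, Subtype.ext hy⟩
  · rintro ⟨y, rfl⟩
    exact Subtype.ext ((h2 _).2 ⟨y, rfl⟩)
  · obtain ⟨x, hx⟩ := h3 y
    refine ⟨⟨M.proj d x, M.proj_mem d x⟩, Subtype.ext ?_⟩
    change lin g (M.proj d x) = y
    rw [lin_proj, hx, proj_same y.2]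

theorem finrank_carrier_of_exact [Module.Finite k M.carrier] (f : L ⟶ M) (g : M ⟶ N)
    (h1 : Function.Injective (lin f)) (h2 : Function.Exact (lin f) (lin g))
    (h3 : Function.Surjective (lin g)) :
    Module.finrank k M.carrier = Module.finrank k L.carrier + Module.finrank k N.carrier :=
  finrank_of_exact ((lin f).restrictScalars k) ((lin g).restrictScalars k) h1 h2 h3

/-- `M` is finite-dimensional with Hilbert series `p`. -/
structure HasHilbert (M : GrMod 𝒜) (p : ℤ[T;T⁻¹]) : Prop where
  finite : Module.Finite k M.carrier
  finrank_eq : ∀ d, (Module.finrank k (M.deg d) : ℤ) = p.coeff d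

namespace HasHilbert

variable {p q : ℤ[T;T⁻¹]}

theorem ker (hM : HasHilbert M p) (hN : HasHilbert N q) (g : M ⟶ N)
    (h : Function.Surjective (lin g)) : HasHilbert (GrMod.ker g) (p - q) where
  finite := by
    have := hM.finite
    exact inferInstanceAs (Module.Finite k ((LinearMap.ker (lin g)).restrictScalars k))
  finrank_eq d := by
    have := hM.finite
    have h1 := finrank_deg_of_exact (kerι g) g Subtype.val_injective
      (fun x => ⟨fun hx => ⟨⟨x, hx⟩, rfl⟩, by rintro ⟨y, rfl⟩; exact y.2⟩) h d
    have h2 := hM.finrank_eq d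
    have h3 := hN.finrank_eq d
    rw [AddMonoidAlgebra.coeff_sub, Finsupp.sub_apply]
    omega

theorem coker (hL : HasHilbert L p) (hM : HasHilbert M q) (f : L ⟶ M)
    (h : Function.Injective (lin f)) : HasHilbert (GrMod.coker f) (q - p) where
  finite := by
    have := hM.finite
    exact inferInstanceAs (Module.Finite k (M.carrier ⧸ (LinearMap.range (lin f)).restrictScalars k))
  finrank_eq d := by
    have := hM.finite
    have h1 := finrank_deg_of_exact f (cokerπ f) h
      (fun x => Submodule.Quotient.mk_eq_zero _) (Submodule.mkQ_surjective _) d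
    have h2 := hM.finrank_eq d
    have h3 := hL.finrank_eq d
    rw [AddMonoidAlgebra.coeff_sub, Finsupp.sub_apply]
    omega

theorem deg_eq_bot (hM : HasHilbert M p) {d : ℤ} (h : p.coeff d = 0) : M.deg d = ⊥ := by
  have := hM.finite
  rw [← Submodule.finrank_eq_zero (R := k)]
  have := hM.finrank_eq d
  omega

theorem eq_zero_of_forall (hM : HasHilbert M p) (h : ∀ d, p.coeff d = 0) (x : M.carrier) : x = 0 :=
  internal_induction M.isInternal (P := fun x => x = 0) rfl
    (fun x y hx hy => by rw [hx, hy, add_zero])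
    (fun d x hx => by rw [hM.deg_eq_bot (h d)] at hx; exact hx) x

end HasHilbert

theorem hasHilbert_shift_triv {ε : A →ₐ[k] k} (hε : ∀ i ≠ 0, ∀ a ∈ 𝒜 i, ε a = 0) (D : ℤ) :
    HasHilbert (shift D (triv 𝒜 ε hε)) (T D) where
  finite := inferInstanceAs (Module.Finite k k)
  finrank_eq d := by
    change (Module.finrank k (if d - D = 0 then (⊤ : Submodule k (Triv ε)) else ⊥ :
      Submodule k (Triv ε)) : ℤ) = _
    rw [T_apply]
    by_cases h : d - D = 0
    · rw [if_pos h, if_pos (by omega), finrank_top]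
      exact congrArg Nat.cast (Module.finrank_self k)
    · rw [if_neg h, if_neg (by omega), finrank_bot]
      rfl

theorem hasHilbert_triv {ε : A →ₐ[k] k} (hε : ∀ i ≠ 0, ∀ a ∈ 𝒜 i, ε a = 0) :
    HasHilbert (triv 𝒜 ε hε) 1 := by
  refine ⟨inferInstanceAs (Module.Finite k k), fun d => ?_⟩
  have := (hasHilbert_shift_triv hε 0).finrank_eq d
  rw [T_zero, show (shift 0 (triv 𝒜 ε hε)).deg d = (triv 𝒜 ε hε).deg (d - 0) from rfl,
    sub_zero] at this
  exact this

end GrMod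

/-- A nonnegatively graded algebra with `𝒜 0 = k`. -/
structure IsConnectedGraded (𝒜 : ℤ → Submodule k A) : Prop where
  neg : ∀ i < 0, 𝒜 i = ⊥
  zero : ∀ a ∈ 𝒜 0, ∃ c : k, algebraMap k A c = a

/-- For a zero module the identity maps form an exact sequence, so the class equals twice itself. -/
theorem K0.cls_eq_zero {M : GrMod 𝒜} (hM : Module.Finite k M.carrier) (h : ∀ x : M.carrier, x = 0) :
    K0.cls M hM = 0 := by
  have := K0.cls_exact hM hM hM (𝟙 M) (𝟙 M) (fun _ _ h => h)
    (fun x => ⟨fun _ => ⟨x, rfl⟩, fun _ => h _⟩) (fun x => ⟨x, rfl⟩)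
  simpa using this

variable [GradedAlgebra 𝒜] {ε : A →ₐ[k] k} (hε : ∀ i ≠ 0, ∀ a ∈ 𝒜 i, ε a = 0)

/-- Positive degrees push `x` beyond the top degree and degree zero consists of scalars, so the
action factors through the augmentation. -/
theorem IsConnectedGraded.smul_eq (hA : IsConnectedGraded 𝒜) {M : GrMod 𝒜} {D : ℤ} {x : M.carrier}
    (hx : x ∈ M.deg D) (hD : ∀ i > 0, M.deg (i + D) = ⊥) (hε : ∀ i ≠ 0, ∀ a ∈ 𝒜 i, ε a = 0) (a : A) :
    a • x = ε a • x := by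
  refine internal_induction (reg 𝒜).isInternal (P := fun a : A => a • x = ε a • x) (by simp)
    (fun a b ha hb => by rw [add_smul, ha, hb, map_add, add_smul]) (fun i a ha => ?_) a
  change a ∈ 𝒜 i at ha
  rcases lt_trichotomy i 0 with hi | rfl | hi
  · rw [hA.neg i hi, Submodule.mem_bot] at ha
    simp [ha]
  · obtain ⟨c, rfl⟩ := hA.zero a ha
    rw [algebraMap_smul, ε.commutes, Algebra.algebraMap_self, RingHom.id_apply]
  · have := M.smul_mem ha hx
    rw [hD i hi, Submodule.mem_bot] at this
    rw [hε i hi.ne' a ha, this, zero_smul]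

/-- Induction on the dimension. A nonzero vector of top degree spans a shifted trivial submodule,
and passing to the quotient subtracts one monomial from the Hilbert series. -/
theorem IsConnectedGraded.cls_eq (hA : IsConnectedGraded 𝒜) {M : GrMod 𝒜} {p : ℤ[T;T⁻¹]}
    (hM : HasHilbert M p) (h : Module.Finite k (triv 𝒜 ε hε).carrier) :
    K0.cls M hM.finite = p • K0.cls (triv 𝒜 ε hε) h := by
  induction hn : Module.finrank k M.carrier using Nat.strong_induction_on generalizing M p with
  | _ n ih =>
  by_cases hp : p.coeff.support = ∅
  · have hp' : p = 0 := LaurentPolynomial.ext fun d => by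
      rw [Finsupp.support_eq_empty] at hp
      rw [hp]
      rfl
    rw [K0.cls_eq_zero _ (hM.eq_zero_of_forall fun d => by rw [hp']; rfl), hp', zero_smul]
  · have hne := Finset.nonempty_iff_ne_empty.2 hp
    set D := p.coeff.support.max' hne with hDdef
    have hD : ∀ i > 0, M.deg (i + D) = ⊥ := fun i hi => hM.deg_eq_bot (by
      by_contra h
      have := p.coeff.support.le_max' _ (Finsupp.mem_support_iff.2 h)
      omega)
    have hDne : M.deg D ≠ ⊥ := fun h => by
      have h1 := hM.finrank_eq D
      rw [h, finrank_bot] at h1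
      exact Finsupp.mem_support_iff.1 (p.coeff.support.max'_mem hne) h1.symm
    obtain ⟨x, hx, hx0⟩ := Submodule.exists_mem_ne_zero_of_ne_bot hDne
    let l : Triv ε →ₗ[A] M.carrier :=
      { toFun := fun c => (show k from c) • x
        map_add' := fun c c' => add_smul (show k from c) (show k from c') x
        map_smul' := fun a c => by
          change (ε a * (show k from c)) • x = a • (show k from c) • x
          rw [smul_comm a, hA.smul_eq hx hD hε, smul_smul, mul_comm] }
    let f : shift D (triv 𝒜 ε hε) ⟶ M := ofLin (M := shift D (triv 𝒜 ε hε)) l fun i c hc => by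
      change c ∈ (if i - D = 0 then (⊤ : Submodule k (Triv ε)) else ⊥) at hc
      by_cases hi : i - D = 0
      · rw [show i = D by omega]
        exact Submodule.smul_mem _ _ hx
      · rw [if_neg hi, Submodule.mem_bot] at hc
        rw [hc, map_zero]
        exact zero_mem _
    have hf : Function.Injective (lin f) := fun c c' hcc =>
      smul_left_injective k hx0 hcc
    have h1 := HasHilbert.coker (hasHilbert_shift_triv hε D) hM f hf
    have h2 := K0.cls_exact (hasHilbert_shift_triv hε D).finite hM.finite h1.finite f (cokerπ f) hf
      (fun x => Submodule.Quotient.mk_eq_zero _) (Submodule.mkQ_surjective _)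
    have h3 := have := hM.finite; finrank_carrier_of_exact f (cokerπ f) hf
      (fun x => Submodule.Quotient.mk_eq_zero _) (Submodule.mkQ_surjective _)
    have h4 : Module.finrank k (shift D (triv 𝒜 ε hε)).carrier = 1 := Module.finrank_self k
    rw [h2, ih _ (by omega) h1 rfl, ← K0.T_smul_cls D _ h, ← add_smul, add_sub_cancel]

end Hilbert

/-! ### Graded free modules and free covers -/

section Free

open GrMod LaurentPolynomial

variable {k A : Type} [Field k] [CommRing A] [Algebra k A] {𝒜 : ℤ → Submodule k A} [GradedAlgebra 𝒜]

theorem GrMod.HasHilbert.free {P : ℤ[T;T⁻¹]} (hA : HasHilbert (reg 𝒜) P) {κ : Type} [Fintype κ]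
    (r : κ → ℤ) : HasHilbert (GrMod.free 𝒜 r) ((∑ s, T (r s)) * P) where
  finite := by
    have : Module.Finite k A := hA.finite
    exact Module.Finite.equiv (DFinsupp.linearEquivFunOnFintype (R := k) (M := fun _ : κ => A)).symm
  finrank_eq d := by
    have : Module.Finite k A := hA.finite
    let e : (GrMod.free 𝒜 r).deg d ≃ₗ[k] ∀ s, 𝒜 (d - r s) :=
      { toFun := fun x s => ⟨x.1 s, x.2 s⟩
        map_add' := fun x y => rfl
        map_smul' := fun c x => rfl
        invFun := fun x => ⟨(DFinsupp.equivFunOnFintype (ι := κ) (β := fun _ => A)).symm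
          fun s => (x s).1, fun s => (x s).2⟩
        left_inv := fun x => Subtype.ext (DFinsupp.ext fun s => rfl)
        right_inv := fun x => rfl }
    rw [e.finrank_eq, Module.finrank_pi_fintype, Finset.sum_mul, AddMonoidAlgebra.coeff_sum,
      Finsupp.finsetSum_apply]
    push_cast
    refine Finset.sum_congr rfl fun s _ => ?_
    rw [coeff_T_mul]
    exact hA.finrank_eq _

/-- Morphisms out of a graded free module. -/
def GrMod.freeHomEquiv {κ : Type} (r : κ → ℤ) (M : GrMod 𝒜) :
    (GrMod.free 𝒜 r ⟶ M) ≃ₗ[k] ∀ s, M.deg (r s) where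
  toFun f s := ⟨lin (dsumι (fun s => shift (r s) (reg 𝒜)) s ≫ f) (1 : A), lin_mem _ (by
    change (1 : A) ∈ 𝒜 (r s - r s)
    rw [sub_self]
    exact SetLike.GradedOne.one_mem)⟩
  map_add' f g := rfl
  map_smul' c f := rfl
  invFun x := dsumDesc _ fun s => ofElem M (r s) (x s).1 (x s).2
  left_inv f := dsum_hom_ext fun s => by
    rw [dsumι_desc]
    exact shift_reg_hom_ext (ofElem_one _ _ _ _)
  right_inv x := funext fun s => Subtype.ext (by
    dsimp only
    rw [dsumι_desc]
    exact ofElem_one _ _ _ _)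

theorem GrMod.finite_free_hom_triv {κ : Type} [Finite κ] (r : κ → ℤ) {ε : A →ₐ[k] k}
    (hε : ∀ i ≠ 0, ∀ a ∈ 𝒜 i, ε a = 0) (d : ℤ) :
    Module.Finite k (GrMod.free 𝒜 r ⟶ shift d (triv 𝒜 ε hε)) :=
  have : Module.Finite k (shift d (triv 𝒜 ε hε)).carrier := (hasHilbert_shift_triv hε d).finite
  Module.Finite.equiv (freeHomEquiv r _).symm

theorem GrMod.finrank_free_hom_triv {κ : Type} [Fintype κ] (r : κ → ℤ) {ε : A →ₐ[k] k}
    (hε : ∀ i ≠ 0, ∀ a ∈ 𝒜 i, ε a = 0) (d : ℤ) :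
    (Module.finrank k (GrMod.free 𝒜 r ⟶ shift d (triv 𝒜 ε hε)) : ℤ) =
      (∑ s, T (r s) : ℤ[T;T⁻¹]).coeff d := by
  have : Module.Finite k (shift d (triv 𝒜 ε hε)).carrier := (hasHilbert_shift_triv hε d).finite
  rw [(freeHomEquiv r _).finrank_eq, Module.finrank_pi_fintype, AddMonoidAlgebra.coeff_sum,
    Finsupp.finsetSum_apply]
  push_cast
  refine Finset.sum_congr rfl fun s _ => ?_
  rw [(hasHilbert_shift_triv hε d).finrank_eq, T_apply, T_apply]
  exact if_congr eq_comm rfl rfl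

/-- A finite-dimensional graded module is covered by the free module on a homogeneous basis. -/
theorem GrMod.HasHilbert.exists_cover {M : GrMod 𝒜} {p : ℤ[T;T⁻¹]} (hM : HasHilbert M p) :
    ∃ (κ : Type) (_ : Fintype κ) (r : κ → ℤ) (π : GrMod.free 𝒜 r ⟶ M),
      Function.Surjective (lin π) ∧ ∑ s, T (r s) = p := by
  have := hM.finite
  let κ : Type := Σ d : p.coeff.support, Fin (Module.finrank k (M.deg d))
  let b : ∀ d, Module.Basis (Fin (Module.finrank k (M.deg d))) k (M.deg d) :=
    fun d => Module.finBasis k (M.deg d)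
  let F : κ → GrMod 𝒜 := fun s => shift s.1 (reg 𝒜)
  let f : ∀ s, F s ⟶ M := fun s => ofElem M s.1 (b s.1 s.2).1 (b s.1 s.2).2
  refine ⟨κ, inferInstance, fun s => s.1, dsumDesc F f, surjective_of_lift _ fun d y hy => ?_, ?_⟩
  · by_cases hd : d ∈ p.coeff.support
    · have h1 : ∀ j, (b d j).1 ∈ LinearMap.range (lin (dsumDesc F f)) := fun j =>
        ⟨lin (dsumι F ⟨⟨d, hd⟩, j⟩) (1 : A), by
          rw [← lin_comp_apply, dsumι_desc]
          exact ofElem_one _ _ _ _⟩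
      have h2 := congrArg Subtype.val ((b d).sum_repr ⟨y, hy⟩)
      rw [AddSubmonoidClass.coe_finsetSum] at h2
      change y ∈ LinearMap.range (lin (dsumDesc F f))
      rw [← show _ = y from h2]
      exact Submodule.sum_mem _ fun j _ => Submodule.smul_of_tower_mem _ _ (h1 j)
    · rw [hM.deg_eq_bot (Finsupp.notMem_support_iff.1 hd), Submodule.mem_bot] at hy
      exact ⟨0, by rw [map_zero, hy]⟩
  · refine LaurentPolynomial.ext fun m => ?_
    rw [AddMonoidAlgebra.coeff_sum, Finsupp.finsetSum_apply, Fintype.sum_sigma]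
    simp only [T_apply, Finset.sum_const, Finset.card_univ, Fintype.card_fin, nsmul_eq_mul,
      hM.finrank_eq, mul_ite, mul_one, mul_zero]
    rw [Finset.sum_coe_sort p.coeff.support fun d => if d = m then p.coeff d else 0,
      Finset.sum_ite_eq' p.coeff.support m]
    by_cases hm : m ∈ p.coeff.support
    · rw [if_pos hm]
    · rw [if_neg hm, Finsupp.notMem_support_iff.1 hm]

end Free

end

noncomputable section

/-! ### A resolution of the size of the bar resolution -/

section BarResolution

open GrMod LaurentPolynomial

variable {k A : Type} [Field k] [CommRing A] [Algebra k A] {𝒜 : ℤ → Submodule k A}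

theorem GrMod.HasHilbert.unique {M : GrMod 𝒜} {p q : ℤ[T;T⁻¹]} (hp : HasHilbert M p)
    (hq : HasHilbert M q) : p = q :=
  LaurentPolynomial.ext fun d => by rw [← hp.finrank_eq, hq.finrank_eq]

variable [GradedAlgebra 𝒜] {ε : A →ₐ[k] k} (hε : ∀ i ≠ 0, ∀ a ∈ 𝒜 i, ε a = 0)

/-- Every finite-dimensional connected graded algebra has a resolution of the trivial module of the
size of the bar resolution. -/
theorem exists_bar_resolution {P : ℤ[T;T⁻¹]} (hA : HasHilbert (reg 𝒜) P) :
    ∃ R : ProjectiveResolution (triv 𝒜 ε hε), ∀ i d,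
      Module.Finite k (R.complex.X i ⟶ shift d (triv 𝒜 ε hε)) ∧
      (Module.finrank k (R.complex.X i ⟶ shift d (triv 𝒜 ε hε)) : ℤ) =
        ((P - 1) ^ i).coeff d := by
  choose κ hκ r π hπ hr using fun M : {M : GrMod 𝒜 // ∃ p, HasHilbert M p} =>
    M.2.choose_spec.exists_cover
  -- The cover has one generator per basis vector, hence Hilbert series `p P`, and the kernel has `p
  -- P - p`.
  have hker : ∀ M p, HasHilbert M.1 p → HasHilbert (GrMod.ker (π M)) ((P - 1) * p) := fun M p hp => by
    have h1 := (hA.free (r M)).ker M.2.choose_spec (π M) (hπ M)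
    rw [hr M, ← hp.unique M.2.choose_spec] at h1
    rwa [sub_mul, one_mul, mul_comm P]
  -- Iterated syzygies. Each carries the mere existence of a Hilbert series, so that the chosen
  -- cover depends on the module alone.
  let S : ℕ → {M : GrMod 𝒜 // ∃ p, HasHilbert M p} := fun i =>
    Nat.rec ⟨triv 𝒜 ε hε, 1, hasHilbert_triv hε⟩
      (fun _ M => ⟨GrMod.ker (π M), _, hker M _ M.2.choose_spec⟩) i
  have hS : ∀ i, HasHilbert (S i).1 ((P - 1) ^ i) := fun i => by
    induction i with
    | zero => rw [pow_zero]; exact hasHilbert_triv hε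
    | succ i ih => rw [pow_succ']; exact hker _ _ ih
  let π' : ∀ i, free 𝒜 (r (S (i + 1))) ⟶ GrMod.ker (π (S i)) := fun i => π (S (i + 1))
  let d : ∀ i, free 𝒜 (r (S (i + 1))) ⟶ free 𝒜 (r (S i)) := fun i => π' i ≫ kerι (π (S i))
  have hd : ∀ i, d i ≫ π (S i) = 0 := fun i => by
    rw [Category.assoc, kerι_comp, comp_zero]
  have hd' : ∀ i (x : (free 𝒜 (r (S i))).carrier), lin (π (S i)) x = 0 → ∃ y, lin (d i) y = x := by
    intro i x hx
    obtain ⟨y, hy⟩ := hπ (S (i + 1)) ⟨x, hx⟩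
    exact ⟨y, congrArg (kerι (π (S i))).1 hy⟩
  have : Epi (π (S 0)) := epi_of_surjective _ (hπ _)
  have sq : ∀ i, d (i + 1) ≫ d i = 0 := fun i => by
    rw [← Category.assoc]
    exact (congrArg (· ≫ kerι (π (S i))) (hd (i + 1))).trans zero_comp
  refine ⟨ProjectiveResolution.ofExact (fun i => free 𝒜 (r (S i))) d sq (π (S 0)) (hd 0)
    (exact_of_elements _ _ _ (hd' 0))
    (fun i => exact_of_elements _ _ _ fun x hx => hd' (i + 1) x (Subtype.ext hx)),
    fun i d => ⟨finite_free_hom_triv (r (S i)) hε d, ?_⟩⟩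
  refine (finrank_free_hom_triv (r (S i)) hε d).trans ?_
  rw [hr, ← (hS i).unique (S i).2.choose_spec]

end BarResolution

/-! ### Euler characteristics of cochain complexes -/

section EulerCharacteristic

variable {k : Type} [Field k]

theorem ShortComplex.finrank_homology (S : ShortComplex (ModuleCat.{0} k)) [Module.Finite k S.X₁]
    [Module.Finite k S.X₂] : Module.finrank k S.homology + Module.finrank k (LinearMap.range S.f.hom) =
      Module.finrank k (LinearMap.ker S.g.hom) := by
  have h1 : Module.finrank k S.homology = Module.finrank k
      (LinearMap.ker S.g.hom ⧸ LinearMap.range S.moduleCatToCycles) :=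
    S.moduleCatHomologyIso.toLinearEquiv.finrank_eq
  have h2 := LinearMap.finrank_range_add_finrank_ker S.moduleCatToCycles
  have h3 := LinearMap.finrank_range_add_finrank_ker S.f.hom
  have h4 : LinearMap.ker S.moduleCatToCycles = LinearMap.ker S.f.hom :=
    LinearMap.ker_codRestrict _ _ _
  rw [h4] at h2
  have h5 := Submodule.finrank_quotient_add_finrank (LinearMap.range S.moduleCatToCycles)
  omega

theorem ShortComplex.finite_homology (S : ShortComplex (ModuleCat.{0} k))
    [Module.Finite k S.X₂] : Module.Finite k S.homology :=
  have : Module.Finite k S.moduleCatLeftHomologyData.H :=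
    inferInstanceAs (Module.Finite k (LinearMap.ker S.g.hom ⧸ LinearMap.range S.moduleCatToCycles))
  Module.Finite.equiv (S.moduleCatHomologyIso.toLinearEquiv (R := k)).symm

variable (K : CochainComplex (ModuleCat.{0} k) ℕ) [∀ i, Module.Finite k (K.X i)]

theorem CochainComplex.finite_homology (i : ℕ) : Module.Finite k (K.homology i) :=
  have : Module.Finite k (K.sc i).X₂ := inferInstanceAs (Module.Finite k (K.X i))
  ShortComplex.finite_homology (K.sc i)

theorem CochainComplex.finrank_homology_zero : Module.finrank k (K.homology 0) +
    Module.finrank k (LinearMap.range (K.d 0 1).hom) = Module.finrank k (K.X 0) := by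
  have h1 := (ShortComplex.homologyMapIso (K.isoSc' 0 0 1 (by simp) (by simp))).toLinearEquiv.finrank_eq
  have : Module.Finite k (K.sc' 0 0 1).X₁ := inferInstanceAs (Module.Finite k (K.X 0))
  have : Module.Finite k (K.sc' 0 0 1).X₂ := inferInstanceAs (Module.Finite k (K.X 0))
  have h2 := ShortComplex.finrank_homology (K.sc' 0 0 1)
  have h3 : (K.sc' 0 0 1).f = 0 := K.shape 0 0 (by simp)
  have h4 := LinearMap.finrank_range_add_finrank_ker (K.d 0 1).hom
  rw [h3, ModuleCat.hom_zero, LinearMap.range_zero, finrank_bot] at h2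
  change Module.finrank k (K.sc' 0 0 1).homology + 0 = Module.finrank k (LinearMap.ker (K.d 0 1).hom) at h2
  change Module.finrank k (K.homology 0) = _ at h1
  omega

theorem CochainComplex.finrank_homology_succ (i : ℕ) : Module.finrank k (K.homology (i + 1)) +
    Module.finrank k (LinearMap.range (K.d (i + 1) (i + 2)).hom) +
    Module.finrank k (LinearMap.range (K.d i (i + 1)).hom) = Module.finrank k (K.X (i + 1)) := by
  have h1 := (ShortComplex.homologyMapIso
    (K.isoSc' i (i + 1) (i + 2) (by simp) (by simp))).toLinearEquiv.finrank_eq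
  have : Module.Finite k (K.sc' i (i + 1) (i + 2)).X₁ := inferInstanceAs (Module.Finite k (K.X i))
  have : Module.Finite k (K.sc' i (i + 1) (i + 2)).X₂ :=
    inferInstanceAs (Module.Finite k (K.X (i + 1)))
  have h2 := ShortComplex.finrank_homology (K.sc' i (i + 1) (i + 2))
  have h4 := LinearMap.finrank_range_add_finrank_ker (K.d (i + 1) (i + 2)).hom
  change Module.finrank k (K.sc' i (i + 1) (i + 2)).homology +
    Module.finrank k (LinearMap.range (K.d i (i + 1)).hom) =
      Module.finrank k (LinearMap.ker (K.d (i + 1) (i + 2)).hom) at h2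
  change Module.finrank k (K.homology (i + 1)) = _ at h1
  omega

/-- The ranks of consecutive differentials telescope. Truncation leaves the rank of the last one as
a correction, which vanishes once the next cochain group is zero. -/
theorem CochainComplex.sum_finrank_homology (N : ℕ) :
    ∑ i ∈ Finset.range (N + 1), (-1) ^ i * (Module.finrank k (K.homology i) : ℤ) =
      ∑ i ∈ Finset.range (N + 1), (-1) ^ i * (Module.finrank k (K.X i) : ℤ) -
        (-1) ^ N * (Module.finrank k (LinearMap.range (K.d N (N + 1)).hom) : ℤ) := by
  induction N with
  | zero =>
    have := CochainComplex.finrank_homology_zero K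
    simp
    omega
  | succ N ih =>
    rw [Finset.sum_range_succ, ih, Finset.sum_range_succ _ (N + 1),
      ← CochainComplex.finrank_homology_succ K N]
    push_cast
    ring

end EulerCharacteristic

/-! ### The Euler characteristic as an inverse series -/

section ExtEulerChar

open GrMod LaurentPolynomial

theorem coeff_toLaurent_natCast (p : Polynomial ℤ) (n : ℕ) : p.toLaurent.coeff (n : ℤ) = p.coeff n := by
  rw [coeff_toLaurent]
  exact Finsupp.mapDomain_apply Nat.castEmbedding.injective _ _

theorem coeff_toLaurent_neg (p : Polynomial ℤ) {d : ℤ} (hd : d < 0) : p.toLaurent.coeff d = 0 := by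
  rw [coeff_toLaurent]
  refine Finsupp.mapDomain_of_notMem_range _ _ ?_
  rintro ⟨n, rfl⟩
  simp at hd
  omega

/-- The variable divides `p - 1`, so the `i`-th power starts in degree `i`. This bounds the
homological degrees that contribute to a fixed internal degree. -/
theorem coeff_sub_one_pow {p : Polynomial ℤ} (hp : p.coeff 0 = 1) {i : ℕ} {d : ℤ} (h : d < i) :
    ((p.toLaurent - 1) ^ i).coeff d = 0 := by
  rw [← map_one (Polynomial.toLaurent (R := ℤ)), ← map_sub, ← map_pow]
  rcases lt_or_ge d 0 with hd | hd
  · exact coeff_toLaurent_neg _ hd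
  · lift d to ℕ using hd
    rw [coeff_toLaurent_natCast]
    have h1 : Polynomial.X ∣ p - 1 := Polynomial.X_dvd_iff.2 (by simp [hp])
    exact Polynomial.X_pow_dvd_iff.1 (pow_dvd_pow_of_dvd h1 i) d (by omega)

/-- The inverse series of a polynomial with constant term `1`. -/
theorem exists_inverse_series {p : Polynomial ℤ} (hp : p.coeff 0 = 1) :
    ∃ E : LaurentSeries ℤ, E * toLaurentSeries p = 1 ∧ ∀ (N : ℕ) (d : ℤ), d ≤ N →
      E.coeff d = ∑ i ∈ Finset.range (N + 1), (-1) ^ i * ((p.toLaurent - 1) ^ i).coeff d := by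
  have hc : PowerSeries.constantCoeff (p : PowerSeries ℤ) = ((1 : ℤˣ) : ℤ) := by
    rw [← PowerSeries.coeff_zero_eq_constantCoeff_apply, Polynomial.coeff_coe, hp]
    rfl
  set e := PowerSeries.invOfUnit (p : PowerSeries ℤ) 1 with he
  have h1 : (p : PowerSeries ℤ) * e = 1 := PowerSeries.mul_invOfUnit _ _ hc
  refine ⟨HahnSeries.ofPowerSeries ℤ ℤ e, ?_, fun N d hd => ?_⟩
  · rw [toLaurentSeries, ← map_mul, mul_comm, h1, map_one]
  rcases lt_or_ge d 0 with hd0 | hd0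
  · rw [Finset.sum_eq_zero fun i _ => by rw [coeff_sub_one_pow hp (by omega), mul_zero]]
    rw [HahnSeries.ofPowerSeries_apply]
    refine HahnSeries.embDomain_of_notMem_range ?_
    rintro ⟨n, hn⟩
    simp at hn
    omega
  · lift d to ℕ using hd0
    -- A finite geometric sum with its remainder; the remainder is divisible by the `(N + 1)`-st
    -- power of the variable and does not affect degrees up to `N`.
    have h2 : e = (∑ i ∈ Finset.range (N + 1), (-1) ^ i * (p - 1) ^ i : Polynomial ℤ) +
        e * ((1 - p) ^ (N + 1) : Polynomial ℤ) := by
      have h3 := mul_neg_geom_sum (1 - p) (N + 1)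
      rw [sub_sub_cancel] at h3
      have h4 : ∑ i ∈ Finset.range (N + 1), (-1) ^ i * (p - 1) ^ i =
          ∑ i ∈ Finset.range (N + 1), (1 - p) ^ i :=
        Finset.sum_congr rfl fun i _ => by rw [← mul_pow, neg_one_mul, neg_sub]
      rw [h4]
      have h5 := congrArg (fun f : Polynomial ℤ => e * (f : PowerSeries ℤ)) h3
      simp only [Polynomial.coe_mul, Polynomial.coe_sub, Polynomial.coe_one] at h5
      linear_combination ((∑ i ∈ Finset.range (N + 1), (1 - p) ^ i : Polynomial ℤ) :
        PowerSeries ℤ) * h1 - h5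
    have h6 : PowerSeries.coeff d (e * (((1 - p) ^ (N + 1) : Polynomial ℤ) : PowerSeries ℤ)) = 0 := by
      have h7 : Polynomial.X ∣ 1 - p := Polynomial.X_dvd_iff.2 (by simp [hp])
      have h8 : (PowerSeries.X : PowerSeries ℤ) ^ (N + 1) ∣
          e * (((1 - p) ^ (N + 1) : Polynomial ℤ) : PowerSeries ℤ) := by
        obtain ⟨c, hc⟩ := pow_dvd_pow_of_dvd h7 (N + 1)
        rw [hc, Polynomial.coe_mul, Polynomial.coe_pow, Polynomial.coe_X]
        exact (dvd_mul_right _ _).mul_left e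
      exact PowerSeries.X_pow_dvd_iff.1 h8 d (by omega)
    rw [HahnSeries.ofPowerSeries_apply_coeff, h2, map_add, h6, add_zero, Polynomial.coeff_coe,
      Polynomial.finsetSum_coeff]
    refine Finset.sum_congr rfl fun i _ => ?_
    rw [← map_one (Polynomial.toLaurent (R := ℤ)), ← map_sub, ← map_pow, coeff_toLaurent_natCast]
    have h7 : (-1 : Polynomial ℤ) ^ i = Polynomial.C ((-1) ^ i) := by simp
    rw [h7, Polynomial.coeff_C_mul]

variable {k A : Type} [Field k] [CommRing A] [Algebra k A] {𝒜 : ℤ → Submodule k A}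
  [GradedAlgebra 𝒜] {ε : A →ₐ[k] k} (hε : ∀ i ≠ 0, ∀ a ∈ 𝒜 i, ε a = 0)

/-- The graded Euler characteristic of the self-extensions of the trivial module is the inverse of
the Hilbert series. -/
theorem exists_gradedEulerChar {p : Polynomial ℤ} (hA : HasHilbert (reg 𝒜) p.toLaurent)
    (hp : p.coeff 0 = 1) : ∃ E : LaurentSeries ℤ,
      IsGradedEulerChar (triv 𝒜 ε hε) (triv 𝒜 ε hε) E ∧ E * toLaurentSeries p = 1 := by
  obtain ⟨E, hE, hEc⟩ := exists_inverse_series hp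
  obtain ⟨R, hR⟩ := exists_bar_resolution hε hA
  let K : ℤ → CochainComplex (ModuleCat.{0} k) ℕ := fun d =>
    R.complex.linearYonedaObj k (shift d (triv 𝒜 ε hε))
  have e : ∀ i d, gradedExt (triv 𝒜 ε hε) (triv 𝒜 ε hε) i d ≃ₗ[k] (K d).homology i := fun i d =>
    (R.isoExt i (shift d (triv 𝒜 ε hε))).toLinearEquiv
  have hf : ∀ d i, Module.Finite k ((K d).X i) := fun d i => (hR i d).1
  have hc : ∀ d i, (Module.finrank k ((K d).X i) : ℤ) = ((p.toLaurent - 1) ^ i).coeff d :=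
    fun d i => (hR i d).2
  have hfin : ∀ i d, Module.Finite k (gradedExt (triv 𝒜 ε hε) (triv 𝒜 ε hε) i d) := fun i d =>
    have := hf d
    have := CochainComplex.finite_homology (K d) i
    Module.Finite.equiv (e i d).symm
  have hX : ∀ (d : ℤ) (i : ℕ), d < i → Module.finrank k ((K d).X i) = 0 := fun d i h => by
    have := hc d i
    rw [coeff_sub_one_pow hp h] at this
    exact_mod_cast this
  have hzero : ∀ (d : ℤ) (i : ℕ), d < i →
      Module.finrank k (gradedExt (triv 𝒜 ε hε) (triv 𝒜 ε hε) i d) = 0 := fun d i h => by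
    have := hf d
    rw [(e i d).finrank_eq]
    have h1 := hX d i h
    rcases i with _ | i
    · have := CochainComplex.finrank_homology_zero (K d)
      omega
    · have := CochainComplex.finrank_homology_succ (K d) i
      omega
  refine ⟨E, ⟨hfin, fun d => ?_, fun d => ?_⟩, hE⟩
  · refine (Set.finite_Iic d.toNat).subset fun i hi => ?_
    by_contra h
    have := hfin i d
    have h1 : 0 < Module.finrank k (gradedExt (triv 𝒜 ε hε) (triv 𝒜 ε hε) i d) :=
      Module.finrank_pos_iff.2 hi
    rw [hzero d i (by simp at h; omega)] at h1
    exact lt_irrefl _ h1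
  · have := hf d
    rw [finsum_eq_sum_of_support_subset (s := Finset.range (d.toNat + 1)) _ fun i hi => by
      by_contra h
      simp only [Finset.coe_range, Set.mem_Iio, not_lt] at h
      exact hi (by simp only [hzero d i (by omega), Nat.cast_zero, mul_zero])]
    -- The cochain groups beyond index `d.toNat` vanish, so the correction term is zero. A negative
    -- `d` is covered too, since then all groups vanish.
    have h1 := CochainComplex.sum_finrank_homology (K d) d.toNat
    have h2 : Module.finrank k (LinearMap.range ((K d).d d.toNat (d.toNat + 1)).hom) = 0 :=
      Nat.eq_zero_of_le_zero ((Submodule.finrank_le _).trans (hX d _ (by omega)).le)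
    rw [h2, Nat.cast_zero, mul_zero, sub_zero] at h1
    rw [hEc d.toNat d (by omega)]
    simp only [← hc, (e _ d).finrank_eq]
    exact h1.symm

end ExtEulerChar

end

noncomputable section

/-! ### Universal splitting algebras -/

section Splitting

open Polynomial

/-- The universal algebra over which `p` becomes a product of `m` linear factors. It is free, with
a basis consisting of monomials in the roots. -/
structure SplittingData {B : Type} [CommRing B] (p : B[X]) (m : ℕ) where
  S : Type
  [commRing : CommRing S]
  [algebra : Algebra B S]
  /-- The roots. -/
  y : Fin m → S
  κ : Type
  [fintype : Fintype κ]
  /-- The exponents of the basis monomials. -/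
  e : κ → Fin m → ℕ
  basis : Module.Basis κ B S
  map_eq : p.map (algebraMap B S) = ∏ i, (X - C (y i))
  basis_eq : ∀ s, basis s = ∏ i, y i ^ e s i
  sum_eq : ∑ s, (X : ℤ[X]) ^ (2 * ∑ i, e s i) = qFact m
  lift : ∀ (D : Type) [CommRing D] [Algebra B D] (z : Fin m → D),
    p.map (algebraMap B D) = ∏ i, (X - C (z i)) → ∃ f : S →ₐ[B] D, ∀ i, f (y i) = z i

attribute [instance] SplittingData.commRing SplittingData.algebra SplittingData.fintype

/-- Adjoining one root after the other. -/
def SplittingData.cons {B : Type} [CommRing B] {p : B[X]} (hp : p.Monic) {m : ℕ}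
    (hm : p.natDegree = m + 1) {q : (AdjoinRoot p)[X]}
    (hq : (X - C (AdjoinRoot.root p)) * q = p.map (AdjoinRoot.of p)) (D : SplittingData q m) :
    SplittingData p (m + 1) :=
  letI : Algebra B D.S := ((algebraMap (AdjoinRoot p) D.S).comp (algebraMap B (AdjoinRoot p))).toAlgebra
  haveI : IsScalarTower B (AdjoinRoot p) D.S := IsScalarTower.of_algebraMap_eq' rfl
  { S := D.S
    y := Fin.cons (algebraMap (AdjoinRoot p) D.S (AdjoinRoot.root p)) D.y
    κ := Fin (m + 1) × D.κ
    e := fun s => Fin.cons (s.1 : ℕ) (D.e s.2)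
    -- Powers of the first root up to exponent `m` contribute the quantum integer of `m + 1`; the
    -- other roots contribute the quantum factorial of `m`.
    basis := ((AdjoinRoot.powerBasis' hp).basis.reindex (finCongr hm)).smulTower D.basis
    map_eq := by
      have h : algebraMap B D.S = (algebraMap (AdjoinRoot p) D.S).comp (AdjoinRoot.of p) := rfl
      rw [h, ← Polynomial.map_map, ← hq, Polynomial.map_mul, D.map_eq, Fin.prod_univ_succ]
      simp
    basis_eq := fun s => by
      rw [Module.Basis.smulTower_apply, D.basis_eq, Fin.prod_univ_succ, Algebra.smul_def]
      simp
      rfl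
    sum_eq := by
      rw [Fintype.sum_prod_type, qFact_succ, ← D.sum_eq, qInt, mul_comm, Finset.sum_mul,
        Finset.sum_range]
      refine Finset.sum_congr rfl fun j _ => ?_
      rw [Finset.mul_sum]
      refine Finset.sum_congr rfl fun s _ => ?_
      rw [Fin.sum_univ_succ]
      simp [mul_add, pow_add]
    lift := fun E _ _ z hz => by
      have h0 : aeval (z 0) p = 0 := by
        rw [aeval_def, ← Polynomial.eval_map, hz, eval_prod]
        exact Finset.prod_eq_zero (Finset.mem_univ 0) (by simp)
      let f1 : AdjoinRoot p →ₐ[B] E := AdjoinRoot.liftAlgHom p (Algebra.ofId B E) (z 0) h0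
      let : Algebra (AdjoinRoot p) E := f1.toRingHom.toAlgebra
      have : IsScalarTower B (AdjoinRoot p) E := IsScalarTower.of_algebraMap_eq' f1.comp_algebraMap.symm
      have h1 : algebraMap (AdjoinRoot p) E (AdjoinRoot.root p) = z 0 :=
        AdjoinRoot.liftAlgHom_root _ _ _ _
      have h2 : q.map (algebraMap (AdjoinRoot p) E) = ∏ i : Fin m, (X - C (z i.succ)) := by
        -- The target need not be a domain; the linear factor can be cancelled because it is monic.
        refine (monic_X_sub_C (z 0)).isRegular.left ?_
        have h3 := congrArg (Polynomial.map (algebraMap (AdjoinRoot p) E)) hq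
        rw [Polynomial.map_mul, Polynomial.map_map] at h3
        have h4 : (algebraMap (AdjoinRoot p) E).comp (AdjoinRoot.of p) = algebraMap B E :=
          f1.comp_algebraMap
        rw [h4, hz, Fin.prod_univ_succ] at h3
        simpa [h1] using h3
      obtain ⟨f, hf⟩ := D.lift E _ h2
      refine ⟨f.restrictScalars B, fun i => ?_⟩
      refine Fin.cases ?_ (fun i => ?_) i
      · exact (f.commutes _).trans h1
      · exact hf i }

/-- The base ring varies in the induction, since the cofactor left after one root lives over the
ring with that root adjoined. -/
theorem exists_splittingData (m : ℕ) : ∀ (B : Type) [CommRing B] (p : B[X]), p.Monic →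
    p.natDegree = m → Nonempty (SplittingData p m) := by
  induction m with
  | zero =>
    intro B _ p hp hm
    obtain rfl := hp.natDegree_eq_zero.1 hm
    exact ⟨{
      S := B
      y := Fin.elim0
      κ := Unit
      e := fun _ => Fin.elim0
      basis := Module.Basis.singleton Unit B
      map_eq := by simp
      basis_eq := by simp
      sum_eq := by simp [qFact]
      lift := fun D _ _ _ _ => ⟨Algebra.ofId B D, fun i => i.elim0⟩ }⟩
  | succ m ih =>
    intro B _ p hp hm
    have hB : Nontrivial B := by
      by_contra h
      rw [not_nontrivial_iff_subsingleton] at h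
      rw [Subsingleton.elim p 0, natDegree_zero] at hm
      omega
    -- The degree of the quotient is only meaningful over a nontrivial ring; here the ring is free
    -- of positive rank.
    have hR : Nontrivial (AdjoinRoot p) := by
      have : Nonempty (Fin (AdjoinRoot.powerBasis' hp).dim) :=
        ⟨⟨0, by rw [AdjoinRoot.powerBasis'_dim]; omega⟩⟩
      exact (AdjoinRoot.powerBasis' hp).basis.repr.toEquiv.nontrivial
    have hr : (p.map (AdjoinRoot.of p)).IsRoot (AdjoinRoot.root p) := AdjoinRoot.isRoot_root p
    have hq := mul_divByMonic_eq_iff_isRoot.2 hr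
    have hmon : (p.map (AdjoinRoot.of p) /ₘ (X - C (AdjoinRoot.root p))).Monic := by
      refine (monic_X_sub_C (AdjoinRoot.root p)).of_mul_monic_left ?_
      rw [hq]
      exact hp.map _
    obtain ⟨D⟩ := ih (AdjoinRoot p) _ hmon (by
      rw [natDegree_divByMonic _ (monic_X_sub_C _), hp.natDegree_map, hm, natDegree_X_sub_C]
      rfl)
    exact ⟨D.cons hp hm hq⟩

end Splitting

/-! ### Hilbert series of the ring of coinvariants -/

section CoinvHilbert

open GrMod

variable {k A : Type} [Field k] [CommRing A] [Algebra k A] {𝒜 : ℤ → Submodule k A}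

open LaurentPolynomial in
theorem GrMod.hasHilbert_of_basis {M : GrMod 𝒜} {κ : Type} [Fintype κ] (r : κ → ℤ)
    (b : Module.Basis κ k M.carrier) (hb : ∀ s, b s ∈ M.deg (r s)) :
    HasHilbert M (∑ s, T (r s)) where
  finite := Module.Finite.of_basis b
  finrank_eq d := by
    classical
    have h1 : M.deg d = Submodule.span k (Set.range fun s : {s // r s = d} => b s) := by
      refine le_antisymm (fun x hx => ?_) (Submodule.span_le.2 ?_)
      · have h2 := congrArg (M.proj d) (b.sum_repr x)
        rw [proj_same hx, map_sum] at h2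
        rw [← h2]
        refine Submodule.sum_mem _ fun s _ => ?_
        rw [map_smul]
        refine Submodule.smul_mem _ _ ?_
        by_cases hs : r s = d
        · subst hs
          rw [proj_same (hb s)]
          exact Submodule.subset_span ⟨⟨s, rfl⟩, rfl⟩
        · rw [proj_ne (hb s) hs]
          exact zero_mem _
      · rintro _ ⟨⟨s, rfl⟩, rfl⟩
        exact hb s
    have h3 : Module.finrank k (Submodule.span k (Set.range fun s : {s // r s = d} => b s)) =
        Fintype.card {s // r s = d} := finrank_span_eq_card
      (b.linearIndependent.comp (fun s : {s // r s = d} => s.1) Subtype.val_injective)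
    rw [h1, h3,
      AddMonoidAlgebra.coeff_sum, Finsupp.finsetSum_apply, Fintype.card_subtype, Finset.card_filter]
    push_cast
    simp only [T_apply]

theorem coinvX_mem (n : ℕ) (i : Fin n) : coinvX n i ∈ coinvGrading n 2 :=
  ⟨MvPolynomial.X i, MvPolynomial.isWeightedHomogeneous_X ℂ _ _, rfl⟩

theorem coinvX_prod_mem {n : ℕ} {ι : Type} [Fintype ι] (f : ι → Fin n) (e : ι → ℕ) :
    ∏ i, coinvX n (f i) ^ e i ∈ coinvGrading n (2 * (∑ i, e i : ℕ)) := by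
  have := SetLike.prod_pow_mem_graded (coinvGrading n) (fun _ : ι => (2 : ℤ))
    (fun i => coinvX n (f i)) (F := Finset.univ) e (fun i _ => coinvX_mem n (f i))
  rw [show ∑ i, e i • (2 : ℤ) = 2 * (∑ i, e i : ℕ) by
    push_cast; rw [Finset.mul_sum]; exact Finset.sum_congr rfl fun i _ => by
      rw [nsmul_eq_mul, mul_comm]] at this
  exact this

theorem coinv_algHom_ext {n : ℕ} {R : Type*} [CommRing R] [Algebra ℂ R] {f g : Coinv n →ₐ[ℂ] R}
    (h : ∀ i, f (coinvX n i) = g (coinvX n i)) : f = g :=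
  Ideal.Quotient.algHom_ext ℂ (MvPolynomial.algHom_ext h)

theorem toLaurent_sum_pow {κ : Type} [Fintype κ] (e : κ → ℕ) :
    (∑ s, (Polynomial.X : Polynomial ℤ) ^ (2 * e s)).toLaurent =
      ∑ s, LaurentPolynomial.T (2 * (e s : ℤ)) := by
  rw [map_sum]
  exact Finset.sum_congr rfl fun s _ => by
    rw [Polynomial.toLaurent_X_pow]
    push_cast
    rfl

/-- The coinvariants and the splitting algebra of `X ^ n` have the same universal property, so they
are isomorphic. The monomial basis transports to a homogeneous one. -/
theorem hasHilbert_coinv (n : ℕ) : HasHilbert (reg (coinvGrading n)) (qFact n).toLaurent := by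
  obtain ⟨D⟩ := exists_splittingData n ℂ (Polynomial.X ^ n) (Polynomial.monic_X_pow n)
    (Polynomial.natDegree_X_pow n)
  have h1 := D.map_eq
  rw [Polynomial.map_pow, Polynomial.map_X] at h1
  obtain ⟨g, hg⟩ := D.lift (Coinv n) (coinvX n) (by
    rw [Polynomial.map_pow, Polynomial.map_X, coinv_prod])
  have h2 : g.comp (coinvLift D.y h1.symm) = AlgHom.id ℂ _ := coinv_algHom_ext fun i => by
    rw [AlgHom.comp_apply, coinvLift_X, hg]
    rfl
  have h3 : (coinvLift D.y h1.symm).comp g = AlgHom.id ℂ _ := by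
    refine AlgHom.toLinearMap_injective (D.basis.ext fun s => ?_)
    rw [D.basis_eq]
    change coinvLift D.y h1.symm (g (∏ i, D.y i ^ D.e s i)) = ∏ i, D.y i ^ D.e s i
    rw [map_prod, map_prod]
    exact Finset.prod_congr rfl fun i _ => by rw [map_pow, map_pow, hg, coinvLift_X]
  let e : D.S ≃ₐ[ℂ] Coinv n := AlgEquiv.ofAlgHom g (coinvLift D.y h1.symm) h2 h3
  rw [← D.sum_eq, toLaurent_sum_pow]
  refine hasHilbert_of_basis (M := reg (coinvGrading n)) _ (D.basis.map e.toLinearEquiv) fun s => ?_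
  rw [Module.Basis.map_apply, D.basis_eq]
  change g (∏ i, D.y i ^ D.e s i) ∈ coinvGrading n _
  rw [map_prod]
  simp only [map_pow, hg]
  exact coinvX_prod_mem (fun i => i) _

end CoinvHilbert

end

noncomputable section

/-! ### The Grassmannian ring as a classifier of factorizations -/

section Grass

open Polynomial

variable (k l : ℕ)

/-- The class of the `i`-th Chern class of the tautological bundle. -/
def grassSub (i : ℕ) : GrassCoh k l := Ideal.Quotient.mk _ (chernSub k l i)

/-- The class of the `i`-th Chern class of the quotient bundle. -/
def grassQuot (i : ℕ) : GrassCoh k l := Ideal.Quotient.mk _ (chernQuot k l i)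

theorem grassSub_zero : grassSub k l 0 = 1 := by simp [grassSub, chernSub]

theorem grassQuot_zero : grassQuot k l 0 = 1 := by simp [grassQuot, chernQuot]

theorem grassSub_of_lt {i : ℕ} (h : k < i) : grassSub k l i = 0 := by
  rw [grassSub, chernSub, if_neg (by omega), dif_neg (by omega), map_zero]

theorem grassQuot_of_lt {i : ℕ} (h : l < i) : grassQuot k l i = 0 := by
  rw [grassQuot, chernQuot, if_neg (by omega), dif_neg (by omega), map_zero]

/-- The polynomial `X ^ m + a 1 X ^ (m - 1) + ⋯ + a m`. -/
def revPoly {R : Type*} [CommRing R] (m : ℕ) (a : ℕ → R) : R[X] :=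
  reflect m (∑ i ∈ Finset.range (m + 1), C (a i) * X ^ i)

section RevPoly

variable {R R' : Type*} [CommRing R] [CommRing R'] (m : ℕ) (a : ℕ → R)

theorem coeff_sum_C_mul_X_pow (ha : ∀ i, m < i → a i = 0) (i : ℕ) :
    (∑ i ∈ Finset.range (m + 1), C (a i) * X ^ i).coeff i = a i := by
  simp only [finsetSum_coeff, coeff_C_mul, coeff_X_pow, mul_ite, mul_one, mul_zero]
  rw [Finset.sum_ite_eq]
  by_cases h : i ∈ Finset.range (m + 1)
  · rw [if_pos h]
  · rw [if_neg h, ha i (by simpa using h)]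

theorem natDegree_sum_C_mul_X_pow :
    (∑ i ∈ Finset.range (m + 1), C (a i) * X ^ i).natDegree ≤ m :=
  natDegree_sum_le_of_forall_le _ _ fun i hi =>
    (natDegree_C_mul_X_pow_le _ _).trans (by simp at hi; omega)

theorem revPoly_map (φ : R →+* R') : (revPoly m a).map φ = revPoly m fun i => φ (a i) := by
  rw [revPoly, revPoly, ← reflect_map, Polynomial.map_sum]
  simp

/-- The hypotheses say that the unreversed polynomials have product `1`. Reversal is multiplicative
and turns `1` into the top power; `sum_revCoeff` is the converse. -/
theorem revPoly_mul (m' : ℕ) (a' : ℕ → R) (ha : ∀ i, m < i → a i = 0)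
    (ha' : ∀ i, m' < i → a' i = 0) (h0 : a 0 * a' 0 = 1)
    (h : ∀ j, 1 ≤ j → ∑ x ∈ Finset.HasAntidiagonal.antidiagonal j, a x.1 * a' x.2 = 0) :
    revPoly m a * revPoly m' a' = X ^ (m + m') := by
  rw [revPoly, revPoly, ← reflect_mul _ _ (natDegree_sum_C_mul_X_pow m a)
    (natDegree_sum_C_mul_X_pow m' a')]
  have h1 : (∑ i ∈ Finset.range (m + 1), C (a i) * X ^ i) *
      (∑ i ∈ Finset.range (m' + 1), C (a' i) * X ^ i) = 1 := by
    ext j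
    rw [coeff_mul]
    simp only [coeff_sum_C_mul_X_pow m a ha, coeff_sum_C_mul_X_pow m' a' ha']
    rcases j with _ | j
    · simpa using h0
    · rw [h _ (by omega), coeff_one, if_neg (by omega)]
  rw [h1, reflect_one]

theorem coeff_revPoly (ha : ∀ i, m < i → a i = 0) {i : ℕ} (hi : i ≤ m) :
    (revPoly m a).coeff (m - i) = a i := by
  rw [revPoly, coeff_reflect, revAt_le (Nat.sub_le _ _), Nat.sub_sub_self hi,
    coeff_sum_C_mul_X_pow m a ha]

theorem natDegree_revPoly_le : (revPoly m a).natDegree ≤ m :=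
  (natDegree_reflect_le).trans (max_le le_rfl (natDegree_sum_C_mul_X_pow m a))

theorem revPoly_monic (ha : ∀ i, m < i → a i = 0) (h0 : a 0 = 1) : (revPoly m a).Monic :=
  monic_of_natDegree_le_of_coeff_eq_one m (natDegree_revPoly_le m a) (by
    have := coeff_revPoly m a ha (Nat.zero_le m)
    rwa [Nat.sub_zero, h0] at this)

theorem revPoly_natDegree [Nontrivial R] (ha : ∀ i, m < i → a i = 0) (h0 : a 0 = 1) :
    (revPoly m a).natDegree = m :=
  le_antisymm (natDegree_revPoly_le m a) (le_natDegree_of_ne_zero (by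
    have := coeff_revPoly m a ha (Nat.zero_le m)
    rw [Nat.sub_zero, h0] at this
    rw [this]
    exact one_ne_zero))

/-- The coefficients in reverse order. -/
def revCoeff (m : ℕ) (P : R[X]) (i : ℕ) : R := if i ≤ m then P.coeff (m - i) else 0

theorem revPoly_revCoeff {P : R[X]} (hP : P.natDegree ≤ m) : revPoly m (revCoeff m P) = P := by
  have h : ∀ i, m < i → revCoeff m P i = 0 := fun i hi => if_neg (by omega)
  ext j
  rcases le_or_gt j m with hj | hj
  · have := coeff_revPoly m _ h (Nat.sub_le m j)
    rw [Nat.sub_sub_self hj] at this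
    rw [this, revCoeff, if_pos (Nat.sub_le _ _), Nat.sub_sub_self hj]
  · rw [coeff_eq_zero_of_natDegree_lt ((natDegree_revPoly_le _ _).trans_lt hj),
      coeff_eq_zero_of_natDegree_lt (hP.trans_lt hj)]

theorem sum_revCoeff {P Q : R[X]} {m m' : ℕ} (hP : P.natDegree ≤ m) (hQ : Q.natDegree ≤ m')
    (h : P * Q = X ^ (m + m')) {j : ℕ} (hj : 1 ≤ j) :
    ∑ x ∈ Finset.HasAntidiagonal.antidiagonal j, revCoeff m P x.1 * revCoeff m' Q x.2 = 0 := by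
  have h1 := reflect_mul P Q hP hQ
  rw [h, reflect_monomial, revAt_le le_rfl, Nat.sub_self, pow_zero] at h1
  have h2 : ∀ (m : ℕ) (P : R[X]), P.natDegree ≤ m → ∀ i, (reflect m P).coeff i = revCoeff m P i := by
    intro m P hP i
    rw [coeff_reflect, revCoeff]
    by_cases hi : i ≤ m
    · rw [if_pos hi, revAt_le hi]
    · rw [if_neg hi, revAt_eq_self_of_lt (by omega), coeff_eq_zero_of_natDegree_lt (by omega)]
  have h3 := congrArg (fun p => p.coeff j) h1
  simp only [coeff_mul, h2 m P hP, h2 m' Q hQ] at h3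
  rw [← h3, coeff_one, if_neg (by omega)]

end RevPoly

/-- The total Chern class of the tautological bundle as a polynomial. -/
def grassP : (GrassCoh k l)[X] := revPoly k (grassSub k l)

/-- The total Chern class of the quotient bundle as a polynomial. -/
def grassQ : (GrassCoh k l)[X] := revPoly l (grassQuot k l)

theorem grassP_mul_grassQ : grassP k l * grassQ k l = X ^ (k + l) := by
  refine revPoly_mul _ _ _ _ (fun _ => grassSub_of_lt k l) (fun _ => grassQuot_of_lt k l)
    (by rw [grassSub_zero, grassQuot_zero, one_mul]) fun j hj => ?_
  simp only [grassSub, grassQuot, ← map_mul, ← map_sum]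
  exact Ideal.Quotient.eq_zero_iff_mem.2 (Ideal.subset_span ⟨j, hj, rfl⟩)

/-- The generators of the ring are the lower coefficients of the two universal monic factors. -/
theorem grass_algHom_ext {R : Type*} [CommRing R] [Algebra ℂ R] {f g : GrassCoh k l →ₐ[ℂ] R}
    (h : (grassP k l).map f.toRingHom = (grassP k l).map g.toRingHom)
    (h' : (grassQ k l).map f.toRingHom = (grassQ k l).map g.toRingHom) : f = g := by
  refine Ideal.Quotient.algHom_ext ℂ (MvPolynomial.algHom_ext ?_)
  rintro (i | i)
  · have h1 := congrArg (fun p => p.coeff (k - (i + 1))) h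
    simp only [coeff_map, grassP, coeff_revPoly k _ (fun _ => grassSub_of_lt k l) i.2] at h1
    simpa [grassSub, chernSub] using h1
  · have h1 := congrArg (fun p => p.coeff (l - (i + 1))) h'
    simp only [coeff_map, grassQ, coeff_revPoly l _ (fun _ => grassQuot_of_lt k l) i.2] at h1
    simpa [grassQuot, chernQuot] using h1

variable {k l}

/-- The homomorphism corresponding to a factorization of `X ^ (k + l)`. -/
theorem exists_grassLift {R : Type*} [CommRing R] [Algebra ℂ R] {P Q : R[X]} (hP : P.natDegree ≤ k)
    (hQ : Q.natDegree ≤ l) (hP1 : P.coeff k = 1) (hQ1 : Q.coeff l = 1) (h : P * Q = X ^ (k + l)) :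
    ∃ f : GrassCoh k l →ₐ[ℂ] R, (∀ i, f (grassSub k l i) = revCoeff k P i) ∧
      ∀ i, f (grassQuot k l i) = revCoeff l Q i := by
  let F : MvPolynomial (Fin k ⊕ Fin l) ℂ →ₐ[ℂ] R := MvPolynomial.aeval
    (Sum.elim (fun i => revCoeff k P (i + 1)) fun i => revCoeff l Q (i + 1))
  have h1 : ∀ i, F (chernSub k l i) = revCoeff k P i := fun i => by
    rw [chernSub]
    split_ifs with h0 hi
    · simp [h0, revCoeff, hP1]
    · simp only [F, MvPolynomial.aeval_X, Sum.elim_inl]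
      rw [Nat.sub_add_cancel (by omega)]
    · rw [map_zero, revCoeff, if_neg (by omega)]
  have h2 : ∀ i, F (chernQuot k l i) = revCoeff l Q i := fun i => by
    rw [chernQuot]
    split_ifs with h0 hi
    · simp [h0, revCoeff, hQ1]
    · simp only [F, MvPolynomial.aeval_X, Sum.elim_inr]
      rw [Nat.sub_add_cancel (by omega)]
    · rw [map_zero, revCoeff, if_neg (by omega)]
  have h3 : grassIdeal k l ≤ RingHom.ker F := Ideal.span_le.2 (by
    rintro _ ⟨m, hm, rfl⟩
    change F _ = 0
    simp only [map_sum, map_mul, h1, h2]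
    exact sum_revCoeff hP hQ h hm)
  exact ⟨Ideal.Quotient.liftₐ _ F fun a ha => h3 ha, h1, h2⟩

theorem prod_X_sub_C_coeff_mem {A : Type} [CommRing A] [Algebra ℂ A] (𝒜 : ℤ → Submodule ℂ A)
    [GradedAlgebra 𝒜] {ι : Type} (s : Finset ι) (x : ι → A) (hx : ∀ i, x i ∈ 𝒜 2) (j : ℕ) :
    (∏ i ∈ s, (X - C (x i))).coeff j ∈ 𝒜 (2 * ((s.card : ℤ) - j)) := by
  classical
  induction s using Finset.induction_on generalizing j with
  | empty =>
    rw [Finset.prod_empty, coeff_one]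
    split_ifs with h
    · subst h
      simpa using SetLike.GradedOne.one_mem (A := 𝒜)
    · exact zero_mem _
  | insert a s ha ih =>
    have h : ∀ j : ℕ, x a * (∏ i ∈ s, (X - C (x i))).coeff j ∈ 𝒜 (2 * (((s.card + 1 : ℕ) : ℤ) - j)) :=
      fun j => by
        have := SetLike.mul_mem_graded (hx a) (ih j)
        convert this using 2
        push_cast
        ring
    rw [Finset.prod_insert ha, Finset.card_insert_of_notMem ha, sub_mul, coeff_sub, coeff_C_mul]
    refine sub_mem ?_ (h j)
    rcases j with _ | j
    · rw [coeff_X_mul_zero]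
      exact zero_mem _
    · rw [coeff_X_mul]
      convert ih j using 2
      push_cast
      ring

end Grass

end

noncomputable section

/-! ### Coinvariants over the Grassmannian ring, and its Hilbert series -/

section GrassHilbert

open GrMod Polynomial

theorem GrMod.exists_homogeneous_basis {k A : Type} [Field k] [CommRing A] [Algebra k A]
    {𝒜 : ℤ → Submodule k A} (M : GrMod 𝒜) :
    ∃ (κ : Type) (b : Module.Basis κ k M.carrier) (r : κ → ℤ), ∀ s, b s ∈ M.deg (r s) :=
  ⟨_, M.isInternal.collectedBasis fun d => Module.Basis.ofVectorSpace k (M.deg d), Sigma.fst,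
    fun s => M.isInternal.collectedBasis_mem _ s⟩

theorem aeval_mem_of_weightedHomogeneous {A σ : Type} [CommRing A] [Algebra ℂ A]
    (𝒜 : ℤ → Submodule ℂ A) [GradedAlgebra 𝒜] (w : σ → ℤ) (f : MvPolynomial σ ℂ →ₐ[ℂ] A)
    (hf : ∀ i, f (MvPolynomial.X i) ∈ 𝒜 (w i)) {p : MvPolynomial σ ℂ} {d : ℤ}
    (hp : MvPolynomial.IsWeightedHomogeneous w p d) : f p ∈ 𝒜 d := by
  rw [← p.support_sum_monomial_coeff, map_sum]
  refine Submodule.sum_mem _ fun u hu => ?_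
  rw [← hp (MvPolynomial.mem_support_iff.1 hu), MvPolynomial.monomial_eq, map_mul,
    ← MvPolynomial.algebraMap_eq, f.commutes, ← Algebra.smul_def, Finsupp.prod, map_prod]
  refine Submodule.smul_mem _ _ ?_
  simp only [map_pow]
  rw [Finsupp.weight_apply]
  exact SetLike.prod_pow_mem_graded 𝒜 w (fun i => f (MvPolynomial.X i)) (F := u.support) u
    fun i _ => hf i

theorem qInt_coeff_zero (n : ℕ) : (qInt (n + 1)).coeff 0 = 1 := by
  rw [qInt, Finset.sum_range_succ', coeff_add, finsetSum_coeff]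
  simp

theorem qFact_coeff_zero (n : ℕ) : (qFact n).coeff 0 = 1 := by
  induction n with
  | zero => simp [qFact]
  | succ n ih => rw [qFact_succ, mul_coeff_zero, ih, qInt_coeff_zero, one_mul]

theorem qBinom_coeff_zero (n k : ℕ) (h : k ≤ n) : (qBinom n k).coeff 0 = 1 := by
  induction n generalizing k with
  | zero =>
    obtain rfl : k = 0 := by omega
    simp [qBinom]
  | succ n ih =>
    rcases k with _ | k
    · simp [qBinom]
    · rw [qBinom, coeff_add, ih k (by omega), mul_coeff_zero, coeff_X_pow]
      simp

theorem SplittingData.nonempty {B : Type} [CommRing B] {p : B[X]} {m : ℕ}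
    (D : SplittingData p m) : Nonempty D.κ := by
  by_contra h
  rw [not_nonempty_iff] at h
  have h1 := D.sum_eq
  rw [Fintype.sum_empty] at h1
  have h2 := qFact_coeff_zero m
  rw [← h1, coeff_zero] at h2
  exact zero_ne_one h2

variable (k l : ℕ)

/-- The ring of coinvariants is free over the cohomology ring of the Grassmannian. -/
theorem exists_coinv_basis_over_grass : ∃ (φ : GrassCoh k l →ₐ[ℂ] Coinv (k + l))
    (D : Type) (E : Type) (_ : Fintype D) (_ : Fintype E) (e : D → Fin k → ℕ) (e' : E → Fin l → ℕ),
    Nonempty D ∧ Nonempty E ∧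
    (∀ d, ∀ a ∈ grassGrading k l d, φ a ∈ coinvGrading (k + l) d) ∧
    ∑ s, (X : ℤ[X]) ^ (2 * ∑ i, e s i) = qFact k ∧ ∑ s, (X : ℤ[X]) ^ (2 * ∑ i, e' s i) = qFact l ∧
    ∀ (κ : Type) (b : Module.Basis κ ℂ (GrassCoh k l)),
      ∃ b' : Module.Basis (κ × (D × E)) ℂ (Coinv (k + l)), ∀ s, b' s = φ (b s.1) *
        ((∏ i, coinvX (k + l) (Fin.castAdd l i) ^ e s.2.1 i) *
          ∏ j, coinvX (k + l) (Fin.natAdd k j) ^ e' s.2.2 j) := by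
  set P : (Coinv (k + l))[X] := ∏ i : Fin k, (X - C (coinvX (k + l) (Fin.castAdd l i))) with hP
  set Q : (Coinv (k + l))[X] := ∏ j : Fin l, (X - C (coinvX (k + l) (Fin.natAdd k j))) with hQ
  have hPQ : P * Q = X ^ (k + l) := by rw [← coinv_prod, Fin.prod_univ_add]
  have hPm : P.Monic := monic_prod_of_monic _ _ fun i _ => monic_X_sub_C _
  have hQm : Q.Monic := monic_prod_of_monic _ _ fun i _ => monic_X_sub_C _
  have hPd : P.natDegree = k := by
    rw [hP, natDegree_prod_of_monic _ _ fun i _ => monic_X_sub_C _]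
    simp
  have hQd : Q.natDegree = l := by
    rw [hQ, natDegree_prod_of_monic _ _ fun i _ => monic_X_sub_C _]
    simp
  obtain ⟨φ, h1, h2⟩ := exists_grassLift hPd.le hQd.le
    (by have := hPm.coeff_natDegree; rwa [hPd] at this)
    (by have := hQm.coeff_natDegree; rwa [hQd] at this) hPQ
  have hφP : (grassP k l).map φ.toRingHom = P := by
    rw [grassP, revPoly_map, ← revPoly_revCoeff k hPd.le]
    exact congrArg _ (funext h1)
  have hφQ : (grassQ k l).map φ.toRingHom = Q := by
    rw [grassQ, revPoly_map, ← revPoly_revCoeff l hQd.le]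
    exact congrArg _ (funext h2)
  have hG : Nontrivial (GrassCoh k l) := φ.toRingHom.domain_nontrivial
  -- Split the first universal factor, then the second one over the resulting algebra. The tower is
  -- free over the Grassmannian ring, and is shown to be the ring of coinvariants.
  obtain ⟨S₁⟩ := exists_splittingData k (GrassCoh k l) (grassP k l)
    (revPoly_monic _ _ (fun _ => grassSub_of_lt k l) (grassSub_zero k l))
    (revPoly_natDegree _ _ (fun _ => grassSub_of_lt k l) (grassSub_zero k l))
  let : Algebra (GrassCoh k l) (Coinv (k + l)) := φ.toRingHom.toAlgebra
  have : IsScalarTower ℂ (GrassCoh k l) (Coinv (k + l)) :=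
    IsScalarTower.of_algebraMap_eq' φ.comp_algebraMap.symm
  obtain ⟨f₁, hf₁⟩ := S₁.lift (Coinv (k + l)) (fun i => coinvX (k + l) (Fin.castAdd l i)) hφP
  have hS₁ : Nontrivial S₁.S := f₁.toRingHom.domain_nontrivial
  have hQm' : (grassQ k l).Monic := revPoly_monic _ _ (fun _ => grassQuot_of_lt k l) (grassQuot_zero k l)
  obtain ⟨S₂⟩ := exists_splittingData l S₁.S ((grassQ k l).map (algebraMap (GrassCoh k l) S₁.S))
    (hQm'.map _) (by
      rw [hQm'.natDegree_map]
      exact revPoly_natDegree _ _ (fun _ => grassQuot_of_lt k l) (grassQuot_zero k l))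
  let : Algebra S₁.S (Coinv (k + l)) := f₁.toRingHom.toAlgebra
  have : IsScalarTower (GrassCoh k l) S₁.S (Coinv (k + l)) :=
    IsScalarTower.of_algebraMap_eq' f₁.comp_algebraMap.symm
  let : Algebra (GrassCoh k l) S₂.S :=
    ((algebraMap S₁.S S₂.S).comp (algebraMap (GrassCoh k l) S₁.S)).toAlgebra
  have : IsScalarTower (GrassCoh k l) S₁.S S₂.S := IsScalarTower.of_algebraMap_eq' rfl
  let : Algebra ℂ S₂.S := ((algebraMap (GrassCoh k l) S₂.S).comp (algebraMap ℂ (GrassCoh k l))).toAlgebra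
  have : IsScalarTower ℂ (GrassCoh k l) S₂.S := IsScalarTower.of_algebraMap_eq (R := ℂ) (S := GrassCoh k l) (A := S₂.S) fun _ => rfl
  obtain ⟨f₂, hf₂⟩ := S₂.lift (Coinv (k + l)) (fun j => coinvX (k + l) (Fin.natAdd k j)) (by
    rw [Polynomial.map_map, ← IsScalarTower.algebraMap_eq]
    exact hφQ)
  let f : S₂.S →ₐ[ℂ] Coinv (k + l) := (f₂.restrictScalars (GrassCoh k l)).restrictScalars ℂ
  let Y : Fin (k + l) → S₂.S := Fin.append (fun i => algebraMap S₁.S S₂.S (S₁.y i)) S₂.y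
  have hY₁ : ∀ i, Y (Fin.castAdd l i) = algebraMap S₁.S S₂.S (S₁.y i) := fun i => Fin.append_left _ _ i
  have hY₂ : ∀ j, Y (Fin.natAdd k j) = S₂.y j := fun j => Fin.append_right _ _ j
  have hP' : (grassP k l).map (algebraMap (GrassCoh k l) S₂.S) =
      ∏ i : Fin k, (X - C (Y (Fin.castAdd l i))) := by
    rw [IsScalarTower.algebraMap_eq (GrassCoh k l) S₁.S S₂.S, ← Polynomial.map_map, S₁.map_eq,
      Polynomial.map_prod]
    simp [hY₁]
  have hQ' : (grassQ k l).map (algebraMap (GrassCoh k l) S₂.S) =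
      ∏ j : Fin l, (X - C (Y (Fin.natAdd k j))) := by
    rw [IsScalarTower.algebraMap_eq (GrassCoh k l) S₁.S S₂.S, ← Polynomial.map_map, S₂.map_eq]
    simp [hY₂]
  have hYprod : ∏ i, (X - C (Y i)) = X ^ (k + l) := by
    rw [Fin.prod_univ_add, ← hP', ← hQ', ← Polynomial.map_mul, grassP_mul_grassQ, Polynomial.map_pow,
      Polynomial.map_X]
  let h := coinvLift Y hYprod
  have hh : ∀ i, h (coinvX (k + l) i) = Y i := fun i => coinvLift_X Y hYprod i
  have hfY₁ : ∀ i, f (Y (Fin.castAdd l i)) = coinvX (k + l) (Fin.castAdd l i) := fun i => by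
    rw [hY₁]
    exact (f₂.commutes _).trans (hf₁ i)
  have hfY₂ : ∀ j, f (Y (Fin.natAdd k j)) = coinvX (k + l) (Fin.natAdd k j) := fun j => by
    rw [hY₂]
    exact hf₂ j
  have hfG : ∀ a, f (algebraMap (GrassCoh k l) S₂.S a) = φ a :=
    (f₂.restrictScalars (GrassCoh k l)).commutes
  -- Both maps send each universal factor to the product of the same linear factors, so they agree
  -- on the Chern classes.
  have hhG : h.comp φ = IsScalarTower.toAlgHom ℂ (GrassCoh k l) S₂.S := by
    refine grass_algHom_ext k l ?_ ?_
    · refine Eq.trans ?_ hP'.symm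
      change (grassP k l).map (h.toRingHom.comp φ.toRingHom) = _
      rw [← Polynomial.map_map, hφP, hP, Polynomial.map_prod]
      refine Finset.prod_congr rfl fun i _ => ?_
      rw [Polynomial.map_sub, Polynomial.map_X, Polynomial.map_C]
      exact congrArg (fun y => X - C y) (hh _)
    · refine Eq.trans ?_ hQ'.symm
      change (grassQ k l).map (h.toRingHom.comp φ.toRingHom) = _
      rw [← Polynomial.map_map, hφQ, hQ, Polynomial.map_prod]
      refine Finset.prod_congr rfl fun i _ => ?_
      rw [Polynomial.map_sub, Polynomial.map_X, Polynomial.map_C]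
      exact congrArg (fun y => X - C y) (hh _)
  have hfh : f.comp h = AlgHom.id ℂ _ := coinv_algHom_ext fun i => by
    rw [AlgHom.comp_apply, hh]
    exact Fin.addCases (fun i => hfY₁ i) (fun j => hfY₂ j) i
  -- The basis of the Grassmannian ring is arbitrary and possibly infinite: finiteness of this ring
  -- is deduced afterwards from that of the coinvariants.
  let B : ∀ {κ : Type}, Module.Basis κ ℂ (GrassCoh k l) → Module.Basis (κ × (S₁.κ × S₂.κ)) ℂ S₂.S :=
    fun b => b.smulTower (S₁.basis.smulTower S₂.basis)
  have hB : ∀ {κ : Type} (b : Module.Basis κ ℂ (GrassCoh k l)) s,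
      B b s = algebraMap (GrassCoh k l) S₂.S (b s.1) *
        ((∏ i, Y (Fin.castAdd l i) ^ S₁.e s.2.1 i) * ∏ j, Y (Fin.natAdd k j) ^ S₂.e s.2.2 j) := by
    intro κ b s
    rw [Module.Basis.smulTower_apply, Module.Basis.smulTower_apply, Algebra.smul_def,
      Algebra.smul_def, S₁.basis_eq, S₂.basis_eq, map_prod]
    simp only [map_pow, hY₁, hY₂]
  have hfB : ∀ {κ : Type} (b : Module.Basis κ ℂ (GrassCoh k l)) s,
      f (B b s) = φ (b s.1) * ((∏ i, coinvX (k + l) (Fin.castAdd l i) ^ S₁.e s.2.1 i) *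
        ∏ j, coinvX (k + l) (Fin.natAdd k j) ^ S₂.e s.2.2 j) := by
    intro κ b s
    rw [hB, map_mul, map_mul, map_prod, map_prod, hfG]
    simp only [map_pow, hfY₁, hfY₂]
  have hhf : h.comp f = AlgHom.id ℂ _ := by
    refine AlgHom.toLinearMap_injective ((B (Module.Basis.ofVectorSpace ℂ _)).ext fun s => ?_)
    change h (f (B _ s)) = B _ s
    rw [hfB, hB, map_mul, map_mul, map_prod, map_prod]
    simp only [map_pow, hh]
    congr 1
    exact AlgHom.congr_fun hhG _
  let E : S₂.S ≃ₐ[ℂ] Coinv (k + l) := AlgEquiv.ofAlgHom f h hfh hhf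
  refine ⟨φ, S₁.κ, S₂.κ, inferInstance, inferInstance, S₁.e, S₂.e, S₁.nonempty, S₂.nonempty, ?_,
    S₁.sum_eq, S₂.sum_eq, fun κ b => ⟨(B b).map E.toLinearEquiv, fun s => hfB b s⟩⟩
  rintro d _ ⟨p, hp, rfl⟩
  refine aeval_mem_of_weightedHomogeneous (coinvGrading (k + l)) (grassWeight k l)
    (φ.comp (Ideal.Quotient.mkₐ ℂ _)) ?_ hp
  rintro (i | i)
  · have h3 := h1 (i + 1)
    have h4 : grassSub k l (i + 1) = Ideal.Quotient.mkₐ ℂ _ (MvPolynomial.X (Sum.inl i)) := by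
      simp [grassSub, chernSub]
    rw [AlgHom.comp_apply, ← h4, h3, revCoeff, if_pos (by omega)]
    have h5 := prod_X_sub_C_coeff_mem (coinvGrading (k + l)) Finset.univ
      (fun i => coinvX (k + l) (Fin.castAdd l i)) (fun i => coinvX_mem _ _) (k - (i + 1))
    convert h5 using 2
    simp [grassWeight]
  · have h3 := h2 (i + 1)
    have h4 : grassQuot k l (i + 1) = Ideal.Quotient.mkₐ ℂ _ (MvPolynomial.X (Sum.inr i)) := by
      simp [grassQuot, chernQuot]
    rw [AlgHom.comp_apply, ← h4, h3, revCoeff, if_pos (by omega)]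
    have h5 := prod_X_sub_C_coeff_mem (coinvGrading (k + l)) Finset.univ
      (fun j => coinvX (k + l) (Fin.natAdd k j)) (fun i => coinvX_mem _ _) (l - (i + 1))
    convert h5 using 2
    simp [grassWeight]

theorem sum_T_prod {κ D E : Type} [Fintype κ] [Fintype D] [Fintype E] (r : κ → ℤ) (e : D → ℕ)
    (e' : E → ℕ) {p q : ℤ[X]} (hp : ∑ s, X ^ (2 * e s) = p) (hq : ∑ s, X ^ (2 * e' s) = q) :
    ∑ s : κ × (D × E), (LaurentPolynomial.T (r s.1 + (2 * (e s.2.1 : ℤ) + 2 * (e' s.2.2 : ℤ))) :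
      LaurentPolynomial ℤ) = (∑ s, LaurentPolynomial.T (r s)) * (p * q).toLaurent := by
  rw [map_mul, ← hp, ← hq, toLaurent_sum_pow, toLaurent_sum_pow, Finset.sum_mul_sum,
    ← Finset.univ_product_univ, ← Finset.sum_product', Finset.univ_product_univ, Finset.sum_mul_sum,
    ← Finset.sum_product']
  simp only [LaurentPolynomial.T_add]
  rfl

/-- Freeness multiplies Hilbert series: the unknown one times the two quantum factorials is that of
the coinvariants. The factor can be cancelled because Laurent polynomials form a domain and its
constant term is one. -/
theorem hasHilbert_grass :
    HasHilbert (reg (grassGrading k l)) (qBinom (k + l) k).toLaurent := by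
  obtain ⟨φ, D, E, _, _, e, e', hD, hE, hφ, hs, hs', hb⟩ := exists_coinv_basis_over_grass k l
  obtain ⟨κ, b, r, hr⟩ := (reg (grassGrading k l)).exists_homogeneous_basis
  obtain ⟨b', hb'⟩ := hb κ b
  have h1 := hasHilbert_coinv (k + l)
  have : Module.Finite ℂ (Coinv (k + l)) := h1.finite
  have : Finite (κ × (D × E)) := Module.Finite.finite_basis b'
  -- Fixing one basis element in each of the other two factors embeds `κ` in the finite index set of
  -- a basis of the coinvariants.
  have : Finite κ := Finite.of_injective (fun s : κ => (s, (hD.some, hE.some)))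
    fun s t h => (Prod.mk.inj h).1
  let := Fintype.ofFinite κ
  have h2 := hasHilbert_of_basis r b hr
  have h3 := hasHilbert_of_basis (M := reg (coinvGrading (k + l)))
    (fun s : κ × (D × E) => r s.1 + (2 * (∑ i, e s.2.1 i : ℕ) + 2 * (∑ i, e' s.2.2 i : ℕ))) b' (by
      intro s
      rw [hb']
      exact SetLike.mul_mem_graded (hφ _ _ (hr s.1))
        (SetLike.mul_mem_graded (coinvX_prod_mem _ _) (coinvX_prod_mem _ _)))
  have h5 := (sum_T_prod r (fun s => ∑ i, e s i) (fun s => ∑ i, e' s i) hs hs').symm.trans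
    (h3.unique h1)
  rw [← qBinom_add_mul, map_mul (Polynomial.toLaurent (R := ℤ)) (qBinom (k + l) k)] at h5
  have h6 : (qFact k * qFact l).toLaurent ≠ 0 := by
    rw [Ne, Polynomial.toLaurent_eq_zero]
    intro h
    have := congrArg (fun p => p.coeff 0) h
    simp [mul_coeff_zero, qFact_coeff_zero] at this
  exact mul_right_cancel₀ h6 h5 ▸ h2

end GrassHilbert

end

noncomputable section

/-! ### Assembling the theorem -/

section Main

open GrMod

/-- A polynomial Hilbert series has no negative degrees, and constant term one makes degree zero the
line spanned by `1`. -/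
theorem isConnectedGraded_of_hasHilbert {k A : Type} [Field k] [CommRing A] [Nontrivial A]
    [Algebra k A] {𝒜 : ℤ → Submodule k A} [GradedAlgebra 𝒜] {p : Polynomial ℤ}
    (hA : HasHilbert (reg 𝒜) p.toLaurent) (hp : p.coeff 0 = 1) : IsConnectedGraded 𝒜 where
  neg _ hi := hA.deg_eq_bot (coeff_toLaurent_neg p hi)
  zero a ha := by
    have h1 := hA.finrank_eq 0
    rw [show p.toLaurent.coeff 0 = p.coeff 0 from coeff_toLaurent_natCast p 0, hp] at h1
    have h2 : Module.finrank k (𝒜 0) = 1 := by exact_mod_cast h1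
    have h3 : (⟨1, SetLike.GradedOne.one_mem⟩ : 𝒜 0) ≠ 0 := fun h =>
      one_ne_zero (congrArg Subtype.val h)
    obtain ⟨c, hc⟩ := (finrank_eq_one_iff_of_nonzero' _ h3).1 h2 ⟨a, ha⟩
    exact ⟨c, by rw [Algebra.algebraMap_eq_smul_one]; exact congrArg Subtype.val hc⟩

instance (k l : ℕ) : Nontrivial (GrassCoh k l) := (grassAug k l).toRingHom.domain_nontrivial

theorem MatrixResolution.infinite_gr {k A : Type} [CommRing k] [CommRing A] [Nontrivial A]
    [Algebra k A] {𝒜 : ℤ → Submodule k A} [GradedAlgebra 𝒜] {ε : A →ₐ[k] k}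
    (R : MatrixResolution 𝒜 ε) (hε : ∀ i ≠ 0, ∀ a ∈ 𝒜 i, ε a = 0)
    (hI : IsNilpotent (RingHom.ker ε)) (hR : ∀ i, Nonempty (R.κ i))
    (P : ProjectiveResolution (triv 𝒜 ε hε)) : IsInfiniteResolution P := fun N =>
  ⟨N, le_rfl, not_isZero_of_minimal hI P (R.toGr hε) (R.toGr_minimal hε) N (by
    classical
    obtain ⟨s⟩ := hR N
    refine ⟨(DFinsupp.single s 1 : Π₀ _ : R.κ N, A), 0, fun h => ?_⟩
    have := DFunLike.congr_fun (F := Π₀ _ : R.κ N, A) h s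
    rw [DFinsupp.single_eq_same] at this
    exact one_ne_zero this)⟩

theorem MatrixResolution.infinite_mod {k A : Type} [CommRing k] [CommRing A] [Nontrivial A]
    [Algebra k A] {𝒜 : ℤ → Submodule k A} {ε : A →ₐ[k] k} (R : MatrixResolution 𝒜 ε)
    (hI : IsNilpotent (RingHom.ker ε)) (hR : ∀ i, Nonempty (R.κ i))
    (P : ProjectiveResolution (ModuleCat.of A (Triv ε))) : IsInfiniteResolution P := fun N =>
  ⟨N, le_rfl, ModuleCat.not_isZero_of_minimal hI P R.toMod R.toMod_minimal N
    (have := hR N; inferInstanceAs (Nontrivial (R.κ N → A)))⟩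

end Main

end

theorem mainTheorem2 (n : ℕ) (hn : 1 ≤ n) :
    (∃ h : Module.Finite ℂ (Coinv n),
      K0.cls (GrMod.reg (coinvGrading n)) h =
        (qFact n).toLaurent • K0.cls (coinvTriv n) (inferInstanceAs (Module.Finite ℂ ℂ))) ∧
    (2 ≤ n →
      (∀ P : ProjectiveResolution (coinvTriv n), IsInfiniteResolution P) ∧
      (∀ P : ProjectiveResolution (ModuleCat.of (Coinv n) (Triv (coinvAug n))),
        IsInfiniteResolution P)) ∧
    (∃ b : ℕ → ℤ →₀ ℕ,
      poincareSeries b * ∏ j ∈ Finset.Icc 2 n,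
          (1 - PowerSeries.C (LaurentPolynomial.T (2 * (j : ℤ))) * PowerSeries.X ^ 2) =
        (1 + PowerSeries.C (LaurentPolynomial.T 2) * PowerSeries.X) ^ (n - 1) ∧
      (∃ P : ProjectiveResolution (coinvTriv n), IsMinimalResolution (coinvAug n) P) ∧
      ∀ P : ProjectiveResolution (coinvTriv n), IsMinimalResolution (coinvAug n) P →
        ∀ i, Nonempty (P.complex.X i ≅ freeOfRank (coinvGrading n) (b i))) ∧
    (∃ E : LaurentSeries ℤ, IsGradedEulerChar (coinvTriv n) (coinvTriv n) E ∧
      E * toLaurentSeries (qFact n) = 1) ∧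
    (∀ k ≤ n,
      (∃ h : Module.Finite ℂ (GrassCoh k (n - k)),
        K0.cls (GrMod.reg (grassGrading k (n - k))) h =
          (qBinom n k).toLaurent •
            K0.cls (grassTriv k (n - k)) (inferInstanceAs (Module.Finite ℂ ℂ))) ∧
      ∃ E : LaurentSeries ℤ,
        IsGradedEulerChar (grassTriv k (n - k)) (grassTriv k (n - k)) E ∧
        E * toLaurentSeries (qBinom n k) = 1) := by
  obtain ⟨r, rfl⟩ : ∃ r, n = r + 1 := ⟨n - 1, by omega⟩
  obtain ⟨R, hR, hR'⟩ := exists_coinv_resolution r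
  have hI := coinvAug_ker_isNilpotent (r + 1)
  have hH := hasHilbert_coinv (r + 1)
  have hc := isConnectedGraded_of_hasHilbert hH (qFact_coeff_zero _)
  refine ⟨⟨hH.finite, hc.cls_eq _ hH _⟩, fun hr => ⟨R.infinite_gr _ hI (hR' (by omega)),
    R.infinite_mod hI (hR' (by omega))⟩, ⟨fun i => degreeCount (R.r i), hR,
    ⟨R.toGr _, R.toGr_minimal _⟩, fun P hP i => ?_⟩,
    exists_gradedEulerChar _ hH (qFact_coeff_zero _), fun k hk => ?_⟩
  -- An arbitrary minimal resolution is compared with the Koszul–Tate one, whose ranks are known.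
  · obtain ⟨e⟩ := GrMod.iso_of_minimal hI hP (R.toGr_minimal _) i
    obtain ⟨e'⟩ := GrMod.nonempty_iso_freeOfRank (𝒜 := coinvGrading (r + 1)) (R.r i)
    exact ⟨e ≪≫ e'⟩
  · have hG := hasHilbert_grass k (r + 1 - k)
    rw [Nat.add_sub_cancel' hk] at hG
    have hq := qBinom_coeff_zero _ _ hk
    have hc := isConnectedGraded_of_hasHilbert hG hq
    exact ⟨⟨hG.finite, hc.cls_eq _ hG _⟩, exists_gradedEulerChar _ hG hq⟩
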